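/- **Constrained Clustering with Outliers.** An instance consists of integers $m,n,k\ge 1$ and $B,\ell\ge 0$, a finite alphabet $\Sigma$ (after renaming the symbols, $\Sigma=\{0,\dots,|\Sigma|-1\}$), an $m\times n$ matrix $A$ over $\Sigma$ with columns $a^1,\dots,a^n\in\Sigma^m$, and relations $R_1,\dots,R_m\subseteq\Sigma^k$. The question is whether there are a set $O\subseteq\{1,\dots,n\}$ with $|O|\le \ell$, a partition of $\{1,\dots,n\}\setminus O$ into $k$ nonempty clusters $I_1,\dots,I_k$, and centers $c_1,\dots,c_k\in\Sigma^m$ such that $(c_1[h],\dots,c_k[h])\in R_h$ for every $1\le h\le m$ and $\sum_{i=1}^k\sum_{j\in I_i}d_H(a^j,c_i)\le B$, where $d_H$ is the Hamming distance. **Machine model.** Running time is measured on a word RAM (registers and indirectly addressed memory; constants, addition, truncated subtraction, multiplication, integer division, loads, stores and comparisons of registers each take one step; words hold the integers $0,\dots,W-1$ and no value may overflow). The input is in memory at the start: the numbers $m,n,|\Sigma|,k,B,\ell$, the matrix column by column, and for each $h$ the truth table of $R_h$, which has $|\Sigma|^k$ entries. Let $N$ be the length of this input plus $|\Sigma|+k+B+\ell$.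 **Theorem.** Constrained Clustering with Outliers is solvable in time $(kB)^{O(kB)}\,|\Sigma|^{kB}\cdot n^{O(k)}\cdot m^2$. That is, there are a single word-RAM program and an absolute constant $c\in\mathbb N$ such that, for every instance and every $W\ge N^{c}$, the program halts without overflow after at most $$c\cdot (kB)^{c\,kB}\cdot|\Sigma|^{kB}\cdot n^{c\,k}\cdot m^2$$ steps (with $0^0=1$ when $B=0$), reports correctly whether the instance is a yes-instance, and, if it is, has written into memory such a set $O$, such a partition and such centers. -/

import Mathlib

/-! ### The problem -/

/-- An instance of Constrained Clustering with Outliers: an alphabet `{0, …, s - 1}`, an `m × n`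
matrix `A` over it (entry `A h j` in row `h`, column `j`), the number `k` of clusters, the budget
`B`, the number `ℓ` of allowed outliers, and one `k`-ary relation `R h` for every row `h`. -/
structure CCOInstance where
  m : ℕ
  n : ℕ
  s : ℕ
  k : ℕ
  B : ℕ
  ℓ : ℕ
  m_pos : 0 < m
  n_pos : 0 < n
  k_pos : 0 < k
  A : Fin m → Fin n → Fin s
  R : Fin m → Finset (Fin k → Fin s)

namespace CCOInstance

/-- Column `j` of the matrix. -/
def col (I : CCOInstance) (j : Fin I.n) : Fin I.m → Fin I.s := fun h => I.A h j

/-- The ordered tuple of vectors `c` satisfies the relations of the instance. -/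
def Satisfies (I : CCOInstance) (c : Fin I.k → Fin I.m → Fin I.s) : Prop :=
  ∀ h : Fin I.m, (fun i : Fin I.k => c i h) ∈ I.R h

/-- `O` is the set of outliers, `cl` the partition of the other columns into `k` nonempty clusters,
and `c` the tuple of centers. -/
def IsSolution (I : CCOInstance) (O : Finset (Fin I.n)) (cl : Fin I.k → Finset (Fin I.n))
    (c : Fin I.k → Fin I.m → Fin I.s) : Prop :=
  O.card ≤ I.ℓ ∧
  (∀ i, (cl i).Nonempty) ∧
  (∀ i i', i ≠ i' → Disjoint (cl i) (cl i')) ∧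
  (∀ j, j ∉ O ↔ ∃ i, j ∈ cl i) ∧
  I.Satisfies c ∧
  ∑ i, ∑ j ∈ cl i, hammingDist (I.col j) (c i) ≤ I.B

/-- The instance is a yes-instance. -/
def IsYes (I : CCOInstance) : Prop := ∃ O cl c, I.IsSolution O cl c

/-- The instance as a sequence of machine words: the six numbers; the matrix, column by column;
and for each row the truth table of its relation, where the tuple `t` has index `∑ i, t i * s ^ i`. -/
def input (I : CCOInstance) : List ℕ :=
  [I.m, I.n, I.s, I.k, I.B, I.ℓ]
  ++ List.ofFn (fun p : Fin (I.n * I.m) =>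
      (I.A (finProdFinEquiv.symm p).2 (finProdFinEquiv.symm p).1 : ℕ))
  ++ List.ofFn (fun p : Fin (I.m * I.s ^ I.k) =>
      if finFunctionFinEquiv.symm (finProdFinEquiv.symm p).2 ∈ I.R (finProdFinEquiv.symm p).1
      then 1 else 0)

/-- The size of the instance; it bounds the length of the input and every number in it
(`m` and `n` are at most the length). -/
def size (I : CCOInstance) : ℕ := I.input.length + I.s + I.k + I.B + I.ℓ

end CCOInstance

/-! ### The machine: a word RAM with structured control flow -/

namespace WordRAM

/-- Contents of the registers and of the memory. -/
structure State where
  reg : ℕ → ℕ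
  mem : ℕ → ℕ

/-- Arithmetic of the machine; `sub` is truncated, `div` rounds down (and `x / 0 = 0`). -/
inductive Op
  | add
  | sub
  | mul
  | div

def Op.eval : Op → ℕ → ℕ → ℕ
  | .add, x, y => x + y
  | .sub, x, y => x - y
  | .mul, x, y => x * y
  | .div, x, y => x / y

/-- Instructions. The arguments are register numbers, except for the constant `v`. -/
inductive Instr
  /-- `r[d] := v` -/
  | const (d v : ℕ)
  /-- `r[d] := r[a] o r[b]` -/
  | op (o : Op) (d a b : ℕ)
  /-- `r[d] := M[r[a]]` -/
  | load (d a : ℕ)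
  /-- `M[r[a]] := r[b]` -/
  | store (a b : ℕ)

/-- Effect of an instruction on a machine whose words hold the integers `0, …, W - 1`;
`none` on overflow. -/
def Instr.eval (W : ℕ) : Instr → State → Option State
  | .const d v, σ =>
      if v < W then some { σ with reg := Function.update σ.reg d v } else none
  | .op o d a b, σ =>
      if o.eval (σ.reg a) (σ.reg b) < W
      then some { σ with reg := Function.update σ.reg d (o.eval (σ.reg a) (σ.reg b)) } else none
  | .load d a, σ =>
      some { σ with reg := Function.update σ.reg d (σ.mem (σ.reg a)) }
  | .store a b, σ =>
      some { σ with mem := Function.update σ.mem (σ.reg a) (σ.reg b) }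

/-- Programs. The tests compare the contents of two registers: `r[a] < r[b]`. -/
inductive Prog
  | skip
  | instr (i : Instr)
  | seq (p q : Prog)
  | ite (a b : ℕ) (p q : Prog)
  | while (a b : ℕ) (p : Prog)

/-- `Exec W p σ t σ'`: on a machine whose words hold `0, …, W - 1`, the program `p` started in
state `σ` halts without overflow in state `σ'` after exactly `t` steps, where each instruction and
each test is one step. -/
inductive Exec (W : ℕ) : Prog → State → ℕ → State → Prop
  | skip (σ : State) : Exec W .skip σ 0 σ
  | instr {i : Instr} {σ σ' : State} (h : i.eval W σ = some σ') : Exec W (.instr i) σ 1 σ'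
  | seq {p q : Prog} {σ σ' σ'' : State} {t t' : ℕ} (hp : Exec W p σ t σ')
      (hq : Exec W q σ' t' σ'') : Exec W (.seq p q) σ (t + t') σ''
  | ite_true {a b : ℕ} {p q : Prog} {σ σ' : State} {t : ℕ} (h : σ.reg a < σ.reg b)
      (hp : Exec W p σ t σ') : Exec W (.ite a b p q) σ (t + 1) σ'
  | ite_false {a b : ℕ} {p q : Prog} {σ σ' : State} {t : ℕ} (h : ¬ σ.reg a < σ.reg b)
      (hq : Exec W q σ t σ') : Exec W (.ite a b p q) σ (t + 1) σ'
  | while_true {a b : ℕ} {p : Prog} {σ σ' σ'' : State} {t t' : ℕ} (h : σ.reg a < σ.reg b)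
      (hp : Exec W p σ t σ') (hw : Exec W (.while a b p) σ' t' σ'') :
      Exec W (.while a b p) σ (t + t' + 1) σ''
  | while_false {a b : ℕ} {p : Prog} {σ : State} (h : ¬ σ.reg a < σ.reg b) :
      Exec W (.while a b p) σ 1 σ

/-- The start state: `w` is at the beginning of the memory, everything else is `0`. -/
def init (w : List ℕ) : State where
  reg := fun _ => 0
  mem := fun a => w.getD a 0

end WordRAM

namespace CCOInstance

/-- The memory contains the solution `(O, cl, c)`: from address `r[1]` on, for every column, the
label `0` (outlier) or the number (from `1` on) of its cluster; from address `r[2]` on, the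
centers, one after the other. -/
def Writes (I : CCOInstance) (O : Finset (Fin I.n)) (cl : Fin I.k → Finset (Fin I.n))
    (c : Fin I.k → Fin I.m → Fin I.s) (σ : WordRAM.State) : Prop :=
  (∀ j ∈ O, σ.mem (σ.reg 1 + (j : ℕ)) = 0) ∧
  (∀ i, ∀ j ∈ cl i, σ.mem (σ.reg 1 + (j : ℕ)) = (i : ℕ) + 1) ∧
  (∀ (i : Fin I.k) (h : Fin I.m), σ.mem (σ.reg 2 + ((i : ℕ) * I.m + (h : ℕ))) = (c i h : ℕ))

/-- The state `σ` holds the correct answer: `r[0]` is `1` on a yes-instance, and then a solution is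
written in memory, and `r[0]` is `0` on a no-instance. -/
def CorrectOutput (I : CCOInstance) (σ : WordRAM.State) : Prop :=
  (I.IsYes → σ.reg 0 = 1 ∧ ∃ O cl c, I.IsSolution O cl c ∧ I.Writes O cl c σ) ∧
  (¬ I.IsYes → σ.reg 0 = 0)

end CCOInstance

/-!
Let `(O, cl, c)` be a solution, and let `r i` be a column of cluster `i`; a row `h` is changed if
the tuple `c · h` differs from the tuple of the entries of the reference columns `r`. The centers
are known as soon as the reference columns, the changed rows, and the entries of the centers in
these rows are known; given the centers and one column of each cluster, the best labels are found by
sending every other column to a nearest center and dropping the most expensive ones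
(`CCOInstance.Valid.nearest_labels`). There are `n ^ k` choices of `r` and, if at most `B` rows are
changed, `s ^ (k * B)` choices of entries. What has to be saved is the factor `m ^ B` for a naive
choice of the changed rows.

Take a solution for which the total distance of the reference columns from the centers is least.
Then every reference column is closest to its center within its cluster, so the rows in which some
`r i` differs from its center number at most `B`. A changed row either violates its relation at the
reference columns, which the algorithm sees, or could be set to the entries of the reference columns
and therefore, by minimality, is popular in some cluster `i` whose center differs from `r i` in row
`h`: more than half of the columns of the cluster differ from `r i` there
(`CCOInstance.Valid.exists_refs`). A popular row `h` of cluster `i` is encoded by its rank, when the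
rows are ordered by the number of columns that differ from `r i` in them, where only the columns at
distance at most `B` from `r i` are counted which differ from `r i` in all the popular rows of
cluster `i` found before in which some fixed column `t` of the cluster, different from `r i` in row
`h`, differs from `r i` as well. Each of the columns counted contributes to at most `B` rows, so
restricting the columns further to those that differ in row `h` divides their number by at least
`(rank + 1) / B` (`rowRank_succ_mul_le`). For a fixed `t` this telescopes: the ranks belonging to
the rows where `t` differs have a product of at most `B ^ d * n`. If `t` is chosen for each row so
that the rank is least, this holds for all columns `t` of the cluster, and since every popular row
belongs to more than half of them, the product of all ranks in the cluster is at most `(B ^ d * n) ^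
2` (`prod_rowRank_le`). Hence all ranks together can be written with `2 * B * log B + 2 * k * log n
+ O(B)` binary digits, and the columns `t` need to be known only through their incidences with the
popular rows, of which there are at most `B`: a popular row has at most as many incidences as its
cluster has columns, and the popular rows of cluster `i` are no more than the distance of each of
its columns from the center, as `r i` is closest to the center and differs from it in these rows. So
some `(k * B) ^ O(k * B) * n ^ O(k)` guesses replace `m ^ B` (`CCOInstance.Valid.exists_goodGuess`,
`CCOInstance.guessCount_le`).

The program is an odometer over all guess vectors. It decodes each one, computes labels and centers,
and checks from scratch whether they are a solution, so that only completeness depends on the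
argument above (`CCOInstance.run_verify`, `CCOInstance.IsYes.exists_guessVec`). It is written in a
small imperative language whose loops have a number of rounds fixed in advance. The language has a
denotation as a total function on states, its translation to the word RAM is correct and cannot
overflow (`Imp.Cm.exec_code`), and the number of steps is at most a constant times `Z ^ a * m ^ b`,
where `b` is the nesting depth of the loops over the rows and `a` that of the other loops, all of
which have at most `Z` rounds (`Imp.Cm.time_le`). For one round of the search `b = 2` and `a = 3`.
-/

set_option linter.constructorNameAsVariable false

/-! ### A small imperative language on top of the word RAM -/

namespace Imp

open WordRAM

/-- The named variables of the programs. The number of a variable is its register; the first three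
are the registers prescribed for the output. -/
inductive Var
  | ans | out1 | out2 | zero
  | m | n | s | k | B | l | sk | oR | L | T | gT | gV | gU | gS | gY
  | go | p | b | v | j | h | h2 | i | e | j2 | x | w | cl | tt | rr | rho | dist | ok | cnt
  | idx | pw | u | bc | bad | tot | carry | kB | lamB | lamn
  deriving DecidableEq

/-- The named arrays of the programs. -/
inductive Arr
  | G | rad | deg | hrow | pk | cen | lab | cost | ref
  deriving DecidableEq

/-- The register of a variable. -/
def Var.reg (x : Var) : ℕ := x.ctorIdx

/-- The residue class that holds an array. -/
def Arr.slot (a : Arr) : ℕ := a.ctorIdx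

/-- The register that holds the address at which the arrays start. -/
abbrev baseReg : ℕ := 64

/-- The register that holds the strict bound for the values of variables and array entries. -/
abbrev capReg : ℕ := 65

/-- The first register used for temporary values. -/
abbrev tmp : ℕ := 66

/-- The stride of the arrays: entry `i` of the array `a` has address `base + stride * i + a.slot`. -/
abbrev stride : ℕ := 16

theorem Var.reg_injective : Function.Injective Var.reg := fun x y hxy => by
  rw [← Var.ofNat_ctorIdx x, ← Var.ofNat_ctorIdx y]
  exact congrArg Var.ofNat hxy

theorem Arr.slot_injective : Function.Injective Arr.slot := fun x y hxy => by
  rw [← Arr.ofNat_ctorIdx x, ← Arr.ofNat_ctorIdx y]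
  exact congrArg Arr.ofNat hxy

theorem Var.reg_lt (x : Var) : x.reg < 64 := by cases x <;> decide

theorem Arr.slot_lt (a : Arr) : a.slot < 16 := by cases a <;> decide

/-- States of the language: the variables, the arrays, the memory below the address `base`, and the
two constants `base` and `cap`. -/
structure HState where
  reg : Var → ℕ
  arr : Arr → ℕ → ℕ
  low : ℕ → ℕ
  base : ℕ
  cap : ℕ

namespace HState

/-- Values that do not stay below `cap` are replaced by `0`. This makes overflow impossible by
construction, at the price that the value of an assignment is known only below `cap`. -/
def clamp (S : HState) (v : ℕ) : ℕ := if v < S.cap then v else 0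

/-- Assignment to a variable. -/
def setReg (S : HState) (x : Var) (v : ℕ) : HState :=
  { S with reg := Function.update S.reg x v }

/-- Assignment to an array entry. -/
def setArr (S : HState) (a : Arr) (i v : ℕ) : HState :=
  { S with arr := Function.update S.arr a (Function.update (S.arr a) i v) }

/-- Assignment to a memory cell below `base`; other addresses are ignored. -/
def setLow (S : HState) (i v : ℕ) : HState :=
  if i < S.base then { S with low := Function.update S.low i v } else S

/-- The machine state that represents a state of the language; all temporary registers are `0`. -/
noncomputable def conc (S : HState) : State where
  reg := Function.extend Var.reg S.reg
    (fun r => if r = baseReg then S.base else if r = capReg then S.cap else 0)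
  mem := fun a => if a < S.base then S.low a else
    Function.extend Arr.slot S.arr (fun _ _ => 0) ((a - S.base) % stride) ((a - S.base) / stride)

@[simp] theorem setReg_reg (S : HState) (x y : Var) (v : ℕ) :
    (S.setReg x v).reg y = if y = x then v else S.reg y := by
  simp [setReg, Function.update_apply]
@[simp] theorem setReg_arr (S : HState) (x : Var) (v : ℕ) : (S.setReg x v).arr = S.arr := rfl
@[simp] theorem setReg_low (S : HState) (x : Var) (v : ℕ) : (S.setReg x v).low = S.low := rfl
@[simp] theorem setReg_base (S : HState) (x : Var) (v : ℕ) : (S.setReg x v).base = S.base := rfl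
@[simp] theorem setReg_cap (S : HState) (x : Var) (v : ℕ) : (S.setReg x v).cap = S.cap := rfl
@[simp] theorem setArr_reg (S : HState) (a : Arr) (i v : ℕ) : (S.setArr a i v).reg = S.reg := rfl
@[simp] theorem setArr_arr (S : HState) (a a' : Arr) (i i' v : ℕ) :
    (S.setArr a i v).arr a' i' = if a' = a ∧ i' = i then v else S.arr a' i' := by
  by_cases h : a' = a
  · subst h; by_cases h' : i' = i <;> simp [setArr, h']
  · simp [setArr, h]
@[simp] theorem setArr_low (S : HState) (a : Arr) (i v : ℕ) : (S.setArr a i v).low = S.low := rfl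
@[simp] theorem setArr_base (S : HState) (a : Arr) (i v : ℕ) :
    (S.setArr a i v).base = S.base := rfl
@[simp] theorem setArr_cap (S : HState) (a : Arr) (i v : ℕ) : (S.setArr a i v).cap = S.cap := rfl
@[simp] theorem setLow_reg (S : HState) (i v : ℕ) : (S.setLow i v).reg = S.reg := by
  unfold setLow; split <;> rfl
@[simp] theorem setLow_arr (S : HState) (i v : ℕ) : (S.setLow i v).arr = S.arr := by
  unfold setLow; split <;> rfl
@[simp] theorem setLow_base (S : HState) (i v : ℕ) : (S.setLow i v).base = S.base := by
  unfold setLow; split <;> rfl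
@[simp] theorem setLow_cap (S : HState) (i v : ℕ) : (S.setLow i v).cap = S.cap := by
  unfold setLow; split <;> rfl

theorem setReg_comm (S : HState) {x y : Var} (h : x ≠ y) (v w : ℕ) :
    (S.setReg x v).setReg y w = (S.setReg y w).setReg x v := by
  simp [setReg, Function.update_comm h]

@[simp] theorem setReg_setReg (S : HState) (x : Var) (v w : ℕ) :
    (S.setReg x v).setReg x w = S.setReg x w := by
  simp [setReg]

theorem clamp_of_lt {S : HState} {v : ℕ} (h : v < S.cap) : S.clamp v = v := if_pos h

theorem clamp_le (S : HState) (v : ℕ) : S.clamp v ≤ S.cap := by unfold clamp; split <;> omega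

theorem conc_reg (S : HState) (x : Var) : S.conc.reg x.reg = S.reg x := by
  simp only [conc, Var.reg_injective.extend_apply]

theorem conc_reg_of_ge (S : HState) {r : ℕ} (hr : 64 ≤ r) :
    S.conc.reg r = if r = baseReg then S.base else if r = capReg then S.cap else 0 := by
  simp only [conc]
  rw [Function.extend_apply' _ _ _ fun ⟨x, hx⟩ => by have := x.reg_lt; omega]

@[simp] theorem conc_base (S : HState) : S.conc.reg 64 = S.base := by
  rw [conc_reg_of_ge _ le_rfl]; simp

@[simp] theorem conc_cap (S : HState) : S.conc.reg 65 = S.cap := by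
  rw [conc_reg_of_ge _ (by decide)]; simp

theorem conc_tmp (S : HState) {r : ℕ} (hr : 66 ≤ r) : S.conc.reg r = 0 := by
  rw [conc_reg_of_ge _ (by omega), if_neg (by simp only [baseReg]; omega),
    if_neg (by simp only [capReg]; omega)]

theorem conc_mem_low (S : HState) {a : ℕ} (h : a < S.base) : S.conc.mem a = S.low a := if_pos h

theorem conc_mem_arr (S : HState) (a : Arr) (i : ℕ) :
    S.conc.mem (S.base + stride * i + a.slot) = S.arr a i := by
  have h1 : ¬ S.base + stride * i + a.slot < S.base := by omega
  have ha := a.slot_lt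
  have h2 : (S.base + stride * i + a.slot - S.base) % stride = a.slot := by
    simp only [stride]; omega
  have h3 : (S.base + stride * i + a.slot - S.base) / stride = i := by
    simp only [stride]; omega
  simp only [conc, if_neg h1, h2, h3, Arr.slot_injective.extend_apply]

theorem conc_setReg (S : HState) (x : Var) (v : ℕ) :
    (S.setReg x v).conc = { S.conc with reg := Function.update S.conc.reg x.reg v } := by
  have : (S.setReg x v).conc.reg = Function.update S.conc.reg x.reg v := by
    funext r
    by_cases hr : ∃ y : Var, y.reg = r
    · obtain ⟨y, rfl⟩ := hr
      by_cases h : y = x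
      · simp [conc_reg, h]
      · rw [conc_reg, Function.update_of_ne (fun h' => h (Var.reg_injective h')), conc_reg]
        simp [h]
    · have hne : r ≠ x.reg := fun h => hr ⟨x, h.symm⟩
      rw [Function.update_of_ne hne]
      simp only [conc]
      rw [Function.extend_apply' _ _ _ hr, Function.extend_apply' _ _ _ hr]
      rfl
  rw [← this]; rfl

theorem conc_setArr (S : HState) (a : Arr) (i v : ℕ) :
    (S.setArr a i v).conc =
      { S.conc with mem := Function.update S.conc.mem (S.base + stride * i + a.slot) v } := by
  have : (S.setArr a i v).conc.mem =
      Function.update S.conc.mem (S.base + stride * i + a.slot) v := by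
    funext r
    by_cases hr : r < S.base
    · rw [Function.update_of_ne (by omega), conc_mem_low _ hr, conc_mem_low _ (by simpa using hr)]
      rfl
    · by_cases hs : ∃ a' : Arr, a'.slot = (r - S.base) % stride
      · obtain ⟨a', ha'⟩ := hs
        have hr' : r = S.base + stride * ((r - S.base) / stride) + a'.slot := by
          rw [ha']; simp only [stride]; omega
        generalize (r - S.base) / stride = q at hr'
        subst hr'
        rw [show S.base = (S.setArr a i v).base from rfl, conc_mem_arr, setArr_arr]
        simp only [setArr_base]
        have h1 := a.slot_lt
        have h2 := a'.slot_lt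
        by_cases h : a' = a ∧ q = i
        · rw [if_pos h, h.1, h.2, Function.update_self]
        · rw [if_neg h, Function.update_of_ne, conc_mem_arr]
          intro h'
          apply h
          have h3 : a'.slot = a.slot := by simp only [stride] at h'; omega
          exact ⟨Arr.slot_injective h3, by simp only [stride] at h'; omega⟩
      · have hne : r ≠ S.base + stride * i + a.slot := fun h =>
          hs ⟨a, by have := a.slot_lt; simp only [stride] at h ⊢; omega⟩
        rw [Function.update_of_ne hne]
        simp only [conc, setArr_base, if_neg hr]
        rw [Function.extend_apply' _ _ _ hs, Function.extend_apply' _ _ _ hs]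
        simp [hr]
  rw [← this]; rfl

theorem conc_setLow (S : HState) {i : ℕ} (hi : i < S.base) (v : ℕ) :
    (S.setLow i v).conc = { S.conc with mem := Function.update S.conc.mem i v } := by
  have : (S.setLow i v).conc.mem = Function.update S.conc.mem i v := by
    funext r
    by_cases hr : r < S.base
    · rw [conc_mem_low _ (by simpa using hr)]
      by_cases h : r = i
      · subst h; simp [setLow, hi]
      · simp [setLow, hi, h, conc_mem_low _ hr]
    · rw [Function.update_of_ne (by omega)]
      simp [conc, hr]
  rw [← this]; simp [setLow, hi, conc]

/-- All values occurring in the state are at most `Y`. -/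
structure Bdd (S : HState) (Y : ℕ) : Prop where
  reg : ∀ x, S.reg x ≤ Y
  arr : ∀ a i, S.arr a i ≤ Y
  low : ∀ i, S.low i ≤ Y
  base : S.base ≤ Y
  cap : S.cap ≤ Y

theorem Bdd.setReg {S : HState} {Y : ℕ} (h : S.Bdd Y) (x : Var) {v : ℕ} (hv : v ≤ Y) :
    (S.setReg x v).Bdd Y :=
  ⟨fun y => by rw [setReg_reg]; split <;> simp [hv, h.reg], h.arr, h.low, h.base, h.cap⟩

theorem Bdd.setArr {S : HState} {Y : ℕ} (h : S.Bdd Y) (a : Arr) (i : ℕ) {v : ℕ} (hv : v ≤ Y) :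
    (S.setArr a i v).Bdd Y :=
  ⟨h.reg, fun b j => by rw [setArr_arr]; split <;> simp [hv, h.arr], h.low, h.base, h.cap⟩

theorem Bdd.setLow {S : HState} {Y : ℕ} (h : S.Bdd Y) (i : ℕ) {v : ℕ} (hv : v ≤ Y) :
    (S.setLow i v).Bdd Y := by
  unfold HState.setLow
  split
  · exact ⟨h.reg, h.arr, fun j => by
      simp only [Function.update_apply]; split <;> simp [hv, h.low], h.base, h.cap⟩
  · exact h

end HState

/-- Expressions: variables, constants, arithmetic, array entries, and memory cells below `base`. -/
inductive Ex
  | var (x : Var)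
  | lit (c : ℕ)
  | op (o : Op) (a b : Ex)
  | get (a : Arr) (i : Ex)
  | peek (a : Ex)

namespace Ex

/-- The value of an expression. -/
def eval (S : HState) : Ex → ℕ
  | var x => S.reg x
  | lit c => c
  | op o a b => o.eval (a.eval S) (b.eval S)
  | get a i => S.arr a (i.eval S)
  | peek a => if a.eval S < S.base then S.low (a.eval S) else 0

/-- Turn the index in register `d` into the address of the entry of the array `a`, using the
register `d + 1`. -/
def addrCode (d : ℕ) (a : Arr) : Prog :=
  .seq (.instr (.const (d + 1) stride)) <| .seq (.instr (.op .mul d d (d + 1))) <|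
  .seq (.instr (.const (d + 1) a.slot)) <| .seq (.instr (.op .add d d (d + 1))) <|
  .seq (.instr (.const (d + 1) 0)) (.instr (.op .add d baseReg d))

/-- Code that puts the value of an expression into register `d`; it uses the registers above `d`
and leaves `0` in them. -/
def code (d : ℕ) : Ex → Prog
  | var x => .instr (.op .add d x.reg (d + 1))
  | lit c => .instr (.const d c)
  | op o a b => .seq (a.code d) <| .seq (b.code (d + 1)) <|
      .seq (.instr (.op o d d (d + 1))) (.instr (.const (d + 1) 0))
  | get a i => .seq (i.code d) <| .seq (addrCode d a) (.instr (.load d d))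
  | peek a => .seq (a.code d) (.ite d baseReg (.instr (.load d d)) (.instr (.const d 0)))

/-- A bound for the number of steps of the code. -/
def time : Ex → ℕ
  | var _ => 1
  | lit _ => 1
  | op _ a b => a.time + b.time + 2
  | get _ i => i.time + 7
  | peek a => a.time + 2

/-- The value of an expression is at most `Y ^ deg` if all values in the state are at most `Y`. -/
def deg : Ex → ℕ
  | var _ => 1
  | lit _ => 1
  | op .add a b => max a.deg b.deg + 1
  | op .sub a _ => a.deg
  | op .mul a b => a.deg + b.deg
  | op .div a _ => a.deg
  | get _ _ => 1
  | peek _ => 1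

/-- The constants are small, and the degrees of all intermediate values are less than `D`. -/
def fits (D : ℕ) : Ex → Bool
  | var _ => 1 < D
  | lit c => c ≤ 16 && 1 < D
  | op o a b => a.fits D && b.fits D && (op o a b).deg < D
  | get _ i => i.fits D && i.deg + 2 < D
  | peek a => a.fits D && 1 < D

theorem eval_le {S : HState} {Y : ℕ} (hY : 16 ≤ Y) (hS : S.Bdd Y) {D : ℕ} :
    ∀ e : Ex, e.fits D → e.eval S ≤ Y ^ e.deg
  | var x, _ => by simpa [eval, deg] using hS.reg x
  | lit c, h => by simp [fits] at h; simp [eval, deg]; omega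
  | op o a b, h => by
    simp only [fits, Bool.and_eq_true] at h
    have ha := eval_le hY hS a h.1.1
    have hb := eval_le hY hS b h.1.2
    cases o with
    | add =>
      simp only [eval, deg, Op.eval]
      have h1 : Y ^ a.deg ≤ Y ^ (max a.deg b.deg) :=
        Nat.pow_le_pow_right (by omega) (le_max_left ..)
      have h2 : Y ^ b.deg ≤ Y ^ (max a.deg b.deg) :=
        Nat.pow_le_pow_right (by omega) (le_max_right ..)
      rw [pow_succ]
      nlinarith
    | sub => simp only [eval, deg, Op.eval]; omega
    | mul => simp only [eval, deg, Op.eval, pow_add]; exact Nat.mul_le_mul ha hb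
    | div => simp only [eval, deg, Op.eval]; exact (Nat.div_le_self _ _).trans ha
  | get a i, _ => by simpa [eval, deg] using hS.arr a _
  | peek a, _ => by
    simp only [eval, deg, pow_one]; split
    · exact hS.low _
    · omega

theorem deg_lt {D : ℕ} : ∀ e : Ex, e.fits D → e.deg < D
  | var x, h => by simpa [fits, deg] using h
  | lit c, h => by simp [fits] at h; simp [deg]; omega
  | op o a b, h => by simp only [fits, Bool.and_eq_true, decide_eq_true_eq] at h; exact h.2
  | get a i, h => by
    simp only [fits, Bool.and_eq_true, decide_eq_true_eq] at h; simp only [deg]; omega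
  | peek a, h => by
    simp only [fits, Bool.and_eq_true, decide_eq_true_eq] at h; simp only [deg]; omega

theorem eval_lt {S : HState} {Y : ℕ} (hY : 16 ≤ Y) (hS : S.Bdd Y) {D : ℕ} {e : Ex}
    (h : e.fits D) : e.eval S < Y ^ D :=
  (eval_le hY hS e h).trans_lt (Nat.pow_lt_pow_right (by omega) (e.deg_lt h))

theorem addr_lt {S : HState} {Y : ℕ} (hY : 16 ≤ Y) (hS : S.Bdd Y) {D : ℕ} {e : Ex}
    (h : e.fits D) (hd : e.deg + 2 < D) (a : Arr) :
    S.base + (stride * e.eval S + a.slot) < Y ^ D := by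
  have h1 := eval_le hY hS e h
  have h2 := hS.base
  have h3 := a.slot_lt
  have h4 : 1 ≤ Y ^ e.deg := Nat.one_le_pow _ _ (by omega)
  have h5 : Y ^ (e.deg + 2) < Y ^ D := Nat.pow_lt_pow_right (by omega) hd
  have h6 : Y ^ (e.deg + 2) = Y ^ e.deg * Y * Y := by ring
  have h7 : Y ^ e.deg * Y * 16 ≤ Y ^ e.deg * Y * Y := Nat.mul_le_mul_left _ hY
  have h8 : Y ^ e.deg * 16 ≤ Y ^ e.deg * Y := Nat.mul_le_mul_left _ hY
  have h9 : 1 * Y ≤ Y ^ e.deg * Y := Nat.mul_le_mul_right _ h4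
  simp only [stride]
  omega

/-- The machine state after an assignment to a register. -/
def _root_.WordRAM.State.setReg (σ : State) (d v : ℕ) : State :=
  { σ with reg := Function.update σ.reg d v }

@[simp] theorem _root_.WordRAM.State.setReg_mem (σ : State) (d v : ℕ) :
    (σ.setReg d v).mem = σ.mem := rfl

@[simp] theorem _root_.WordRAM.State.setReg_reg (σ : State) (d v r : ℕ) :
    (σ.setReg d v).reg r = if r = d then v else σ.reg r := Function.update_apply ..

theorem _root_.WordRAM.State.setReg_setReg (σ : State) (d v w : ℕ) :
    (σ.setReg d v).setReg d w = σ.setReg d w := by simp [State.setReg]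

theorem _root_.WordRAM.State.ext_setReg {σ τ : State} (h : ∀ r, σ.reg r = τ.reg r)
    (h' : σ.mem = τ.mem) : σ = τ := by
  cases σ; cases τ
  simp only at h'
  simp only [h', State.mk.injEq, and_true]
  exact funext h

theorem _root_.WordRAM.Exec.congr {W t : ℕ} {p : Prog} {σ σ' σ'' : State}
    (h : Exec W p σ t σ') (h' : σ' = σ'') : Exec W p σ t σ'' := h' ▸ h

theorem _root_.WordRAM.Exec.op' {W : ℕ} {o : Op} {d a b : ℕ} {σ : State} {v : ℕ}
    (hv : o.eval (σ.reg a) (σ.reg b) = v) (h : v < W) :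
    Exec W (.instr (.op o d a b)) σ 1 (σ.setReg d v) := by
  subst hv
  exact .instr (by simp [Instr.eval, h, State.setReg])

theorem _root_.WordRAM.Exec.const' {W : ℕ} {d v : ℕ} {σ : State} (h : v < W) :
    Exec W (.instr (.const d v)) σ 1 (σ.setReg d v) :=
  .instr (by simp [Instr.eval, h, State.setReg])

theorem _root_.WordRAM.Exec.load' {W : ℕ} {d a : ℕ} {σ : State} {v : ℕ}
    (hv : σ.mem (σ.reg a) = v) : Exec W (.instr (.load d a)) σ 1 (σ.setReg d v) := by
  subst hv
  exact .instr (by simp [Instr.eval, State.setReg])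

theorem _root_.WordRAM.Exec.store' {W : ℕ} {a b : ℕ} {σ : State} {u v : ℕ}
    (hu : σ.reg a = u) (hv : σ.reg b = v) :
    Exec W (.instr (.store a b)) σ 1 { σ with mem := Function.update σ.mem u v } := by
  subst hu hv
  exact .instr (by simp [Instr.eval])

theorem exec_addrCode {W : ℕ} {σ : State} {d : ℕ} {a : Arr} (hd : tmp ≤ d)
    (h0 : σ.reg (d + 1) = 0) (hW : σ.reg baseReg + (stride * σ.reg d + a.slot) < W)
    (h16 : 16 < W) :
    Exec W (addrCode d a) σ 6 (σ.setReg d (σ.reg baseReg + stride * σ.reg d + a.slot)) := by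
  have ha := a.slot_lt
  have h1 : d ≠ d + 1 := by omega
  have h2 : baseReg ≠ d := by simp only [baseReg, tmp] at *; omega
  have h3 : baseReg ≠ d + 1 := by simp only [baseReg, tmp] at *; omega
  have e1 := Exec.const' (σ := σ) (d := d + 1) (v := stride) h16
  have e2 := Exec.op' (W := W) (o := .mul) (d := d) (a := d) (b := d + 1)
    (σ := σ.setReg (d + 1) stride)
    (v := stride * σ.reg d) (by simp [Op.eval, Nat.mul_comm]) (by omega)
  have e3 := Exec.const' (W := W)
    (σ := (σ.setReg (d + 1) stride).setReg d (stride * σ.reg d))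
    (d := d + 1) (v := a.slot) (by omega)
  have e4 := Exec.op' (W := W) (o := .add) (d := d) (a := d) (b := d + 1)
    (σ := ((σ.setReg (d + 1) stride).setReg d (stride * σ.reg d)).setReg (d + 1) a.slot)
    (v := stride * σ.reg d + a.slot) (by simp [Op.eval]) (by omega)
  have e5 := Exec.const' (W := W) (d := d + 1) (v := 0)
    (σ := (((σ.setReg (d + 1) stride).setReg d (stride * σ.reg d)).setReg (d + 1) a.slot).setReg d
      (stride * σ.reg d + a.slot)) (by omega)
  have e6 := Exec.op' (W := W) (o := .add) (d := d) (a := baseReg) (b := d)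
    (σ := ((((σ.setReg (d + 1) stride).setReg d (stride * σ.reg d)).setReg (d + 1) a.slot).setReg d
      (stride * σ.reg d + a.slot)).setReg (d + 1) 0)
    (v := σ.reg baseReg + stride * σ.reg d + a.slot)
    (by simp [Op.eval, h2, h3, Nat.add_assoc]) (by omega)
  have := Exec.seq e1 (Exec.seq e2 (Exec.seq e3 (Exec.seq e4 (Exec.seq e5 e6))))
  refine this.congr (State.ext_setReg (fun r => ?_) rfl)
  by_cases hr : r = d
  · subst hr; simp
  · by_cases hr' : r = d + 1
    · subst hr'; simp [h0]
    · simp [hr, hr']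

theorem exec_code {W Y D : ℕ} (hY : 16 ≤ Y) (hW : Y ^ D ≤ W) {S : HState} (hS : S.Bdd Y) :
    ∀ (e : Ex), e.fits D → ∀ (d : ℕ) (σ : State), tmp ≤ d → σ.mem = S.conc.mem →
      (∀ r < tmp, σ.reg r = S.conc.reg r) → (∀ r, d ≤ r → σ.reg r = 0) →
      ∃ t ≤ e.time, Exec W (e.code d) σ t (σ.setReg d (e.eval S))
  | var x, he, d, σ, hd, _, hr, h0 => by
    refine ⟨1, le_rfl, .op' ?_ ((eval_lt hY hS he).trans_le hW)⟩
    rw [hr _ (x.reg_lt.trans (by decide)), h0 (d + 1) (by omega), HState.conc_reg]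
    rfl
  | lit c, he, d, σ, _, _, _, _ => ⟨1, le_rfl, .const' ((eval_lt hY hS he).trans_le hW)⟩
  | op o a b, he, d, σ, hd, hm, hr, h0 => by
    have he' := he
    simp only [fits, Bool.and_eq_true, decide_eq_true_eq] at he'
    obtain ⟨t1, ht1, e1⟩ := exec_code hY hW hS a he'.1.1 d σ hd hm hr h0
    obtain ⟨t2, ht2, e2⟩ := exec_code hY hW hS b he'.1.2 (d + 1)
      (σ.setReg d (a.eval S)) (by omega) hm
      (fun r hr' => by rw [State.setReg_reg, if_neg (by omega), hr r hr'])
      (fun r hr' => by rw [State.setReg_reg, if_neg (by omega), h0 r (by omega)])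
    have e3 := Exec.op' (W := W) (o := o) (d := d) (a := d) (b := d + 1)
      (σ := (σ.setReg d (a.eval S)).setReg (d + 1) (b.eval S))
      (v := (op o a b).eval S) (by simp [eval]) ((eval_lt hY hS he).trans_le hW)
    have e4 := Exec.const' (W := W) (d := d + 1) (v := 0)
      (σ := ((σ.setReg d (a.eval S)).setReg (d + 1) (b.eval S)).setReg d ((op o a b).eval S))
      ((Nat.pow_pos (by omega)).trans_le hW)
    refine ⟨t1 + (t2 + (1 + 1)), by simp only [time]; omega, ?_⟩
    have := Exec.seq e1 (Exec.seq e2 (Exec.seq e3 e4))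
    refine this.congr (State.ext_setReg (fun r => ?_) rfl)
    by_cases hr : r = d
    · subst hr; simp
    · by_cases hr' : r = d + 1
      · subst hr'; simp [h0]
      · simp [hr, hr']
  | get a i, he, d, σ, hd, hm, hr, h0 => by
    have he' := he
    simp only [fits, Bool.and_eq_true, decide_eq_true_eq] at he'
    obtain ⟨t1, ht1, e1⟩ := exec_code hY hW hS i he'.1 d σ hd hm hr h0
    have h16 : 16 < W := by
      have : Y ^ 1 < Y ^ D := Nat.pow_lt_pow_right (by omega) (by omega)
      simp only [pow_one] at this; omega
    have hb : baseReg ≠ d := by simp only [baseReg, tmp] at *; omega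
    have hbv : (σ.setReg d (i.eval S)).reg baseReg = S.base := by
      rw [State.setReg_reg, if_neg hb, hr _ (by decide), HState.conc_base]
    have e2 := exec_addrCode (W := W) (a := a) (σ := σ.setReg d (i.eval S)) hd
      (by simp [h0]) (by
        rw [hbv, State.setReg_reg, if_pos rfl]
        exact (addr_lt hY hS he'.1 he'.2 a).trans_le hW) h16
    rw [hbv, State.setReg_reg, if_pos rfl, State.setReg_setReg] at e2
    have e3 := Exec.load' (W := W) (d := d) (a := d)
      (σ := σ.setReg d (S.base + stride * i.eval S + a.slot)) (v := (get a i).eval S)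
      (by rw [State.setReg_reg, if_pos rfl, State.setReg_mem, hm, HState.conc_mem_arr]; rfl)
    rw [State.setReg_setReg] at e3
    exact ⟨t1 + (6 + 1), by simp only [time]; omega, Exec.seq e1 (Exec.seq e2 e3)⟩
  | peek a, he, d, σ, hd, hm, hr, h0 => by
    have he' := he
    simp only [fits, Bool.and_eq_true, decide_eq_true_eq] at he'
    obtain ⟨t1, ht1, e1⟩ := exec_code hY hW hS a he'.1 d σ hd hm hr h0
    have hb : baseReg ≠ d := by simp only [baseReg, tmp] at *; omega
    have hbv : (σ.setReg d (a.eval S)).reg baseReg = S.base := by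
      rw [State.setReg_reg, if_neg hb, hr _ (by decide), HState.conc_base]
    refine ⟨t1 + (1 + 1), by simp only [time]; omega, .seq e1 ?_⟩
    by_cases hlt : a.eval S < S.base
    · refine .ite_true (by rw [hbv]; simpa using hlt) ?_
      have := Exec.load' (W := W) (d := d) (a := d)
        (σ := σ.setReg d (a.eval S)) (v := (peek a).eval S)
        (by rw [State.setReg_reg, if_pos rfl, State.setReg_mem, hm, HState.conc_mem_low _ hlt]
            simp [eval, hlt])
      rwa [State.setReg_setReg] at this
    · refine .ite_false (by rw [hbv]; simpa using hlt) ?_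
      have := Exec.const' (W := W) (d := d) (v := 0) (σ := σ.setReg d (a.eval S))
        ((Nat.pow_pos (by omega)).trans_le hW)
      rw [State.setReg_setReg] at this
      simpa [eval, hlt] using this

end Ex
end Imp

/-! ### Commands and their translation -/

namespace Imp

open WordRAM

/-- Commands. The condition of `ite` is that the expression is positive; `loop x b p` runs `p` for
`x = 0, …, b - 1`. -/
inductive Cm
  | skip
  | set (x : Var) (e : Ex)
  | put (a : Arr) (i e : Ex)
  | poke (i e : Ex)
  | seq (p q : Cm)
  | ite (e : Ex) (p q : Cm)
  | loop (x b : Var) (p : Cm)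

/-- The state after `i` rounds of a loop with counter `x` and body `f`. -/
def loopRun (f : HState → HState) (x : Var) (S : HState) : ℕ → HState
  | 0 => S.setReg x 0
  | i + 1 => (f (loopRun f x S i)).setReg x (i + 1)

namespace Cm

/-- The meaning of a command. -/
def run : Cm → HState → HState
  | skip, S => S
  | set x e, S => S.setReg x (S.clamp (e.eval S))
  | put a i e, S => S.setArr a (i.eval S) (S.clamp (e.eval S))
  | poke i e, S => S.setLow (i.eval S) (S.clamp (e.eval S))
  | seq p q, S => q.run (p.run S)
  | ite e p q, S => if 0 < e.eval S then p.run S else q.run S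
  | loop x b p, S => loopRun p.run x S (S.reg b)

/-- Code that replaces the value of register `d` by `0` unless it is less than `cap`. -/
def clampCode (d : ℕ) : Prog := .ite d capReg .skip (.instr (.const d 0))

/-- The machine code of a command. -/
def code : Cm → Prog
  | skip => .skip
  | set x e => .seq (e.code tmp) <| .seq (clampCode tmp) <|
      .seq (.instr (.op .add x.reg tmp (tmp + 1))) (.instr (.const tmp 0))
  | put a i e => .seq (i.code tmp) <| .seq (Ex.addrCode tmp a) <| .seq (e.code (tmp + 1)) <|
      .seq (clampCode (tmp + 1)) <| .seq (.instr (.store tmp (tmp + 1))) <|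
      .seq (.instr (.const (tmp + 1) 0)) (.instr (.const tmp 0))
  | poke i e => .seq (i.code tmp) <| .seq (e.code (tmp + 1)) <| .seq (clampCode (tmp + 1)) <|
      .seq (.ite tmp baseReg (.instr (.store tmp (tmp + 1))) .skip) <|
      .seq (.instr (.const (tmp + 1) 0)) (.instr (.const tmp 0))
  | seq p q => .seq p.code q.code
  | ite e p q => .seq (e.code tmp) (.ite (tmp + 1) tmp
      (.seq (.instr (.const tmp 0)) p.code) (.seq (.instr (.const tmp 0)) q.code))
  | loop x b p => .seq (.instr (.const x.reg 0)) (.while x.reg b.reg (.seq p.code <|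
      .seq (.instr (.const tmp 1)) <| .seq (.instr (.op .add x.reg x.reg tmp))
        (.instr (.const tmp 0))))

/-- A bound for the number of steps, where `ρ` bounds the variables that limit the loops. -/
def time (ρ : Var → ℕ) : Cm → ℕ
  | skip => 0
  | set _ e => e.time + 4
  | put _ i e => i.time + e.time + 11
  | poke i e => i.time + e.time + 6
  | seq p q => p.time ρ + q.time ρ
  | ite e p q => e.time + 2 + (p.time ρ + q.time ρ)
  | loop _ b p => ρ b * (p.time ρ + 4) + 2

/-- The variables that a command may change. -/
def wv : Cm → List Var
  | skip => []
  | set x _ => [x]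
  | put _ _ _ => []
  | poke _ _ => []
  | seq p q => p.wv ++ q.wv
  | ite _ p q => p.wv ++ q.wv
  | loop x _ p => x :: p.wv

/-- The arrays that a command may change. -/
def wa : Cm → List Arr
  | skip => []
  | set _ _ => []
  | put a _ _ => [a]
  | poke _ _ => []
  | seq p q => p.wa ++ q.wa
  | ite _ p q => p.wa ++ q.wa
  | loop _ _ p => p.wa

/-- Whether a command may change the memory below `base`. -/
def wl : Cm → Bool
  | skip => false
  | set _ _ => false
  | put _ _ _ => false
  | poke _ _ => true
  | seq p q => p.wl || q.wl
  | ite _ p q => p.wl || q.wl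
  | loop _ _ p => p.wl

/-- The expressions fit (see `Ex.fits`), the variables in `prm` are never changed, the loops are
limited by variables in `prm`, and the body of a loop does not change its counter. -/
def wf (D : ℕ) (prm : List Var) : Cm → Bool
  | skip => true
  | set x e => !prm.contains x && e.fits D
  | put _ i e => i.fits D && (i.deg + 2 < D) && e.fits D
  | poke i e => i.fits D && e.fits D
  | seq p q => p.wf D prm && q.wf D prm
  | ite e p q => e.fits D && p.wf D prm && q.wf D prm
  | loop x b p => !prm.contains x && prm.contains b && p.wf D prm && !p.wv.contains x

theorem loopRun_reg {f : HState → HState} {x : Var} {S : HState} {y : Var} (hy : y ≠ x)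
    (h : ∀ S', (f S').reg y = S'.reg y) (i : ℕ) : (loopRun f x S i).reg y = S.reg y := by
  induction i with
  | zero => simp [loopRun, hy]
  | succ i ih => simp [loopRun, hy, h, ih]

theorem run_reg : ∀ (p : Cm) (S : HState) {y : Var}, y ∉ p.wv → (p.run S).reg y = S.reg y
  | skip, _, _, _ => rfl
  | set x e, S, y, h => by simp [wv] at h; simp [run, h]
  | put a i e, S, y, _ => by simp [run]
  | poke i e, S, y, _ => by simp [run]
  | seq p q, S, y, h => by
    simp [wv] at h; simp [run, run_reg q _ h.2, run_reg p _ h.1]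
  | ite e p q, S, y, h => by
    simp [wv] at h; simp only [run]; split
    · exact run_reg p _ h.1
    · exact run_reg q _ h.2
  | loop x b p, S, y, h => by
    simp [wv] at h; exact loopRun_reg h.1 (fun S' => run_reg p S' h.2) _

theorem run_arr : ∀ (p : Cm) (S : HState) {a : Arr}, a ∉ p.wa → (p.run S).arr a = S.arr a
  | skip, _, _, _ => rfl
  | set x e, S, _, _ => rfl
  | put a i e, S, _, h => by simp [wa] at h; simp [run, HState.setArr, h]
  | poke i e, S, _, _ => by simp [run]
  | seq p q, S, _, h => by
    simp [wa] at h; simp [run, run_arr q _ h.2, run_arr p _ h.1]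
  | ite e p q, S, _, h => by
    simp [wa] at h; simp only [run]; split
    · exact run_arr p _ h.1
    · exact run_arr q _ h.2
  | loop x b p, S, a, h => by
    have : ∀ i, (loopRun p.run x S i).arr a = S.arr a := fun i => by
      induction i with
      | zero => rfl
      | succ i ih => rw [← ih]; exact run_arr p _ h
    exact this _

theorem run_low : ∀ (p : Cm) (S : HState), p.wl = false → (p.run S).low = S.low
  | skip, _, _ => rfl
  | set x e, S, _ => rfl
  | put a i e, S, _ => rfl
  | poke i e, S, h => by simp [wl] at h
  | seq p q, S, h => by
    simp [wl] at h; simp [run, run_low q _ h.2, run_low p _ h.1]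
  | ite e p q, S, h => by
    simp [wl] at h; simp only [run]; split
    · exact run_low p _ h.1
    · exact run_low q _ h.2
  | loop x b p, S, h => by
    have : ∀ i, (loopRun p.run x S i).low = S.low := fun i => by
      induction i with
      | zero => rfl
      | succ i ih => rw [← ih]; exact run_low p _ h
    exact this _

theorem run_base : ∀ (p : Cm) (S : HState), (p.run S).base = S.base
  | skip, _ => rfl
  | set x e, S => rfl
  | put a i e, S => rfl
  | poke i e, S => by simp [run]
  | seq p q, S => by simp [run, run_base q, run_base p]
  | ite e p q, S => by
    simp only [run]; split
    · exact run_base p _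
    · exact run_base q _
  | loop x b p, S => by
    have : ∀ i, (loopRun p.run x S i).base = S.base := fun i => by
      induction i with
      | zero => rfl
      | succ i ih => rw [← ih]; exact run_base p _
    exact this _

theorem run_cap : ∀ (p : Cm) (S : HState), (p.run S).cap = S.cap
  | skip, _ => rfl
  | set x e, S => rfl
  | put a i e, S => rfl
  | poke i e, S => by simp [run]
  | seq p q, S => by simp [run, run_cap q, run_cap p]
  | ite e p q, S => by
    simp only [run]; split
    · exact run_cap p _
    · exact run_cap q _
  | loop x b p, S => by
    have : ∀ i, (loopRun p.run x S i).cap = S.cap := fun i => by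
      induction i with
      | zero => rfl
      | succ i ih => rw [← ih]; exact run_cap p _
    exact this _

theorem notMem_wv {D : ℕ} {prm : List Var} {y : Var} (hy : y ∈ prm) :
    ∀ p : Cm, p.wf D prm → y ∉ p.wv
  | skip, _ => by simp [wv]
  | set x e, h => by
    simp [wf] at h; simp only [wv, List.mem_singleton]; rintro rfl; exact h.1 hy
  | put a i e, _ => by simp [wv]
  | poke i e, _ => by simp [wv]
  | seq p q, h => by
    simp [wf] at h; simp [wv, notMem_wv hy p h.1, notMem_wv hy q h.2]
  | ite e p q, h => by
    simp [wf] at h; simp [wv, notMem_wv hy p h.1.2, notMem_wv hy q h.2]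
  | loop x b p, h => by
    simp [wf] at h
    simp only [wv, List.mem_cons, not_or]
    exact ⟨fun h' => h.1.1.1 (h' ▸ hy), notMem_wv hy p h.1.2⟩

theorem Bdd.run {Y : ℕ} {D : ℕ} {prm : List Var} :
    ∀ (p : Cm) {S : HState}, S.Bdd Y → p.wf D prm → (p.run S).Bdd Y
  | skip, _, h, _ => h
  | set x e, S, h, _ => h.setReg x ((S.clamp_le _).trans h.cap)
  | put a i e, S, h, _ => h.setArr a _ ((S.clamp_le _).trans h.cap)
  | poke i e, S, h, _ => h.setLow _ ((S.clamp_le _).trans h.cap)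
  | seq p q, S, h, hw => by
    simp [wf] at hw; exact Bdd.run q (Bdd.run p h hw.1) hw.2
  | ite e p q, S, h, hw => by
    simp [wf] at hw; simp only [Cm.run]; split
    · exact Bdd.run p h hw.1.2
    · exact Bdd.run q h hw.2
  | loop x b p, S, h, hw => by
    simp [wf] at hw
    have : ∀ i ≤ S.reg b, (loopRun p.run x S i).Bdd Y := fun i => by
      induction i with
      | zero => exact fun _ => h.setReg x (Nat.zero_le _)
      | succ i ih =>
        intro hi
        exact (Bdd.run p (ih (by omega)) hw.1.2).setReg x (hi.trans (h.reg b))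
    exact this _ le_rfl

theorem exec_clampCode {W : ℕ} {d : ℕ} {σ : State} (hW : 0 < W) :
    ∃ t ≤ 2, Exec W (clampCode d) σ t
      (σ.setReg d (if σ.reg d < σ.reg capReg then σ.reg d else 0)) := by
  by_cases h : σ.reg d < σ.reg capReg
  · refine ⟨1, by omega, (Exec.ite_true h (.skip σ)).congr ?_⟩
    rw [if_pos h]
    exact State.ext_setReg (fun r => by simp; rintro rfl; rfl) rfl
  · exact ⟨2, by omega, by rw [if_neg h]; exact .ite_false h (.const' hW)⟩

theorem exec_value {W Y D : ℕ} (hY : 16 ≤ Y) (hW : Y ^ D ≤ W) {S : HState} (hS : S.Bdd Y) {e : Ex}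
    (he : e.fits D) {d : ℕ} {σ : State} (hd : tmp ≤ d) (hm : σ.mem = S.conc.mem)
    (hr : ∀ r < tmp, σ.reg r = S.conc.reg r) (h0 : ∀ r, d ≤ r → σ.reg r = 0) :
    ∃ t ≤ e.time + 2, Exec W (.seq (e.code d) (clampCode d)) σ t
      (σ.setReg d (S.clamp (e.eval S))) := by
  obtain ⟨t1, ht1, e1⟩ := Ex.exec_code hY hW hS e he d σ hd hm hr h0
  obtain ⟨t2, ht2, e2⟩ := exec_clampCode (W := W) (d := d) (σ := σ.setReg d (e.eval S))
    ((Nat.pow_pos (by omega)).trans_le hW)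
  refine ⟨t1 + t2, by omega, (Exec.seq e1 e2).congr ?_⟩
  have hne : capReg ≠ d := by simp only [capReg, tmp] at *; omega
  rw [State.setReg_setReg, State.setReg_reg, if_pos rfl, State.setReg_reg, if_neg hne,
    hr _ (by decide), HState.conc_cap]
  rfl

theorem _root_.WordRAM.Exec.assoc {W : ℕ} {p q r : Prog} {σ τ : State} {t : ℕ}
    (h : Exec W (.seq (.seq p q) r) σ t τ) : Exec W (.seq p (.seq q r)) σ t τ := by
  cases h with
  | seq h1 h2 =>
    cases h1 with
    | seq h3 h4 => rw [Nat.add_assoc]; exact .seq h3 (.seq h4 h2)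

theorem conc_reg_ne_tmp (S : HState) (x : Var) (v : ℕ) {d : ℕ} (hd : tmp ≤ d) :
    (S.conc.setReg d v).reg x.reg = S.reg x := by
  have := x.reg_lt
  rw [State.setReg_reg, if_neg (by simp only [tmp] at hd; omega), HState.conc_reg]

/-- The compiled code computes the meaning of the command, without overflow and in time. -/
theorem exec_code {W Y D : ℕ} (hD : 1 < D) (hY : 16 ≤ Y) (hW : Y ^ D ≤ W) {ρ : Var → ℕ}
    {prm : List Var} :
    ∀ (p : Cm) {S : HState}, S.Bdd Y → p.wf D prm → (∀ y ∈ prm, S.reg y ≤ ρ y) →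
      ∃ t ≤ p.time ρ, Exec W p.code S.conc t (p.run S).conc
  | skip, S, _, _, _ => ⟨0, le_rfl, .skip _⟩
  | set x e, S, hS, hw, _ => by
    simp [wf] at hw
    have hYW : Y < W := by
      have : Y ^ 1 < Y ^ D := Nat.pow_lt_pow_right (by omega) hD
      simp only [pow_one] at this; omega
    obtain ⟨t1, ht1, e1⟩ := exec_value hY hW hS hw.2 (d := tmp) (σ := S.conc) le_rfl rfl
      (fun _ _ => rfl) (fun r hr => S.conc_tmp hr)
    have hx := x.reg_lt
    have hc := (S.clamp_le (e.eval S)).trans hS.cap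
    have e2 := Exec.op' (W := W) (o := .add) (d := x.reg) (a := tmp) (b := tmp + 1)
      (σ := S.conc.setReg tmp (S.clamp (e.eval S))) (v := S.clamp (e.eval S))
      (by simp [Op.eval, S.conc_tmp]) (by omega)
    have e3 := Exec.const' (W := W) (d := tmp) (v := 0)
      (σ := (S.conc.setReg tmp (S.clamp (e.eval S))).setReg x.reg (S.clamp (e.eval S))) (by omega)
    refine ⟨t1 + (1 + 1), by simp only [time]; omega, Exec.assoc ?_⟩
    refine (Exec.seq e1 (Exec.seq e2 e3)).congr ?_
    simp only [run, HState.conc_setReg]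
    refine State.ext_setReg (fun r => ?_) rfl
    simp only [State.setReg_reg, Function.update_apply]
    by_cases h : r = tmp
    · subst h; rw [if_pos rfl, if_neg (by simp only [tmp]; omega), S.conc_tmp (by decide)]
    · simp [h]
  | put a i e, S, hS, hw, _ => by
    simp [wf] at hw
    have hYW : Y < W := by
      have : Y ^ 1 < Y ^ D := Nat.pow_lt_pow_right (by omega) hD
      simp only [pow_one] at this; omega
    obtain ⟨t1, ht1, e1⟩ := Ex.exec_code hY hW hS i hw.1.1 tmp S.conc le_rfl rfl
      (fun _ _ => rfl) (fun r hr => S.conc_tmp hr)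
    have hbv : (S.conc.setReg tmp (i.eval S)).reg baseReg = S.base := by simp
    have e2 := Ex.exec_addrCode (W := W) (a := a) (σ := S.conc.setReg tmp (i.eval S)) le_rfl
      (by simp [S.conc_tmp]) (by
        rw [hbv, State.setReg_reg, if_pos rfl]
        exact (Ex.addr_lt hY hS hw.1.1 hw.1.2 a).trans_le hW) (by omega)
    rw [hbv, State.setReg_reg, if_pos rfl, State.setReg_setReg] at e2
    set ad := S.base + stride * i.eval S + a.slot
    obtain ⟨t3, ht3, e3⟩ := exec_value hY hW hS hw.2 (d := tmp + 1) (σ := S.conc.setReg tmp ad)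
      (by omega) rfl (fun r hr => by rw [State.setReg_reg, if_neg (by omega)])
      (fun r hr => by
        rw [State.setReg_reg, if_neg (by omega), S.conc_tmp (by simp only [tmp] at hr; omega)])
    have e4 := Exec.store' (W := W) (a := tmp) (b := tmp + 1)
      (σ := (S.conc.setReg tmp ad).setReg (tmp + 1) (S.clamp (e.eval S)))
      (u := ad) (v := S.clamp (e.eval S)) (by simp) (by simp)
    have e5 := Exec.const' (W := W) (d := tmp + 1) (v := 0) (σ :=
      { (S.conc.setReg tmp ad).setReg (tmp + 1) (S.clamp (e.eval S)) with
        mem := Function.update S.conc.mem ad (S.clamp (e.eval S)) }) (by omega)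
    have e6 := Exec.const' (W := W) (d := tmp) (v := 0) (σ :=
      ({ (S.conc.setReg tmp ad).setReg (tmp + 1) (S.clamp (e.eval S)) with
        mem := Function.update S.conc.mem ad (S.clamp (e.eval S)) } : State).setReg (tmp + 1) 0)
      (by omega)
    refine ⟨t1 + (6 + (t3 + (1 + (1 + 1)))), by simp only [time]; omega, ?_⟩
    refine .congr (.seq e1 (.seq e2 (Exec.assoc (.seq e3 (.seq e4 (.seq e5 e6)))))) ?_
    simp only [run, HState.conc_setArr]
    refine State.ext_setReg (fun r => ?_) rfl
    simp only [State.setReg_reg]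
    by_cases h : r = tmp
    · subst h; rw [if_pos rfl, S.conc_tmp (by decide)]
    · by_cases h' : r = tmp + 1
      · subst h'; simp [S.conc_tmp]
      · simp [h, h']
  | poke i e, S, hS, hw, _ => by
    simp [wf] at hw
    have hYW : Y < W := by
      have : Y ^ 1 < Y ^ D := Nat.pow_lt_pow_right (by omega) hD
      simp only [pow_one] at this; omega
    obtain ⟨t1, ht1, e1⟩ := Ex.exec_code hY hW hS i hw.1 tmp S.conc le_rfl rfl
      (fun _ _ => rfl) (fun r hr => S.conc_tmp hr)
    set ad := i.eval S with had
    obtain ⟨t3, ht3, e3⟩ := exec_value hY hW hS hw.2 (d := tmp + 1) (σ := S.conc.setReg tmp ad)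
      (by omega) rfl (fun r hr => by rw [State.setReg_reg, if_neg (by omega)])
      (fun r hr => by
        rw [State.setReg_reg, if_neg (by omega), S.conc_tmp (by simp only [tmp] at hr; omega)])
    have e4 : ∃ t ≤ 2, Exec W (.ite tmp baseReg (.instr (.store tmp (tmp + 1))) .skip)
        ((S.conc.setReg tmp ad).setReg (tmp + 1) (S.clamp (e.eval S))) t
        { (S.conc.setReg tmp ad).setReg (tmp + 1) (S.clamp (e.eval S)) with
          mem := ((poke i e).run S).conc.mem } := by
      have hbv : ((S.conc.setReg tmp ad).setReg (tmp + 1) (S.clamp (e.eval S))).reg baseReg =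
          S.base := by
        rw [State.setReg_reg, if_neg (by decide), State.setReg_reg, if_neg (by decide),
          HState.conc_base]
      have htv : ((S.conc.setReg tmp ad).setReg (tmp + 1) (S.clamp (e.eval S))).reg tmp = ad := by
        simp
      by_cases h : ad < S.base
      · refine ⟨1 + 1, le_rfl, .ite_true (by rwa [hbv, htv]) ?_⟩
        refine (Exec.store' (W := W) (a := tmp) (b := tmp + 1)
          (u := ad) (v := S.clamp (e.eval S)) (by simp) (by simp)).congr ?_
        simp only [run]
        rw [HState.conc_setLow _ h]
        rfl
      · refine ⟨0 + 1, by omega, .ite_false (by rwa [hbv, htv]) ((Exec.skip _).congr ?_)⟩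
        simp only [run, ← had, HState.setLow, if_neg h]
        rfl
    obtain ⟨t4, ht4, e4⟩ := e4
    have e5 := Exec.const' (W := W) (d := tmp + 1) (v := 0) (σ :=
      { (S.conc.setReg tmp ad).setReg (tmp + 1) (S.clamp (e.eval S)) with
        mem := ((poke i e).run S).conc.mem }) (by omega)
    have e6 := Exec.const' (W := W) (d := tmp) (v := 0) (σ :=
      ({ (S.conc.setReg tmp ad).setReg (tmp + 1) (S.clamp (e.eval S)) with
        mem := ((poke i e).run S).conc.mem } : State).setReg (tmp + 1) 0)
      (by omega)
    refine ⟨t1 + (t3 + (t4 + (1 + 1))), by simp only [time]; omega, ?_⟩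
    refine .congr (.seq e1 (Exec.assoc (.seq e3 (.seq e4 (.seq e5 e6))))) ?_
    refine State.ext_setReg (fun r => ?_) rfl
    have hcr : ((poke i e).run S).conc.reg = S.conc.reg := by simp [HState.conc, run]
    simp only [State.setReg_reg, hcr]
    by_cases h : r = tmp
    · subst h; rw [if_pos rfl, S.conc_tmp (by decide)]
    · by_cases h' : r = tmp + 1
      · subst h'; simp [S.conc_tmp]
      · simp [h, h']
  | seq p q, S, hS, hw, hρ => by
    simp [wf] at hw
    obtain ⟨t1, ht1, e1⟩ := exec_code hD hY hW (ρ := ρ) p hS hw.1 hρ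
    obtain ⟨t2, ht2, e2⟩ := exec_code hD hY hW (ρ := ρ) q (Bdd.run p hS hw.1) hw.2
      (fun y hy => by rw [run_reg p _ (notMem_wv hy p hw.1)]; exact hρ y hy)
    exact ⟨t1 + t2, by simp only [time]; omega, .seq e1 e2⟩
  | ite e p q, S, hS, hw, hρ => by
    simp [wf] at hw
    have hW0 : 0 < W := (Nat.pow_pos (by omega)).trans_le hW
    obtain ⟨t1, ht1, e1⟩ := Ex.exec_code hY hW hS e hw.1.1 tmp S.conc le_rfl rfl
      (fun _ _ => rfl) (fun r hr => S.conc_tmp hr)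
    have e2 := Exec.const' (W := W) (d := tmp) (v := 0) (σ := S.conc.setReg tmp (e.eval S)) hW0
    have hback : (S.conc.setReg tmp (e.eval S)).setReg tmp 0 = S.conc := by
      rw [State.setReg_setReg]
      refine State.ext_setReg (fun r => ?_) rfl
      simp only [State.setReg_reg]; split
      · rename_i h; rw [h, S.conc_tmp (by decide)]
      · rfl
    rw [hback] at e2
    have hc : (S.conc.setReg tmp (e.eval S)).reg (tmp + 1) <
        (S.conc.setReg tmp (e.eval S)).reg tmp ↔ 0 < e.eval S := by
      simp [S.conc_tmp]
    by_cases h : 0 < e.eval S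
    · obtain ⟨t3, ht3, e3⟩ := exec_code hD hY hW (ρ := ρ) p hS hw.1.2 hρ
      refine ⟨t1 + (1 + t3 + 1), by simp only [time]; omega, ?_⟩
      simp only [run, if_pos h]
      exact .seq e1 (.ite_true (hc.2 h) (.seq e2 e3))
    · obtain ⟨t3, ht3, e3⟩ := exec_code hD hY hW (ρ := ρ) q hS hw.2 hρ
      refine ⟨t1 + (1 + t3 + 1), by simp only [time]; omega, ?_⟩
      simp only [run, if_neg h]
      exact .seq e1 (.ite_false (hc.not.2 h) (.seq e2 e3))
  | loop x b p, S, hS, hw, hρ => by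
    simp [wf] at hw
    have hYW : Y < W := by
      have : Y ^ 1 < Y ^ D := Nat.pow_lt_pow_right (by omega) hD
      simp only [pow_one] at this; omega
    have hprm : ∀ i, ∀ y ∈ prm, (loopRun p.run x S i).reg y = S.reg y := fun i y hy =>
      loopRun_reg (fun h => hw.1.1.1 (by rwa [← h])) (fun S' => run_reg p S' (notMem_wv hy p hw.1.2)) i
    have hx : ∀ i, (loopRun p.run x S i).reg x = i := fun i => by cases i <;> simp [loopRun]
    have hbdd : ∀ i ≤ S.reg b, (loopRun p.run x S i).Bdd Y := fun i => by
      induction i with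
      | zero => exact fun _ => hS.setReg x (Nat.zero_le _)
      | succ i ih =>
        intro hi
        exact (Bdd.run p (ih (by omega)) hw.1.2).setReg x (hi.trans (hS.reg b))
    have hbody : ∀ i < S.reg b, ∃ t ≤ p.time ρ + 3, Exec W (.seq p.code <|
        .seq (.instr (.const tmp 1)) <| .seq (.instr (.op .add x.reg x.reg tmp))
        (.instr (.const tmp 0))) (loopRun p.run x S i).conc t (loopRun p.run x S (i + 1)).conc := by
      intro i hi
      obtain ⟨t1, ht1, e1⟩ := exec_code hD hY hW (ρ := ρ) p (hbdd i hi.le) hw.1.2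
        (fun y hy => by rw [hprm i y hy]; exact hρ y hy)
      set S' := p.run (loopRun p.run x S i) with hS'
      have hS'x : S'.reg x = i := by rw [hS', run_reg p _ hw.2, hx]
      have hxr := x.reg_lt
      have hbY := hS.reg b
      have e2 := Exec.const' (W := W) (d := tmp) (v := 1) (σ := S'.conc) (by omega)
      have e3 := Exec.op' (W := W) (o := .add) (d := x.reg) (a := x.reg) (b := tmp)
        (σ := S'.conc.setReg tmp 1) (v := i + 1)
        (by rw [conc_reg_ne_tmp _ _ _ le_rfl, hS'x]; simp [Op.eval]) (by omega)
      have e4 := Exec.const' (W := W) (d := tmp) (v := 0)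
        (σ := (S'.conc.setReg tmp 1).setReg x.reg (i + 1)) (by omega)
      refine ⟨t1 + (1 + (1 + 1)), by omega, (Exec.seq e1 (.seq e2 (.seq e3 e4))).congr ?_⟩
      simp only [loopRun, ← hS', HState.conc_setReg]
      refine State.ext_setReg (fun r => ?_) rfl
      simp only [State.setReg_reg, Function.update_apply]
      by_cases h : r = tmp
      · subst h; rw [if_pos rfl, if_neg (by simp only [tmp]; omega), S'.conc_tmp (by decide)]
      · simp [h]
    have hwhile : ∀ c i, i + c = S.reg b → ∃ t ≤ c * (p.time ρ + 4) + 1,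
        Exec W (.while x.reg b.reg (.seq p.code <| .seq (.instr (.const tmp 1)) <|
          .seq (.instr (.op .add x.reg x.reg tmp)) (.instr (.const tmp 0))))
          (loopRun p.run x S i).conc t (loopRun p.run x S (S.reg b)).conc := by
      intro c
      induction c with
      | zero =>
        intro i hi
        refine ⟨1, by omega, ?_⟩
        obtain rfl : i = S.reg b := by omega
        refine .while_false ?_
        rw [HState.conc_reg, HState.conc_reg, hx, hprm _ _ hw.1.1.2]; omega
      | succ c ih =>
        intro i hi
        obtain ⟨t1, ht1, e1⟩ := hbody i (by omega)
        obtain ⟨t2, ht2, e2⟩ := ih (i + 1) (by omega)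
        refine ⟨t1 + t2 + 1, by rw [Nat.succ_mul]; omega, .while_true ?_ e1 e2⟩
        rw [HState.conc_reg, HState.conc_reg, hx, hprm _ _ hw.1.1.2]; omega
    obtain ⟨t, ht, e⟩ := hwhile (S.reg b) 0 (by omega)
    have e0 := Exec.const' (W := W) (d := x.reg) (v := 0) (σ := S.conc) (by omega)
    have hle := hρ b hw.1.1.2
    refine ⟨1 + t, ?_, .seq e0 ?_⟩
    · simp only [time]
      have := Nat.mul_le_mul_right (p.time ρ + 4) hle
      omega
    · have : (loopRun p.run x S 0).conc = S.conc.setReg x.reg 0 := by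
        rw [loopRun, HState.conc_setReg]; rfl
      rw [← this]; exact e

/-- The nesting depth of the loops that are limited by `Var.m`. -/
def dm : Cm → ℕ
  | seq p q => max p.dm q.dm
  | ite _ p q => max p.dm q.dm
  | loop _ b p => if b = .m then p.dm + 1 else p.dm
  | _ => 0

/-- The nesting depth of the loops that are limited by other variables. -/
def dz : Cm → ℕ
  | seq p q => max p.dz q.dz
  | ite _ p q => max p.dz q.dz
  | loop _ b p => if b = .m then p.dz else p.dz + 1
  | _ => 0

/-- The number of steps of a command if every loop is run once. -/
def cst : Cm → ℕ
  | skip => 0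
  | set _ e => e.time + 4
  | put _ i e => i.time + e.time + 11
  | poke i e => i.time + e.time + 6
  | seq p q => p.cst + q.cst
  | ite e p q => e.time + 2 + (p.cst + q.cst)
  | loop _ _ p => p.cst + 4 + 2

theorem time_le {ρ : Var → ℕ} {Z : ℕ} (hZ : 1 ≤ Z) (hm : 1 ≤ ρ .m) (h : ∀ b, b ≠ .m → ρ b ≤ Z) :
    ∀ p : Cm, p.time ρ ≤ p.cst * (Z ^ p.dz * ρ .m ^ p.dm)
  | skip => by simp [time]
  | set _ _ => by simp [time, cst, dz, dm]
  | put _ _ _ => by simp [time, cst, dz, dm]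
  | poke _ _ => by simp [time, cst, dz, dm]
  | seq p q => by
    have h1 := time_le hZ hm h p
    have h2 := time_le hZ hm h q
    have h3 : Z ^ p.dz * ρ .m ^ p.dm ≤ Z ^ max p.dz q.dz * ρ .m ^ max p.dm q.dm :=
      Nat.mul_le_mul (Nat.pow_le_pow_right hZ (le_max_left ..))
        (Nat.pow_le_pow_right hm (le_max_left ..))
    have h4 : Z ^ q.dz * ρ .m ^ q.dm ≤ Z ^ max p.dz q.dz * ρ .m ^ max p.dm q.dm :=
      Nat.mul_le_mul (Nat.pow_le_pow_right hZ (le_max_right ..))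
        (Nat.pow_le_pow_right hm (le_max_right ..))
    simp only [time, cst, dz, dm, Nat.add_mul]
    exact Nat.add_le_add (h1.trans (Nat.mul_le_mul_left _ h3))
      (h2.trans (Nat.mul_le_mul_left _ h4))
  | ite e p q => by
    have h1 := time_le hZ hm h p
    have h2 := time_le hZ hm h q
    have h3 : Z ^ p.dz * ρ .m ^ p.dm ≤ Z ^ max p.dz q.dz * ρ .m ^ max p.dm q.dm :=
      Nat.mul_le_mul (Nat.pow_le_pow_right hZ (le_max_left ..))
        (Nat.pow_le_pow_right hm (le_max_left ..))
    have h4 : Z ^ q.dz * ρ .m ^ q.dm ≤ Z ^ max p.dz q.dz * ρ .m ^ max p.dm q.dm :=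
      Nat.mul_le_mul (Nat.pow_le_pow_right hZ (le_max_right ..))
        (Nat.pow_le_pow_right hm (le_max_right ..))
    have h5 : 1 ≤ Z ^ max p.dz q.dz * ρ .m ^ max p.dm q.dm :=
      Nat.mul_pos (Nat.pow_pos hZ) (Nat.pow_pos hm)
    simp only [time, cst, dz, dm]
    rw [Nat.add_mul, Nat.add_mul p.cst]
    exact Nat.add_le_add (Nat.le_mul_of_pos_right _ h5)
      (Nat.add_le_add (h1.trans (Nat.mul_le_mul_left _ h3)) (h2.trans (Nat.mul_le_mul_left _ h4)))
  | loop x b p => by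
    have h1 := time_le hZ hm h p
    have h5 : 1 ≤ Z ^ p.dz * ρ .m ^ p.dm := Nat.mul_pos (Nat.pow_pos hZ) (Nat.pow_pos hm)
    have key : ∀ r, ρ b ≤ r → 1 ≤ r →
        ρ b * (p.time ρ + 4) + 2 ≤ (p.cst + 4 + 2) * (r * (Z ^ p.dz * ρ .m ^ p.dm)) := by
      intro r hr hr1
      generalize Z ^ p.dz * ρ .m ^ p.dm = X at h1 h5
      calc ρ b * (p.time ρ + 4) + 2 ≤ r * (p.cst * X + 4 * X) + 2 * (r * X) :=
            Nat.add_le_add (Nat.mul_le_mul hr (by omega)) (by nlinarith)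
        _ = _ := by ring
    simp only [time, cst, dz, dm]
    by_cases hb : b = .m
    · rw [if_pos hb, if_pos hb]
      refine (key (ρ .m) (by rw [hb]) hm).trans (le_of_eq ?_)
      ring
    · rw [if_neg hb, if_neg hb]
      refine (key Z (h b hb) hZ).trans (le_of_eq ?_)
      ring

end Cm
end Imp

namespace Imp

open WordRAM

/-! ### The program -/

namespace Ex

instance : Add Ex := ⟨Ex.op .add⟩
instance : Sub Ex := ⟨Ex.op .sub⟩
instance : Mul Ex := ⟨Ex.op .mul⟩
instance (c : ℕ) : OfNat Ex c := ⟨Ex.lit c⟩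

prefix:max "♯" => Ex.var

/-- `1` if `a < b`, otherwise `0`. -/
def lt (a b : Ex) : Ex := 1 - (1 - (b - a))

/-- `1` if `a = b`, otherwise `0`. -/
def eq (a b : Ex) : Ex := 1 - ((a - b) + (b - a))

/-- `1` if `a ≠ b`, otherwise `0`. -/
def ne (a b : Ex) : Ex := 1 - eq a b

@[simp] theorem eval_add (S : HState) (a b : Ex) : (a + b).eval S = a.eval S + b.eval S := rfl
@[simp] theorem eval_sub (S : HState) (a b : Ex) : (a - b).eval S = a.eval S - b.eval S := rfl
@[simp] theorem eval_mul (S : HState) (a b : Ex) : (a * b).eval S = a.eval S * b.eval S := rfl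
@[simp] theorem eval_zero (S : HState) : (0 : Ex).eval S = 0 := rfl
@[simp] theorem eval_one (S : HState) : (1 : Ex).eval S = 1 := rfl
@[simp] theorem eval_two (S : HState) : (2 : Ex).eval S = 2 := rfl
@[simp] theorem eval_six (S : HState) : (6 : Ex).eval S = 6 := rfl
@[simp] theorem eval_var (S : HState) (x : Var) : (♯x).eval S = S.reg x := rfl
@[simp] theorem eval_get (S : HState) (a : Arr) (i : Ex) :
    (get a i).eval S = S.arr a (i.eval S) := rfl
theorem eval_peek (S : HState) (a : Ex) :
    (peek a).eval S = if a.eval S < S.base then S.low (a.eval S) else 0 := rfl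
@[simp] theorem eval_lt' (S : HState) (a b : Ex) :
    (lt a b).eval S = if a.eval S < b.eval S then 1 else 0 := by
  simp only [lt, eval_sub, eval_one]; split <;> omega
@[simp] theorem eval_eq (S : HState) (a b : Ex) :
    (eq a b).eval S = if a.eval S = b.eval S then 1 else 0 := by
  simp only [eq, eval_sub, eval_one, eval_add]; split <;> omega
@[simp] theorem eval_ne (S : HState) (a b : Ex) :
    (ne a b).eval S = if a.eval S ≠ b.eval S then 1 else 0 := by
  simp only [ne, eval_sub, eval_one, eval_eq]; split <;> simp_all

/-- The entry of the input matrix in row `h` and column `j`. -/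
def entry (h j : Ex) : Ex := peek (6 + j * ♯.m + h)

/-- The entry with index `t` of the truth table for row `h`. -/
def truth (h t : Ex) : Ex := peek (♯.oR + h * ♯.sk + t)

end Ex

open Ex Cm

infixr:30 " ;; " => Cm.seq

/-- Put the distance of column `j` and the vector with entries `o` into `dist`. -/
def distTo (o : Ex) : Cm :=
  .set .dist 0 ;;
  .loop .h .m (.set .dist (♯.dist + ne (entry ♯.h ♯.j) o))

/-- Put into `ok` whether column `j` has distance at most `B` from the reference column `rr` and
differs from it in all the rows found before that are recorded as incident to column `tt`. -/
def pickFilter : Cm :=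
  distTo (entry ♯.h ♯.rr) ;;
  .set .ok (1 - lt ♯.B ♯.dist) ;;
  .loop .e .B (
    .set .w (get .hrow (get .G (♯.gV + ♯.e))) ;;
    .set .ok (♯.ok * (1 - eq (get .G (♯.gU + ♯.e)) ♯.tt * lt (get .G (♯.gV + ♯.e)) ♯.v *
      eq (entry ♯.w ♯.j) (entry ♯.w ♯.rr))))

/-- For every row, count the columns selected by `pickFilter` that differ from column `rr`. -/
def pickDeg : Cm :=
  .loop .h .m (.put .deg ♯.h 0) ;;
  .loop .j .n (
    pickFilter ;;
    .loop .h .m (.put .deg ♯.h (get .deg ♯.h + ♯.ok * ne (entry ♯.h ♯.j) (entry ♯.h ♯.rr))))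

/-- Add `1` to `cnt` if entry `y` of the array `a` precedes entry `x` in decreasing order. -/
def precedes (a : Arr) (x y : Var) : Ex :=
  lt (get a ♯x) (get a ♯y) + eq (get a ♯x) (get a ♯y) * lt ♯y ♯x

/-- Pick the row whose rank in the order by decreasing degree is `rho`. -/
def pickRow : Cm :=
  .loop .h .m (
    .set .cnt 0 ;;
    .loop .h2 .m (.set .cnt (♯.cnt + precedes .deg .h .h2)) ;;
    .ite (eq ♯.cnt ♯.rho) (.put .hrow ♯.v ♯.h ;; .put .pk ♯.h 1) .skip)

/-- Decode the row with number `v` from its rank `rho`. -/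
def pick : Cm :=
  .set .cl (get .G (♯.k + ♯.v)) ;;
  .set .tt (get .G (♯.gT + ♯.v)) ;;
  .set .rr (get .G ♯.cl) ;;
  pickDeg ;;
  pickRow

/-- Decode all rows; the ranks are written in binary, each one followed by the digit `2`. -/
def picks : Cm :=
  .loop .h .m (.put .pk ♯.h 0) ;;
  .set .v 0 ;;
  .set .rho 0 ;;
  .loop .b .L (
    .set .x (get .G (♯.gS + ♯.b)) ;;
    .ite (lt ♯.x 2) (.set .rho (2 * ♯.rho + ♯.x))
      (pick ;; .set .v (♯.v + 1) ;; .set .rho 0))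

/-- Put into `idx` the index of the tuple with entries `o` in a truth table. -/
def index (o : Ex) : Cm :=
  .set .idx 0 ;;
  .set .pw 1 ;;
  .loop .i .k (
    .set .idx (♯.idx + o * ♯.pw) ;;
    .set .pw (♯.pw * ♯.s))

/-- Compute the centers: the rows of the reference columns, except that the rows that were picked
or violate their relation get the guessed symbols. -/
def centers : Cm :=
  .set .u 0 ;;
  .loop .h .m (
    index (entry ♯.h (get .G ♯.i)) ;;
    .set .x ((1 - truth ♯.h ♯.idx) + get .pk ♯.h) ;;
    .loop .i .k (.ite ♯.x
      (.put .cen (♯.i * ♯.m + ♯.h) (get .G (♯.gY + (♯.u * ♯.k + ♯.i))))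
      (.put .cen (♯.i * ♯.m + ♯.h) (entry ♯.h (get .G ♯.i)))) ;;
    .ite ♯.x (.set .u (♯.u + 1)) .skip)

/-- Find a nearest center of every column. -/
def nearest : Cm :=
  .loop .j .n (
    .set .bc (♯.m + 1) ;;
    .loop .i .k (
      distTo (get .cen (♯.i * ♯.m + ♯.h)) ;;
      .ite (lt ♯.dist ♯.bc) (.set .bc ♯.dist ;; .put .lab ♯.j (♯.i + 1)) .skip) ;;
    .put .cost ♯.j ♯.bc ;;
    .put .ref ♯.j 0)

/-- Put the reference columns into their clusters. -/
def setRefs : Cm :=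
  .loop .i .k (
    .put .lab (get .G ♯.i) (♯.i + 1) ;;
    .put .ref (get .G ♯.i) 1)

/-- Declare the most expensive columns to be outliers, except for reference columns. -/
def outliers : Cm :=
  .loop .j .n (
    .set .cnt 0 ;;
    .loop .j2 .n (.set .cnt (♯.cnt + (1 - get .ref ♯.j2) * precedes .cost .j .j2)) ;;
    .ite ((1 - get .ref ♯.j) * lt ♯.cnt ♯.l) (.put .lab ♯.j 0) .skip)

/-- Count the violations of the relations. -/
def checkRel : Cm :=
  .loop .h .m (
    .loop .i .k (.set .bad (♯.bad + (1 - lt (get .cen (♯.i * ♯.m + ♯.h)) ♯.s))) ;;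
    index (get .cen (♯.i * ♯.m + ♯.h)) ;;
    .set .bad (♯.bad + (1 - truth ♯.h ♯.idx)))

/-- Check the number of outliers, the labels, and the total cost. -/
def checkCost : Cm :=
  .set .cnt 0 ;;
  .set .tot 0 ;;
  .loop .j .n (
    .set .cnt (♯.cnt + eq (get .lab ♯.j) 0) ;;
    .set .bad (♯.bad + lt ♯.k (get .lab ♯.j)) ;;
    .loop .h .m (.set .tot (♯.tot + ne (get .lab ♯.j) 0 *
      ne (entry ♯.h ♯.j) (get .cen ((get .lab ♯.j - 1) * ♯.m + ♯.h))))) ;;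
  .set .bad (♯.bad + (lt ♯.l ♯.cnt + lt ♯.B ♯.tot))

/-- Count the empty clusters. -/
def checkNonempty : Cm :=
  .loop .i .k (
    .set .cnt 0 ;;
    .loop .j .n (.set .cnt (♯.cnt + eq (get .lab ♯.j) (♯.i + 1))) ;;
    .set .bad (♯.bad + eq ♯.cnt 0))

/-- Count the reasons why the labels and the centers are not a solution. -/
def verify : Cm :=
  .set .bad 0 ;; checkRel ;; checkCost ;; checkNonempty

/-- Go to the next guess vector; `carry` becomes `1` if there is none. -/
def advance : Cm :=
  .set .carry 1 ;;
  .loop .p .T (.ite ♯.carry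
    (.ite (lt (get .G ♯.p + 1) (get .rad ♯.p))
      (.put .G ♯.p (get .G ♯.p + 1) ;; .set .carry 0)
      (.put .G ♯.p 0))
    .skip)

/-- Decode and check one guess vector. -/
def attempt : Cm :=
  picks ;; centers ;; nearest ;; setRefs ;; outliers ;; verify

/-- One round of the search. -/
def searchRound : Cm :=
  attempt ;;
  .ite ♯.bad (advance ;; .ite ♯.carry (.set .go 0) .skip) (.set .ans 1 ;; .set .go 0)

/-- Put the least `y` with `2 ^ y ≥ b` into `y`. -/
def clog (y b : Var) : Cm :=
  .set y 0 ;;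
  .set .pw 1 ;;
  .loop .x b (.ite (lt ♯.pw ♯b) (.set .pw (2 * ♯.pw) ;; .set y (♯y + 1)) .skip)

/-- Compute the addresses of the output, and the layout of the guess vectors. -/
def layout : Cm :=
  .set .oR (6 + ♯.n * ♯.m) ;;
  .set .out1 (♯.oR + ♯.m * ♯.sk) ;;
  .set .out2 (♯.out1 + ♯.n) ;;
  .set .kB (♯.k * ♯.B) ;;
  clog .lamB .B ;;
  clog .lamn .n ;;
  .set .L (♯.B * (2 + 2 * ♯.lamB) + 2 * (♯.k * ♯.lamn)) ;;
  .set .gT (♯.k + ♯.B) ;;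
  .set .gV (♯.gT + ♯.B) ;;
  .set .gU (♯.gV + ♯.B) ;;
  .set .gS (♯.gU + ♯.B) ;;
  .set .gY (♯.gS + ♯.L) ;;
  .set .T (♯.gY + ♯.kB) ;;
  .set .go 1

/-- Compute the bounds of the digits of the guess vectors. -/
def radices : Cm :=
  .loop .p .T (
    .ite (lt ♯.p ♯.k) (.put .rad ♯.p ♯.n) <|
    .ite (lt ♯.p ♯.gT) (.put .rad ♯.p ♯.k) <|
    .ite (lt ♯.p ♯.gS) (.put .rad ♯.p ♯.B) <|
    .ite (lt ♯.p ♯.gY) (.put .rad ♯.p 3) (.put .rad ♯.p ♯.s))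

/-- Copy the labels and the centers to the addresses prescribed for the output. -/
def output : Cm :=
  .loop .j .n (.poke (♯.out1 + ♯.j) (get .lab ♯.j)) ;;
  .loop .i .k (.loop .h .m
    (.poke (♯.out2 + (♯.i * ♯.m + ♯.h)) (get .cen (♯.i * ♯.m + ♯.h))))

/-- The variables that stay fixed during the search. -/
def fixedVars : List Var :=
  [.zero, .out1, .out2, .m, .n, .s, .k, .B, .l, .sk, .oR, .L, .T, .gT, .gV, .gU, .gS, .gY]

theorem wf_radices : radices.wf 12 fixedVars := by decide +kernel
theorem wf_round : searchRound.wf 12 fixedVars := by decide +kernel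
theorem wf_output : output.wf 12 fixedVars := by decide +kernel
theorem dm_round : searchRound.dm = 2 := by decide +kernel
theorem dz_round : searchRound.dz = 3 := by decide +kernel

end Imp

open Finset

/-! ### Ranks -/

/-- The number of elements of `R` that precede `x` in the order by decreasing weight `w`, where
ties are broken in favour of smaller numbers. -/
def rank (R : Finset ℕ) (w : ℕ → ℕ) (x : ℕ) : ℕ :=
  #{y ∈ R | w x < w y ∨ (w x = w y ∧ y < x)}

theorem rank_lt_rank {R : Finset ℕ} {w : ℕ → ℕ} {x y : ℕ} (hx : x ∈ R)
    (h : w y < w x ∨ (w y = w x ∧ x < y)) : rank R w x < rank R w y := by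
  refine card_lt_card ⟨fun z hz => ?_, fun hs => ?_⟩
  · simp only [mem_filter] at hz ⊢
    exact ⟨hz.1, by omega⟩
  · have := hs (mem_filter.2 ⟨hx, h⟩)
    simp at this

theorem rank_injOn (R : Finset ℕ) (w : ℕ → ℕ) : Set.InjOn (rank R w) R := by
  intro x hx y hy hxy
  by_contra hne
  rcases lt_trichotomy (w x) (w y) with h | h | h
  · exact (rank_lt_rank hy (Or.inl h)).ne hxy.symm
  · rcases lt_or_gt_of_ne hne with h' | h'
    · exact (rank_lt_rank hx (Or.inr ⟨h.symm, h'⟩)).ne hxy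
    · exact (rank_lt_rank hy (Or.inr ⟨h, h'⟩)).ne hxy.symm
  · exact (rank_lt_rank hx (Or.inl h)).ne hxy

theorem rank_lt_card {R : Finset ℕ} {w : ℕ → ℕ} {x : ℕ} (hx : x ∈ R) : rank R w x < #R :=
  card_lt_card ⟨filter_subset _ _, fun hs => by simpa using hs hx⟩

/-- An element of large weight has small rank. -/
theorem rank_succ_mul_le {R : Finset ℕ} {w : ℕ → ℕ} {x : ℕ} (hx : x ∈ R) :
    (rank R w x + 1) * w x ≤ ∑ y ∈ R, w y := by
  have h1 : x ∉ ({y ∈ R | w x < w y ∨ (w x = w y ∧ y < x)} : Finset ℕ) := by simp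
  calc (rank R w x + 1) * w x
      = #(insert x {y ∈ R | w x < w y ∨ (w x = w y ∧ y < x)}) * w x := by
        rw [card_insert_of_notMem h1, rank]
    _ ≤ ∑ y ∈ insert x {y ∈ R | w x < w y ∨ (w x = w y ∧ y < x)}, w y := by
        rw [← smul_eq_mul]
        refine card_nsmul_le_sum _ _ _ fun y hy => ?_
        simp only [mem_insert, mem_filter] at hy
        rcases hy with rfl | hy
        · exact le_rfl
        · omega
    _ ≤ ∑ y ∈ R, w y :=
        sum_le_sum_of_subset (insert_subset hx (filter_subset _ _))

theorem card_rank_lt_le (R : Finset ℕ) (w : ℕ → ℕ) (l : ℕ) : #{x ∈ R | rank R w x < l} ≤ l := by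
  have := card_le_card_of_injOn (s := {x ∈ R | rank R w x < l}) (t := range l) (rank R w)
    (fun x hx => by simpa using (mem_filter.1 hx).2)
    ((rank_injOn R w).mono (by exact_mod_cast filter_subset _ _))
  simpa using this

/-- The `l` elements of smallest rank have at least the weight of any other `l` elements. -/
theorem sum_le_sum_rank_lt {R O : Finset ℕ} (w : ℕ → ℕ) {l : ℕ} (hO : O ⊆ R) (hl : #O ≤ l) :
    ∑ x ∈ O, w x ≤ ∑ x ∈ R with rank R w x < l, w x := by
  set Q : Finset ℕ := {x ∈ R | rank R w x < l} with hQ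
  have himg : image (rank R w) R = range #R :=
    eq_of_subset_of_card_le
      (fun y hy => by
        obtain ⟨x, hx, rfl⟩ := mem_image.1 hy
        exact mem_range.2 (rank_lt_card hx))
      (by rw [card_range, card_image_of_injOn (rank_injOn R w)])
  have hcard : #O ≤ #Q := by
    have h1 : range #O ⊆ image (rank R w) Q := by
      intro y hy
      rw [mem_range] at hy
      have h2 : y ∈ image (rank R w) R := by
        rw [himg, mem_range]; exact hy.trans_le (card_le_card hO)
      obtain ⟨x, hx, rfl⟩ := mem_image.1 h2
      exact mem_image_of_mem _ (mem_filter.2 ⟨hx, hy.trans_le hl⟩)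
    simpa using (card_le_card h1).trans card_image_le
  have hle : ∀ x ∈ O \ Q, ∀ y ∈ Q \ O, w x ≤ w y := by
    intro x hx y hy
    rw [mem_sdiff] at hx hy
    by_contra hlt
    have hy1 := mem_filter.1 hy.1
    have := rank_lt_rank (hO hx.1) (Or.inl (not_le.1 hlt))
    exact hx.2 (mem_filter.2 ⟨hO hx.1, this.trans hy1.2⟩)
  have hsd : #(O \ Q) ≤ #(Q \ O) := by
    have h1 := card_sdiff_add_card_inter O Q
    have h2 := card_sdiff_add_card_inter Q O
    rw [inter_comm] at h2
    omega
  have key : ∑ x ∈ O \ Q, w x ≤ ∑ x ∈ Q \ O, w x := by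
    rcases (O \ Q).eq_empty_or_nonempty with he | hne
    · simp [he]
    · obtain ⟨x, hx, hmax⟩ := exists_max_image (O \ Q) w hne
      calc ∑ y ∈ O \ Q, w y ≤ #(O \ Q) • w x := sum_le_card_nsmul _ _ _ hmax
        _ ≤ #(Q \ O) • w x := by simpa using Nat.mul_le_mul_right _ hsd
        _ ≤ ∑ y ∈ Q \ O, w y := card_nsmul_le_sum _ _ _ fun y hy => hle x hx y hy
  rw [← sum_inter_add_sum_sdiff O Q, ← sum_inter_add_sum_sdiff Q O, inter_comm]
  omega

/-! ### Encoding rows by their ranks -/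

theorem exists_enum {α : Type*} [Inhabited α] (P : Finset α) :
    ∃ f : ℕ → α, (∀ v < #P, f v ∈ P) ∧ (∀ a ∈ P, ∃ v < #P, f v = a) ∧
      ∀ u < #P, ∀ v < #P, f u = f v → u = v := by
  classical
  refine ⟨fun v => if h : v < #P then P.equivFin.symm ⟨v, h⟩ else default, ?_, ?_, ?_⟩
  · intro v hv
    simp [hv]
  · intro a ha
    exact ⟨P.equivFin ⟨a, ha⟩, (P.equivFin ⟨a, ha⟩).2, by simp⟩
  · intro u hu v hv h
    simpa [hu, hv] using h

/-- A family of sets `F j`, `j ∈ J`, with union inside `V`, such that every element of `V` lies in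
at least half of the sets: if the product of `ρ` over each set is at most `X`, then the product
over `V` is at most `X ^ 2`. -/
theorem prod_le_sq_of_majority {J V : Finset ℕ} (hJ : J.Nonempty) {inc : ℕ → ℕ → Prop}
    [∀ j v, Decidable (inc j v)] {ρ : ℕ → ℕ} {X : ℕ}
    (hρ : ∀ v ∈ V, 1 ≤ ρ v) (hmaj : ∀ v ∈ V, #J ≤ 2 * #{j ∈ J | inc j v})
    (hX : ∀ j ∈ J, ∏ v ∈ V with inc j v, ρ v ≤ X) : ∏ v ∈ V, ρ v ≤ X ^ 2 := by
  have h1 : (∏ v ∈ V, ρ v) ^ #J ≤ (X ^ 2) ^ #J := by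
    calc (∏ v ∈ V, ρ v) ^ #J = ∏ v ∈ V, ρ v ^ #J := (prod_pow _ _ _).symm
      _ ≤ ∏ v ∈ V, (∏ j ∈ J with inc j v, ρ v) ^ 2 := by
          refine prod_le_prod' fun v hv => ?_
          rw [prod_const, ← pow_mul]
          exact Nat.pow_le_pow_right (hρ v hv) (by have := hmaj v hv; omega)
      _ = (∏ j ∈ J, ∏ v ∈ V with inc j v, ρ v) ^ 2 := by
          rw [prod_pow]
          congr 1
          simp only [prod_filter]
          exact prod_comm
      _ ≤ (X ^ #J) ^ 2 := by
          refine Nat.pow_le_pow_left ?_ 2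
          exact prod_le_pow_card _ _ _ hX
      _ = (X ^ 2) ^ #J := by rw [← pow_mul, ← pow_mul, Nat.mul_comm]
  exact (Nat.pow_le_pow_iff_left hJ.card_pos.ne').1 h1

section Telescope

variable (C R : Finset ℕ) (near : ℕ → ℕ → Prop) (diff : ℕ → ℕ → ℕ → Prop)
  [∀ i j, Decidable (near i j)] [∀ i j h, Decidable (diff i j h)] (cl row : ℕ → ℕ)

/-- The columns near the reference column `i` that differ from it in all the rows `row u`, `u < v`,
that belong to cluster `i` and in which column `t` differs from the reference column. -/
def compat (i t v : ℕ) : Finset ℕ :=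
  {j ∈ C | near i j ∧ ∀ u < v, cl u = i → diff i t (row u) → diff i j (row u)}

/-- The number of compatible columns that differ from the reference column in row `h`. -/
def compatDeg (i t v h : ℕ) : ℕ := #{j ∈ compat C near diff cl row i t v | diff i j h}

/-- The rank of the `v`-th row among all rows, ordered by `compatDeg`. -/
def rowRank (t v : ℕ) : ℕ := rank R (compatDeg C near diff cl row (cl v) t v) (row v)

variable {C R near diff cl row}

theorem compatDeg_eq_card_compat_succ {i t v : ℕ} (hi : cl v = i) (ht : diff i t (row v)) :
    compatDeg C near diff cl row i t v (row v) = #(compat C near diff cl row i t (v + 1)) := by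
  unfold compatDeg compat
  rw [filter_filter]
  congr 1
  ext j
  simp only [mem_filter, and_congr_right_iff, and_assoc]
  intro _ _
  constructor
  · rintro ⟨h1, h2⟩ u hu hui hd
    rcases Nat.lt_succ_iff_lt_or_eq.1 hu with h | rfl
    · exact h1 u h hui hd
    · exact h2
  · intro h
    exact ⟨fun u hu => h u (by omega), h v (by omega) hi ht⟩

theorem compat_succ_of_not {i t v : ℕ} (h : ¬ (cl v = i ∧ diff i t (row v))) :
    compat C near diff cl row i t (v + 1) = compat C near diff cl row i t v := by
  unfold compat
  ext j
  simp only [mem_filter, and_congr_right_iff]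
  intro _ _
  constructor
  · exact fun h' u hu => h' u (by omega)
  · intro h' u hu hui hd
    rcases Nat.lt_succ_iff_lt_or_eq.1 hu with h2 | rfl
    · exact h' u h2 hui hd
    · exact (h ⟨hui, hd⟩).elim

/-- Passing to the compatible columns that differ in the `v`-th row as well costs a factor that
pays for the rank of that row. -/
theorem rowRank_succ_mul_le {B : ℕ} (hB : ∀ i j, near i j → #{h ∈ R | diff i j h} ≤ B)
    {t v : ℕ} (hrow : row v ∈ R) (ht : diff (cl v) t (row v)) :
    (rowRank C R near diff cl row t v + 1) * #(compat C near diff cl row (cl v) t (v + 1)) ≤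
      B * #(compat C near diff cl row (cl v) t v) := by
  rw [← compatDeg_eq_card_compat_succ rfl ht]
  refine (rank_succ_mul_le hrow).trans ?_
  calc ∑ h ∈ R, compatDeg C near diff cl row (cl v) t v h
      = ∑ j ∈ compat C near diff cl row (cl v) t v, #{h ∈ R | diff (cl v) j h} := by
        simp only [compatDeg, card_filter]
        exact sum_comm
    _ ≤ ∑ j ∈ compat C near diff cl row (cl v) t v, B :=
        sum_le_sum fun j hj => hB _ _ (mem_filter.1 hj).2.1
    _ = _ := by rw [sum_const, smul_eq_mul, Nat.mul_comm]

/-- The factors of `rowRank_succ_mul_le` for a fixed column `t` telescope. -/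
theorem prod_mul_card_compat_le {B : ℕ} (hB : ∀ i j, near i j → #{h ∈ R | diff i j h} ≤ B)
    {d i t : ℕ} {ρ : ℕ → ℕ} (hrow : ∀ v < d, row v ∈ R)
    (hρ : ∀ v < d, cl v = i → diff i t (row v) → ρ v ≤ rowRank C R near diff cl row t v + 1)
    (hB1 : 0 < d → 1 ≤ B) :
    ∀ v ≤ d, (∏ u ∈ range v with cl u = i ∧ diff i t (row u), ρ u) *
      #(compat C near diff cl row i t v) ≤ B ^ #{u ∈ range v | cl u = i} * #C := by
  intro v
  induction v with
  | zero => intro _; simpa [compat] using card_filter_le _ _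
  | succ v ih =>
    intro hv
    have ih := ih (by omega)
    have hcle : #{u ∈ range v | cl u = i} ≤ #{u ∈ range (v + 1) | cl u = i} :=
      card_le_card (filter_subset_filter _ (range_subset_range.2 (by omega)))
    have hpow := Nat.pow_le_pow_right (hB1 (by omega)) hcle
    by_cases h : cl v = i ∧ diff i t (row v)
    · obtain ⟨rfl, hd⟩ := h
      rw [range_add_one, filter_insert, if_pos ⟨rfl, hd⟩, prod_insert (by simp)]
      rw [filter_insert, if_pos rfl, card_insert_of_notMem (by simp), pow_succ]
      have h1 := rowRank_succ_mul_le (C := C) hB (hrow v (by omega)) hd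
      have h2 := hρ v (by omega) rfl hd
      generalize #(compat C near diff cl row (cl v) t (v + 1)) = a at *
      generalize #(compat C near diff cl row (cl v) t v) = b at *
      generalize (∏ u ∈ range v with cl u = cl v ∧ diff (cl v) t (row u), ρ u) = p at *
      calc ρ v * p * a ≤ p * ((rowRank C R near diff cl row t v + 1) * a) := by
            rw [Nat.mul_comm (ρ v), Nat.mul_assoc]
            exact Nat.mul_le_mul_left _ (Nat.mul_le_mul_right _ h2)
        _ ≤ p * (B * b) := Nat.mul_le_mul_left _ h1
        _ = B * (p * b) := by ring
        _ ≤ B * (B ^ #{u ∈ range v | cl u = cl v} * #C) := Nat.mul_le_mul_left _ ih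
        _ = _ := by ring
    · rw [compat_succ_of_not h]
      have hf : (range (v + 1)).filter (fun u => cl u = i ∧ diff i t (row u)) =
          (range v).filter (fun u => cl u = i ∧ diff i t (row u)) := by
        rw [range_add_one, filter_insert, if_neg h]
      rw [hf]
      exact ih.trans (Nat.mul_le_mul_right _ hpow)

/-- If every row `row v` of cluster `i` is a row in which more than half of the members of the
cluster differ from its reference column, then these members can be used to find the rows so that
the product of the ranks is small. -/
theorem prod_rowRank_le {B d k : ℕ} (hB : ∀ i j, near i j → #{h ∈ R | diff i j h} ≤ B)
    (mem : ℕ → Finset ℕ) (hmem : ∀ i, mem i ⊆ C) (hne : ∀ i < k, (mem i).Nonempty)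
    (hnear : ∀ i, ∀ j ∈ mem i, near i j) (hcl : ∀ v < d, cl v < k)
    (hrow : ∀ v < d, row v ∈ R) (hB1 : 0 < d → 1 ≤ B)
    (hmaj : ∀ v < d, #(mem (cl v)) < 2 * #{j ∈ mem (cl v) | diff (cl v) j (row v)}) :
    ∃ t : ℕ → ℕ, (∀ v < d, t v ∈ mem (cl v) ∧ diff (cl v) (t v) (row v)) ∧
      ∏ v ∈ range d, (rowRank C R near diff cl row (t v) v + 1) ≤ (B ^ d * #C ^ k) ^ 2 := by
  have hex : ∀ v, ∃ t, v < d → (t ∈ mem (cl v) ∧ diff (cl v) t (row v)) ∧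
      ∀ t' ∈ mem (cl v), diff (cl v) t' (row v) →
        rowRank C R near diff cl row t v ≤ rowRank C R near diff cl row t' v := by
    intro v
    by_cases hv : v < d
    · have h1 := hmaj v hv
      have h2 : ({j ∈ mem (cl v) | diff (cl v) j (row v)} : Finset ℕ).Nonempty := by
        rw [← card_pos]; omega
      obtain ⟨t, ht, hmin⟩ := exists_min_image _ (fun t => rowRank C R near diff cl row t v) h2
      exact ⟨t, fun _ => ⟨mem_filter.1 ht, fun t' h3 h4 => hmin t' (mem_filter.2 ⟨h3, h4⟩)⟩⟩
    · exact ⟨0, fun h => (hv h).elim⟩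
  choose t ht using hex
  refine ⟨t, fun v hv => (ht v hv).1, ?_⟩
  set ρ : ℕ → ℕ := fun v => rowRank C R near diff cl row (t v) v + 1 with hρdef
  have hcluster : ∀ i < k, ∏ v ∈ range d with cl v = i, ρ v ≤
      (B ^ #{v ∈ range d | cl v = i} * #C) ^ 2 := by
    intro i hi
    refine prod_le_sq_of_majority (J := mem i) (hne i hi)
      (inc := fun j v => diff i j (row v)) (fun v _ => by simp [hρdef]) ?_ ?_
    · intro v hv
      obtain ⟨hv1, rfl⟩ := mem_filter.1 hv
      exact (hmaj v (mem_range.1 hv1)).le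
    · intro j hj
      have h1 := prod_mul_card_compat_le (C := C) (cl := cl) (row := row) hB (i := i) (t := j)
        (ρ := ρ) hrow
        (fun v hv hvi hd => by
          subst hvi
          exact Nat.succ_le_succ ((ht v hv).2 j hj hd)) hB1 d le_rfl
      have h2 : 1 ≤ #(compat C near diff cl row i j d) :=
        card_pos.2 ⟨j, mem_filter.2 ⟨hmem i hj, hnear i j hj, fun _ _ _ h => h⟩⟩
      rw [filter_filter]
      exact (Nat.le_mul_of_pos_right _ h2).trans h1
  have hfib : ∏ v ∈ range d, ρ v = ∏ i ∈ range k, ∏ v ∈ range d with cl v = i, ρ v :=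
    (prod_fiberwise_of_maps_to (fun v hv => mem_range.2 (hcl v (mem_range.1 hv))) _).symm
  rw [hfib]
  calc ∏ i ∈ range k, ∏ v ∈ range d with cl v = i, ρ v
      ≤ ∏ i ∈ range k, (B ^ #{v ∈ range d | cl v = i} * #C) ^ 2 :=
        prod_le_prod' fun i hi => hcluster i (mem_range.1 hi)
    _ = (B ^ d * #C ^ k) ^ 2 := by
        rw [prod_pow, prod_mul_distrib, prod_pow_eq_pow_sum, prod_const, card_range]
        rw [← card_eq_sum_card_fiberwise (fun v hv => ?_), card_range]
        simpa using hcl v (by simpa using hv)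

end Telescope

/-- Small ranks have short binary codes; `size x + 1` is the length of the code of `x` with a
terminator. -/
theorem sum_size_succ_le {d B k n : ℕ} {x : ℕ → ℕ} (hd : d ≤ B)
    (h : ∏ v ∈ range d, (x v + 1) ≤ (B ^ d * n ^ k) ^ 2) :
    ∑ v ∈ range d, (Nat.size (x v) + 1) ≤
      B * (2 + 2 * Nat.clog 2 B) + 2 * (k * Nat.clog 2 n) := by
  have h1 : ∀ y, 2 ^ (Nat.size y + 1) ≤ 4 * (y + 1) := by
    intro y
    rcases Nat.eq_zero_or_pos y with rfl | hy
    · simp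
    · have h2 : Nat.size y - 1 < Nat.size y := Nat.sub_lt (Nat.size_pos.2 hy) one_pos
      have h3 := Nat.lt_size.1 h2
      have h4 : Nat.size y + 1 = (Nat.size y - 1) + 2 := by omega
      rw [h4, pow_add]
      omega
  have h5 : 2 ^ (∑ v ∈ range d, (Nat.size (x v) + 1)) ≤
      2 ^ (B * (2 + 2 * Nat.clog 2 B) + 2 * (k * Nat.clog 2 n)) := by
    rcases Nat.eq_zero_or_pos d with rfl | hd0
    · simpa using Nat.one_le_two_pow
    have hB1 : 1 ≤ B := hd0.trans_le hd
    have hb := Nat.le_pow_clog one_lt_two B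
    have hn' := Nat.le_pow_clog one_lt_two n
    calc 2 ^ (∑ v ∈ range d, (Nat.size (x v) + 1))
        = ∏ v ∈ range d, 2 ^ (Nat.size (x v) + 1) := (prod_pow_eq_pow_sum _ _ _).symm
      _ ≤ ∏ v ∈ range d, 4 * (x v + 1) := prod_le_prod' fun v _ => h1 _
      _ = 4 ^ d * ∏ v ∈ range d, (x v + 1) := by rw [prod_mul_distrib]; simp
      _ ≤ 4 ^ d * (B ^ d * n ^ k) ^ 2 := Nat.mul_le_mul_left _ h
      _ ≤ 4 ^ B * (B ^ B * n ^ k) ^ 2 := by gcongr; omega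
      _ ≤ 4 ^ B * (((2 ^ Nat.clog 2 B) ^ B) * (2 ^ Nat.clog 2 n) ^ k) ^ 2 := by gcongr
      _ = _ := by
        rw [show (4 : ℕ) = 2 ^ 2 by norm_num]
        simp only [← pow_mul, ← pow_add]
        congr 1
        ring
  exact (Nat.pow_le_pow_iff_right (by norm_num)).1 h5

/-! ### Solutions as labelings -/

namespace CCOInstance

variable (I : CCOInstance)

/-- The entry of the matrix in row `h` and column `j`, for natural numbers `h` and `j`. -/
def ent (h j : ℕ) : ℕ := if p : h < I.m ∧ j < I.n then I.A ⟨h, p.1⟩ ⟨j, p.2⟩ else 0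

/-- The entry with index `x` of the truth table of row `h`. -/
def tab (h x : ℕ) : ℕ :=
  if p : h < I.m ∧ x < I.s ^ I.k then
    if finFunctionFinEquiv.symm ⟨x, p.2⟩ ∈ I.R ⟨h, p.1⟩ then 1 else 0
  else 0

/-- The Hamming distance of column `j` and the vector `c`. -/
def dst (j : ℕ) (c : ℕ → ℕ) : ℕ := #{h ∈ range I.m | I.ent h j ≠ c h}

/-- The index of the tuple `t` in a truth table. -/
def tupleIdx (t : ℕ → ℕ) : ℕ := ∑ i ∈ range I.k, t i * I.s ^ i

/-- The columns with label `i + 1`. -/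
def members (lab : ℕ → ℕ) (i : ℕ) : Finset ℕ := {j ∈ range I.n | lab j = i + 1}

/-- The labels `lab` (`0` for outliers, `i + 1` for the columns of cluster `i`) and the centers `c`
describe a solution. -/
structure Valid (lab : ℕ → ℕ) (c : ℕ → ℕ → ℕ) : Prop where
  lab_le : ∀ j < I.n, lab j ≤ I.k
  card_outliers : #{j ∈ range I.n | lab j = 0} ≤ I.ℓ
  nonempty : ∀ i < I.k, (I.members lab i).Nonempty
  lt : ∀ i < I.k, ∀ h < I.m, c i h < I.s
  rel : ∀ h < I.m, I.tab h (I.tupleIdx fun i => c i h) = 1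
  cost : ∑ j ∈ range I.n with lab j ≠ 0, I.dst j (c (lab j - 1)) ≤ I.B

variable {I}

theorem s_pos (I : CCOInstance) : 0 < I.s :=
  (Nat.zero_le _).trans_lt (I.A ⟨0, I.m_pos⟩ ⟨0, I.n_pos⟩).2

theorem ent_lt (I : CCOInstance) (h j : ℕ) : I.ent h j < I.s := by
  unfold ent; split
  · exact Fin.is_lt _
  · exact I.s_pos

theorem ent_fin (I : CCOInstance) (h : Fin I.m) (j : Fin I.n) : I.ent h j = I.A h j := by
  simp [ent]

theorem tupleIdx_congr {t t' : ℕ → ℕ} (h : ∀ i < I.k, t i = t' i) :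
    I.tupleIdx t = I.tupleIdx t' :=
  sum_congr rfl fun i hi => by rw [h i (mem_range.1 hi)]

theorem tupleIdx_fin (I : CCOInstance) (t : Fin I.k → Fin I.s) {t' : ℕ → ℕ}
    (h : ∀ i : Fin I.k, t' i = t i) : I.tupleIdx t' = finFunctionFinEquiv t := by
  rw [finFunctionFinEquiv_apply, tupleIdx, ← Fin.sum_univ_eq_sum_range (fun i => t' i * I.s ^ i)]
  simp only [h]

theorem tab_tupleIdx (I : CCOInstance) (h : Fin I.m) (t : Fin I.k → Fin I.s) {t' : ℕ → ℕ}
    (ht : ∀ i : Fin I.k, t' i = t i) : I.tab h (I.tupleIdx t') = if t ∈ I.R h then 1 else 0 := by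
  have h1 : I.tupleIdx t' < I.s ^ I.k := by
    rw [tupleIdx_fin I t ht]; exact Fin.is_lt _
  have h2 : (⟨I.tupleIdx t', h1⟩ : Fin (I.s ^ I.k)) = finFunctionFinEquiv t :=
    Fin.ext (tupleIdx_fin I t ht)
  rw [tab, dif_pos ⟨h.2, h1⟩, h2, Equiv.symm_apply_apply]

theorem tupleIdx_lt (I : CCOInstance) {t : ℕ → ℕ} (h : ∀ i < I.k, t i < I.s) :
    I.tupleIdx t < I.s ^ I.k := by
  rw [tupleIdx_fin I (fun i => ⟨t i, h i i.2⟩) (t' := t) (fun _ => rfl)]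
  exact Fin.is_lt _

theorem tab_le_one (I : CCOInstance) (h x : ℕ) : I.tab h x ≤ 1 := by
  unfold tab; split_ifs <;> omega

theorem dst_fin (I : CCOInstance) (j : Fin I.n) (v : Fin I.m → Fin I.s) {c : ℕ → ℕ}
    (h : ∀ x : Fin I.m, c x = v x) : I.dst j c = hammingDist (I.col j) v := by
  rw [dst, hammingDist, card_filter, card_filter, ← Fin.sum_univ_eq_sum_range
    (fun x => if I.ent x j ≠ c x then 1 else 0)]
  refine sum_congr rfl fun x _ => ?_
  simp only [h, ent_fin, col, ne_eq, Fin.ext_iff]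

theorem mem_members {lab : ℕ → ℕ} {i j : ℕ} : j ∈ I.members lab i ↔ j < I.n ∧ lab j = i + 1 := by
  simp [members]

theorem sum_members (I : CCOInstance) {lab : ℕ → ℕ} (h : ∀ j < I.n, lab j ≤ I.k) (f : ℕ → ℕ) :
    ∑ j ∈ range I.n with lab j ≠ 0, f j = ∑ i ∈ range I.k, ∑ j ∈ I.members lab i, f j := by
  rw [← sum_fiberwise_of_maps_to (g := fun j => lab j - 1) (t := range I.k)]
  · refine sum_congr rfl fun i _ => sum_congr ?_ fun _ _ => rfl
    ext j
    simp only [mem_filter, mem_members, mem_range, and_assoc, and_congr_right_iff]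
    intro _; omega
  · intro j hj
    simp only [mem_filter, mem_range] at hj ⊢
    have := h j hj.1
    omega

theorem Valid.cost_members {lab : ℕ → ℕ} {c : ℕ → ℕ → ℕ} (h : I.Valid lab c) :
    ∑ i ∈ range I.k, ∑ j ∈ I.members lab i, I.dst j (c i) ≤ I.B := by
  refine le_of_eq_of_le ?_ h.cost
  rw [sum_members I h.lab_le]
  refine sum_congr rfl fun i _ => sum_congr rfl fun j hj => ?_
  rw [(mem_members.1 hj).2, Nat.add_sub_cancel]

theorem sum_range_filter_fin (n : ℕ) (p : ℕ → Prop) [DecidablePred p] (f : ℕ → ℕ) :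
    ∑ j ∈ range n with p j, f j = ∑ j ∈ univ.filter fun j : Fin n => p j, f j := by
  rw [sum_filter, sum_filter, ← Fin.sum_univ_eq_sum_range (fun j => if p j then f j else 0)]

theorem IsYes.exists_valid (h : I.IsYes) : ∃ lab c, I.Valid lab c := by
  classical
  obtain ⟨O, cl, c, hO, hne, hdis, hout, hsat, hcost⟩ := h
  set lb : Fin I.n → ℕ := fun j => if h : ∃ i, j ∈ cl i then (h.choose : ℕ) + 1 else 0 with hlb
  have lb1 : ∀ i j, lb j = (i : Fin I.k) + 1 ↔ j ∈ cl i := by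
    intro i j
    constructor
    · intro hj
      by_cases hx : ∃ i, j ∈ cl i
      · simp only [hlb, dif_pos hx, Nat.add_right_cancel_iff] at hj
        rw [← Fin.ext hj]
        exact hx.choose_spec
      · simp [hlb, hx] at hj
    · intro hj
      have hx : ∃ i, j ∈ cl i := ⟨i, hj⟩
      simp only [hlb, dif_pos hx, Nat.add_right_cancel_iff]
      by_contra hc
      exact disjoint_left.1 (hdis hx.choose i (fun h => hc (by rw [h]))) hx.choose_spec hj
  have lb0 : ∀ j, lb j = 0 ↔ j ∈ O := by
    intro j
    have := hout j
    by_cases hx : ∃ i, j ∈ cl i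
    · simp only [hlb, dif_pos hx]
      simpa using this.2 hx
    · simp only [hlb, dif_neg hx, true_iff]
      by_contra hc
      exact hx (this.1 hc)
  have lbk : ∀ j, lb j ≤ I.k := by
    intro j
    simp only [hlb]; split
    · exact Fin.is_lt _
    · exact Nat.zero_le _
  set lab : ℕ → ℕ := fun j => if h : j < I.n then lb ⟨j, h⟩ else 0
  have hlab : ∀ j : Fin I.n, lab j = lb j := fun j => by simp [lab]
  set cc : ℕ → ℕ → ℕ := fun i h => if p : i < I.k ∧ h < I.m then c ⟨i, p.1⟩ ⟨h, p.2⟩ else 0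
  have hcc : ∀ (i : Fin I.k) (h : Fin I.m), cc i h = c i h := fun i h => by simp [cc]
  have hlabk : ∀ j < I.n, lab j ≤ I.k := fun j hj => by
    have := hlab ⟨j, hj⟩
    simp only at this
    rw [this]; exact lbk _
  refine ⟨lab, cc, hlabk, ?_, ?_, ?_, ?_, ?_⟩
  · rw [card_eq_sum_ones, sum_range_filter_fin, ← card_eq_sum_ones]
    refine le_of_eq_of_le ?_ hO
    congr 1
    ext j
    simp [hlab, lb0]
  · intro i hi
    obtain ⟨j, hj⟩ := hne ⟨i, hi⟩
    exact ⟨j, mem_members.2 ⟨j.2, by rw [hlab]; exact (lb1 ⟨i, hi⟩ j).2 hj⟩⟩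
  · intro i hi h hh
    have := hcc ⟨i, hi⟩ ⟨h, hh⟩
    simp only at this
    rw [this]; exact Fin.is_lt _
  · intro h hh
    rw [tab_tupleIdx I ⟨h, hh⟩ (fun i => c i ⟨h, hh⟩) (fun i => hcc i ⟨h, hh⟩), if_pos (hsat _)]
  · rw [sum_members I hlabk, ← Fin.sum_univ_eq_sum_range
      (fun i => ∑ j ∈ I.members lab i, I.dst j (cc (lab j - 1)))]
    refine le_of_eq_of_le (sum_congr rfl fun i _ => ?_) hcost
    rw [members, sum_range_filter_fin]
    refine sum_congr (by ext j; simp [hlab, lb1]) fun j hj => ?_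
    rw [hlab, (lb1 i j).2 hj, Nat.add_sub_cancel]
    exact dst_fin I j (c i) (fun x => hcc i x)

theorem Valid.exists_isSolution {lab : ℕ → ℕ} {c : ℕ → ℕ → ℕ} (h : I.Valid lab c) :
    ∃ O cl c', I.IsSolution O cl c' ∧ (∀ j ∈ O, lab j = 0) ∧
      (∀ i, ∀ j ∈ cl i, lab j = (i : ℕ) + 1) ∧
      ∀ (i : Fin I.k) (x : Fin I.m), (c' i x : ℕ) = c i x := by
  classical
  set c' : Fin I.k → Fin I.m → Fin I.s := fun i x => ⟨c i x, h.lt i i.2 x x.2⟩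
  refine ⟨univ.filter fun j => lab j = 0, fun i => univ.filter fun j => lab j = (i : ℕ) + 1,
    c', ⟨?_, ?_, ?_, ?_, ?_, ?_⟩, by simp, by simp, fun _ _ => rfl⟩
  · have := h.card_outliers
    rwa [card_eq_sum_ones, sum_range_filter_fin, ← card_eq_sum_ones] at this
  · intro i
    obtain ⟨j, hj⟩ := h.nonempty i i.2
    obtain ⟨h1, h2⟩ := mem_members.1 hj
    exact ⟨⟨j, h1⟩, by simpa using h2⟩
  · intro i i' hii
    rw [disjoint_left]
    intro j hj hj'
    simp only [mem_filter, mem_univ, true_and] at hj hj'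
    exact hii (Fin.ext (by omega))
  · intro j
    simp only [mem_filter, mem_univ, true_and]
    constructor
    · intro hj
      have := h.lab_le j j.2
      exact ⟨⟨lab j - 1, by omega⟩, by simp only; omega⟩
    · rintro ⟨i, hi⟩; omega
  · intro x
    have h1 := h.rel x x.2
    rw [tab_tupleIdx I x (fun i => c' i x) (fun i => rfl)] at h1
    by_contra hc
    rw [if_neg hc] at h1
    exact zero_ne_one h1
  · have h1 := h.cost_members
    rw [← Fin.sum_univ_eq_sum_range (fun i => ∑ j ∈ I.members lab i, I.dst j (c i))] at h1
    refine le_of_eq_of_le (sum_congr rfl fun i _ => ?_) h1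
    rw [members, sum_range_filter_fin]
    exact sum_congr rfl fun j _ => (dst_fin I j (c' i) (fun x => rfl)).symm

theorem k_le_n_of_isYes (h : I.IsYes) : I.k ≤ I.n := by
  obtain ⟨lab, c, hv⟩ := h.exists_valid
  choose! f hf using hv.nonempty
  have : #(range I.k) ≤ #(range I.n) := card_le_card_of_injOn f
    (fun i hi => by simpa using (mem_members.1 (hf i (by simpa using hi))).1) (by
      intro i hi i' hi' hii
      have h1 := (mem_members.1 (hf i (by simpa using hi))).2
      have h2 := (mem_members.1 (hf i' (by simpa using hi'))).2
      rw [hii] at h1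
      omega)
  simpa using this

/-! ### Reference columns -/

variable (I)

/-- For every cluster `i`, column `r i` belongs to it. -/
def IsRef (lab : ℕ → ℕ) (r : ℕ → ℕ) : Prop := ∀ i < I.k, r i ∈ I.members lab i

variable {I}

/-- A labeling has centers and reference columns with the following properties. Every reference
column is at least as close to its center as the other columns of its cluster. If a row in which a
center differs from the reference column satisfies the relation already for the reference columns,
then in some cluster the center differs from the reference column, and so do more than half of the
columns. Indeed, otherwise the entries of the reference columns could be used in that row. -/
theorem Valid.exists_refs {lab : ℕ → ℕ} {c : ℕ → ℕ → ℕ} (hv : I.Valid lab c) :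
    ∃ c r, I.Valid lab c ∧ I.IsRef lab r ∧
      (∀ i < I.k, ∀ j ∈ I.members lab i, I.dst (r i) (c i) ≤ I.dst j (c i)) ∧
      ∀ h < I.m, I.tab h (I.tupleIdx fun i => I.ent h (r i)) = 1 →
        (∃ i < I.k, c i h ≠ I.ent h (r i)) → ∃ i < I.k, c i h ≠ I.ent h (r i) ∧
          #(I.members lab i) < 2 * #{j ∈ I.members lab i | I.ent h j ≠ I.ent h (r i)} := by
  classical
  have hex : ∃ N, ∃ c r, I.Valid lab c ∧ I.IsRef lab r ∧
      ∑ i ∈ range I.k, I.dst (r i) (c i) = N := by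
    choose! r hr using hv.nonempty
    exact ⟨_, c, r, hv, hr, rfl⟩
  obtain ⟨c, r, hv, hr, hN⟩ := Nat.find_spec hex
  have hmin : ∀ c' r', I.Valid lab c' → I.IsRef lab r' →
      ∑ i ∈ range I.k, I.dst (r i) (c i) ≤ ∑ i ∈ range I.k, I.dst (r' i) (c' i) := by
    intro c' r' h1 h2
    rw [hN]
    exact Nat.find_min' hex ⟨c', r', h1, h2, rfl⟩
  refine ⟨c, r, hv, hr, ?_, ?_⟩
  · intro i hi j hj
    by_contra hlt
    have h1 := hmin c (Function.update r i j) hv (fun i' hi' => by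
      by_cases h : i' = i
      · subst h; simpa using hj
      · simpa [h] using hr i' hi')
    refine absurd h1 (not_le.2 (sum_lt_sum (fun i' _ => ?_) ⟨i, mem_range.2 hi, ?_⟩))
    · by_cases h : i' = i
      · subst h; simpa using (not_le.1 hlt).le
      · simp [h]
    · simpa using hlt
  · rintro h hh htab ⟨i0, hi0, hne0⟩
    by_contra hcon
    push Not at hcon
    set c' : ℕ → ℕ → ℕ := fun i x => if x = h then I.ent h (r i) else c i x with hc'
    have hsplit : ∀ (j : ℕ) (v : ℕ → ℕ), I.dst j v =
        (if I.ent h j ≠ v h then 1 else 0) +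
          ∑ x ∈ (range I.m).erase h, if I.ent x j ≠ v x then 1 else 0 := by
      intro j v
      rw [dst, card_filter, ← add_sum_erase _ _ (mem_range.2 hh)]
    have hrest : ∀ (j i : ℕ), (∑ x ∈ (range I.m).erase h, if I.ent x j ≠ c' i x then 1 else 0) =
        ∑ x ∈ (range I.m).erase h, if I.ent x j ≠ c i x then 1 else 0 := by
      intro j i
      refine sum_congr rfl fun x hx => ?_
      simp [hc', (mem_erase.1 hx).1]
    have hcost : ∀ i < I.k, ∑ j ∈ I.members lab i, I.dst j (c' i) ≤
        ∑ j ∈ I.members lab i, I.dst j (c i) := by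
      intro i hi
      simp only [hsplit, sum_add_distrib, hrest, ← card_filter]
      refine Nat.add_le_add_right ?_ _
      simp only [hc', if_true]
      by_cases hci : c i h = I.ent h (r i)
      · rw [hci]
      · have h1 := hcon i hi hci
        have h2 := card_filter_add_card_filter_not (s := I.members lab i)
          (fun j => I.ent h j ≠ I.ent h (r i))
        have h3 : #{j ∈ I.members lab i | ¬ I.ent h j ≠ I.ent h (r i)} ≤
            #{j ∈ I.members lab i | I.ent h j ≠ c i h} := by
          refine card_le_card fun j hj => ?_
          simp only [mem_filter, not_not] at hj ⊢
          exact ⟨hj.1, by rw [hj.2]; exact Ne.symm hci⟩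
        omega
    have hv' : I.Valid lab c' := by
      refine ⟨hv.lab_le, hv.card_outliers, hv.nonempty, ?_, ?_, ?_⟩
      · intro i hi x hx
        simp only [hc']; split
        · exact I.ent_lt _ _
        · exact hv.lt i hi x hx
      · intro x hx
        by_cases hxh : x = h
        · subst hxh; simpa [hc'] using htab
        · simpa [hc', hxh] using hv.rel x hx
      · rw [sum_members I hv.lab_le]
        refine le_trans ?_ hv.cost_members
        refine sum_le_sum fun i hi => ?_
        refine le_trans (le_of_eq (sum_congr rfl fun j hj => ?_)) (hcost i (mem_range.1 hi))
        rw [(mem_members.1 hj).2, Nat.add_sub_cancel]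
    refine absurd (hmin c' r hv' hr) (not_le.2 (sum_lt_sum (fun i _ => ?_)
      ⟨i0, mem_range.2 hi0, ?_⟩))
    · rw [hsplit, hsplit, hrest]; simp [hc']
    · rw [hsplit, hsplit, hrest]; simp [hc', hne0.symm]

end CCOInstance

/-! ### Guesses that lead to a solution -/

namespace CCOInstance

variable (I : CCOInstance)

/-- The number of ternary digits reserved for the ranks of the rows. -/
def codeLen : ℕ := I.B * (2 + 2 * Nat.clog 2 I.B) + 2 * (I.k * Nat.clog 2 I.n)

/-- The column `r i`, as a vector. -/
def refCol (r : ℕ → ℕ) (i : ℕ) : ℕ → ℕ := fun h => I.ent h (r i)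

/-- The degree of row `h` in the step that finds the row with number `v`: the number of columns `j`
near the reference column of cluster `cl v` that differ from it in row `h` and in the rows found
before that are recorded, by the pairs `(ve e, te e)`, as incident to `tt v`. -/
def pickDegree (r row cl tt ve te : ℕ → ℕ) (v h : ℕ) : ℕ :=
  #{j ∈ range I.n | (I.dst j (I.refCol r (cl v)) ≤ I.B ∧
      ∀ e < I.B, te e = tt v → ve e < v → I.ent (row (ve e)) j ≠ I.ent (row (ve e)) (r (cl v))) ∧
    I.ent h j ≠ I.ent h (r (cl v))}

/-- The rank by which the row with number `v` is encoded. -/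
def pickRank (r row cl tt ve te : ℕ → ℕ) (v : ℕ) : ℕ :=
  rank (range I.m) (I.pickDegree r row cl tt ve te v) (row v)

/-- Row `h` is one of the rows `row v`, `v < d`, or the reference columns violate its relation. -/
def Changed (r row : ℕ → ℕ) (d h : ℕ) : Prop :=
  I.tab h (I.tupleIdx fun i => I.ent h (r i)) ≠ 1 ∨ ∃ v < d, row v = h

/-- A guess of reference columns `r`, of `d` rows `row v` with the data by which they are decoded,
such that the centers of a solution agree with the reference columns outside at most `B` rows that
are known from the guess. -/
structure GoodGuess (lab : ℕ → ℕ) (c : ℕ → ℕ → ℕ) (r : ℕ → ℕ) (d : ℕ)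
    (row cl tt ve te : ℕ → ℕ) : Prop where
  valid : I.Valid lab c
  ref : I.IsRef lab r
  d_le : d ≤ I.B
  row_lt : ∀ v < d, row v < I.m
  cl_lt : ∀ v < d, cl v < I.k
  tt_lt : ∀ v < d, tt v < I.B
  ve_lt : ∀ e < I.B, ve e < I.B
  te_lt : ∀ e < I.B, te e < I.B
  size_le : ∑ v ∈ range d, (Nat.size (I.pickRank r row cl tt ve te v) + 1) ≤ I.codeLen
  card_changed : ∀ [DecidablePred (I.Changed r row d)],
    #{h ∈ range I.m | I.Changed r row d h} ≤ I.B
  eq_of_not_changed : ∀ h < I.m, ¬ I.Changed r row d h → ∀ i < I.k, c i h = I.ent h (r i)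

variable {I}

theorem dst_refCol_le (I : CCOInstance) (j : ℕ) (r : ℕ → ℕ) (i : ℕ) (c : ℕ → ℕ) :
    I.dst j (I.refCol r i) ≤ I.dst j c + I.dst (r i) c := by
  unfold dst refCol
  refine (card_le_card fun h hh => ?_).trans (card_union_le _ _)
  rw [mem_union, mem_filter, mem_filter]
  rw [mem_filter] at hh
  by_cases h1 : I.ent h j = c h
  · exact Or.inr ⟨hh.1, fun h2 => hh.2 (h1.trans h2.symm)⟩
  · exact Or.inl ⟨hh.1, h1⟩

theorem Valid.exists_goodGuess {lab : ℕ → ℕ} {c : ℕ → ℕ → ℕ} (hv : I.Valid lab c) :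
    ∃ c r d row cl tt ve te, I.GoodGuess lab c r d row cl tt ve te := by
  classical
  obtain ⟨c, r, hv, hr, hclose, hmaj⟩ := hv.exists_refs
  set mem := I.members lab with hmem
  -- Every reference column pays for the whole cluster.
  have hsum : ∑ i ∈ range I.k, #(mem i) * I.dst (r i) (c i) ≤ I.B := by
    refine le_trans (sum_le_sum fun i hi => ?_) hv.cost_members
    rw [← smul_eq_mul]
    exact card_nsmul_le_sum _ _ _ fun j hj => hclose i (mem_range.1 hi) j hj
  have hmem1 : ∀ i < I.k, 1 ≤ #(mem i) := fun i hi => card_pos.2 ⟨r i, hr i hi⟩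
  have hsum1 : ∑ i ∈ range I.k, I.dst (r i) (c i) ≤ I.B :=
    (sum_le_sum fun i hi => Nat.le_mul_of_pos_left _ (hmem1 i (mem_range.1 hi))).trans hsum
  -- The rows `h` to be found, with a cluster `i` in which they are popular.
  set P : Finset (ℕ × ℕ) := (range I.k ×ˢ range I.m).filter fun p =>
    c p.1 p.2 ≠ I.ent p.2 (r p.1) ∧
      #(mem p.1) < 2 * #{j ∈ mem p.1 | I.ent p.2 j ≠ I.ent p.2 (r p.1)} with hP
  have hfib : ∀ i, #{p ∈ P | p.1 = i} ≤ I.dst (r i) (c i) := by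
    intro i
    refine card_le_card_of_injOn (fun p => p.2) (fun p hp => ?_) (fun p hp q hq hpq => ?_)
    · simp only [hP, coe_filter, mem_filter, mem_product, mem_range, Set.mem_ofPred_eq] at hp ⊢
      obtain ⟨⟨⟨_, h1⟩, h2, _⟩, rfl⟩ := hp
      exact ⟨h1, h2.symm⟩
    · simp only [coe_filter, Set.mem_ofPred_eq] at hp hq
      exact Prod.ext (hp.2.trans hq.2.symm) hpq
  have hPmap : ∀ p ∈ P, p.1 ∈ range I.k := fun p hp =>
    (mem_product.1 (mem_filter.1 hp).1).1
  have hPcard : #P ≤ I.B := by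
    rw [card_eq_sum_card_fiberwise hPmap]
    exact (sum_le_sum fun i _ => hfib i).trans hsum1
  obtain ⟨f, hf1, hf2, hf3⟩ := exists_enum P
  set d := #P with hd
  set cl : ℕ → ℕ := fun v => (f v).1
  set row : ℕ → ℕ := fun v => (f v).2
  have hPf : ∀ v < d, (cl v < I.k ∧ row v < I.m) ∧ c (cl v) (row v) ≠ I.ent (row v) (r (cl v)) ∧
      #(mem (cl v)) < 2 * #{j ∈ mem (cl v) | I.ent (row v) j ≠ I.ent (row v) (r (cl v))} := by
    intro v hvd
    simpa [hP] using hf1 v hvd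
  -- The incidences of these rows with the columns of their cluster.
  set Q : Finset (ℕ × ℕ) := (range d ×ˢ range I.n).filter fun q =>
    q.2 ∈ mem (cl q.1) ∧ I.ent (row q.1) q.2 ≠ I.ent (row q.1) (r (cl q.1)) with hQ
  have hQcard : #Q ≤ I.B := by
    have h1 : #Q ≤ ∑ v ∈ range d, #(mem (cl v)) := by
      rw [card_eq_sum_card_fiberwise (f := fun q => q.1) (t := range d)
        (fun q hq => (mem_product.1 (mem_filter.1 hq).1).1)]
      refine sum_le_sum fun v _ => card_le_card_of_injOn (fun q => q.2) (fun q hq => ?_)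
        (fun q hq q' hq' h => ?_)
      · simp only [coe_filter, mem_filter, Set.mem_ofPred_eq] at hq
        obtain ⟨⟨_, h1, _⟩, rfl⟩ := hq
        exact h1
      · simp only [coe_filter, Set.mem_ofPred_eq] at hq hq'
        exact Prod.ext (hq.2.trans hq'.2.symm) h
    refine h1.trans (le_trans ?_ hsum)
    have h2 : ∑ v ∈ range d, #(mem (cl v)) = ∑ p ∈ P, #(mem p.1) := by
      refine sum_bij (fun v _ => f v) (fun v hvd => hf1 v (mem_range.1 hvd))
        (fun u hu v hvd h => hf3 u (mem_range.1 hu) v (mem_range.1 hvd) h)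
        (fun p hp => ?_) (fun v _ => rfl)
      obtain ⟨v, hvd, rfl⟩ := hf2 p hp
      exact ⟨v, mem_range.2 hvd, rfl⟩
    rw [h2, ← sum_fiberwise_of_maps_to hPmap]
    refine sum_le_sum fun i _ => ?_
    rw [sum_congr rfl fun p hp => by rw [(mem_filter.1 hp).2], sum_const, smul_eq_mul,
      Nat.mul_comm]
    exact Nat.mul_le_mul_left _ (hfib i)
  obtain ⟨t, ht, hprod⟩ := prod_rowRank_le (C := range I.n) (R := range I.m)
    (near := fun i j => I.dst j (I.refCol r i) ≤ I.B)
    (diff := fun i j h => I.ent h j ≠ I.ent h (r i)) (cl := cl) (row := row)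
    (B := I.B) (d := d) (k := I.k) (fun i j h => h) mem (fun i => filter_subset _ _)
    (fun i hi => ⟨r i, hr i hi⟩)
    (by
      intro i j hj
      by_cases hjr : j = r i
      · rw [hjr]
        simp [dst, refCol]
      by_cases hi : i < I.k
      · refine (dst_refCol_le I j r i (c i)).trans (le_trans ?_ hv.cost_members)
        calc I.dst j (c i) + I.dst (r i) (c i) = ∑ x ∈ {j, r i}, I.dst x (c i) :=
              (sum_pair (f := fun x => I.dst x (c i)) hjr).symm
          _ ≤ ∑ x ∈ mem i, I.dst x (c i) := sum_le_sum_of_subset (by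
              intro x hx
              simp only [mem_insert, mem_singleton] at hx
              rcases hx with rfl | rfl
              · exact hj
              · exact hr i hi)
          _ ≤ _ := single_le_sum (f := fun i => ∑ x ∈ mem i, I.dst x (c i))
              (fun _ _ => Nat.zero_le _) (mem_range.2 hi)
      · have h1 := mem_members.1 hj
        have h2 := hv.lab_le j h1.1
        omega)
    (fun v hvd => (hPf v hvd).1.1) (fun v hvd => mem_range.2 (hPf v hvd).1.2)
    (fun h => h.trans_le hPcard) (fun v hvd => (hPf v hvd).2.2)
  -- The columns that occur in incidences get numbers below `B`.
  obtain ⟨g, hg1, hg2, hg3⟩ := exists_enum (Q.image Prod.snd)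
  have hgcard : #(Q.image Prod.snd) ≤ I.B := card_image_le.trans hQcard
  have hidex : ∀ j, ∃ a, j ∈ Q.image Prod.snd → a < #(Q.image Prod.snd) ∧ g a = j := by
    intro j
    by_cases hj : j ∈ Q.image Prod.snd
    · obtain ⟨a, ha⟩ := hg2 j hj
      exact ⟨a, fun _ => ha⟩
    · exact ⟨0, fun h => (hj h).elim⟩
  choose num hnum using hidex
  have hnum_inj : ∀ j ∈ Q.image Prod.snd, ∀ j' ∈ Q.image Prod.snd, num j = num j' → j = j' := by
    intro j hj j' hj' h
    rw [← (hnum j hj).2, ← (hnum j' hj').2, h]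
  obtain ⟨q, hq1, hq2, hq3⟩ := exists_enum Q
  have htQ : ∀ v < d, (v, t v) ∈ Q := by
    intro v hvd
    obtain ⟨h1, h2⟩ := ht v hvd
    exact mem_filter.2 ⟨mem_product.2 ⟨mem_range.2 hvd, mem_range.2 (mem_members.1 h1).1⟩, h1, h2⟩
  have htS : ∀ v < d, t v ∈ Q.image Prod.snd := fun v hvd =>
    mem_image.2 ⟨_, htQ v hvd, rfl⟩
  have hqS : ∀ e < #Q, (q e).2 ∈ Q.image Prod.snd := fun e he =>
    mem_image.2 ⟨_, hq1 e he, rfl⟩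
  -- Unused entries of the list of incidences refer to a step that is never before another one.
  set ve : ℕ → ℕ := fun e => if e < #Q then (q e).1 else I.B - 1 with hve
  set te : ℕ → ℕ := fun e => if e < #Q then num (q e).2 else 0 with hte
  set tt : ℕ → ℕ := fun v => num (t v) with htt
  have hdeg : ∀ v < d, I.pickDegree r row cl tt ve te v =
      compatDeg (range I.n) (fun i j => I.dst j (I.refCol r i) ≤ I.B)
        (fun i j h => I.ent h j ≠ I.ent h (r i)) cl row (cl v) (t v) v := by
    intro v hvd
    funext h
    rw [pickDegree, compatDeg, compat, filter_filter]
    congr 1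
    ext j
    simp only [mem_filter, and_congr_right_iff, and_congr_left_iff]
    intro _ _ _
    constructor
    · intro H u hu hcu hinc
      have huQ : (u, t v) ∈ Q := by
        refine mem_filter.2 ⟨mem_product.2 ⟨mem_range.2 (hu.trans hvd), ?_⟩, ?_, ?_⟩
        · exact mem_range.2 (mem_members.1 (ht v hvd).1).1
        · simp only [hcu]; exact (ht v hvd).1
        · simp only [hcu]; exact hinc
      obtain ⟨e, he, hqe⟩ := hq2 _ huQ
      have h1 : ve e = u := by simp [hve, he, hqe]
      have h2 : te e = tt v := by simp [hte, htt, he, hqe]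
      have := H e (he.trans_le hQcard) h2 (h1 ▸ hu)
      rwa [h1] at this
    · intro H e he hee hev
      by_cases heQ : e < #Q
      · have h1 : ve e = (q e).1 := by simp [hve, heQ]
        have h2 : te e = num (q e).2 := by simp [hte, heQ]
        have h3 : (q e).2 = t v :=
          hnum_inj _ (hqS e heQ) _ (htS v hvd) (by rw [← h2, hee])
        have h4 := (mem_filter.1 (hq1 e heQ)).2
        rw [h3] at h4
        rw [h1] at hev ⊢
        have h5 : cl (q e).1 = cl v := by
          have h6 := (mem_members.1 h4.1).2
          have h7 := (mem_members.1 (ht v hvd).1).2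
          omega
        refine H _ hev h5 ?_
        rw [← h5]; exact h4.2
      · have h1 : ve e = I.B - 1 := by simp [hve, heQ]
        omega
  refine ⟨c, r, d, row, cl, tt, ve, te, hv, hr, hPcard, fun v hvd => (hPf v hvd).1.2,
    fun v hvd => (hPf v hvd).1.1, fun v hvd => ((hnum _ (htS v hvd)).1.trans_le hgcard), ?_, ?_, ?_,
    ?_, ?_⟩
  · intro e he
    simp only [hve]; split
    · rename_i heQ
      exact (mem_range.1 (mem_product.1 (mem_filter.1 (hq1 e heQ)).1).1).trans_le hPcard
    · omega
  · intro e he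
    simp only [hte]; split
    · rename_i heQ
      exact (hnum _ (hqS e heQ)).1.trans_le hgcard
    · omega
  · refine sum_size_succ_le hPcard ?_
    rw [card_range] at hprod
    refine le_of_eq_of_le (prod_congr rfl fun v hvd => ?_) hprod
    rw [pickRank, hdeg v (mem_range.1 hvd)]
    rfl
  · intro _
    have h1 : ∀ h, h < I.m → I.Changed r row d h → ∃ i < I.k, c i h ≠ I.ent h (r i) := by
      rintro h hh (h1 | ⟨v, hvd, rfl⟩)
      · by_contra hcon
        push Not at hcon
        exact h1 (by rw [← tupleIdx_congr hcon]; exact hv.rel h hh)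
      · exact ⟨cl v, (hPf v hvd).1.1, (hPf v hvd).2.1⟩
    refine le_trans ?_ hsum1
    calc #{h ∈ range I.m | I.Changed r row d h}
        ≤ #((range I.k).biUnion fun i => {h ∈ range I.m | I.ent h (r i) ≠ c i h}) := by
          refine card_le_card fun h hh => ?_
          simp only [mem_filter, mem_range, mem_biUnion] at hh ⊢
          obtain ⟨i, hi, hne⟩ := h1 h hh.1 hh.2
          exact ⟨i, hi, hh.1, hne.symm⟩
      _ ≤ _ := card_biUnion_le
  · intro h hh hnc i hi
    by_contra hne
    simp only [Changed, not_or, not_not] at hnc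
    obtain ⟨i', hi', h1, h2⟩ := hmaj h hh hnc.1 ⟨i, hi, hne⟩
    obtain ⟨v, hvd, hfv⟩ := hf2 (i', h) (mem_filter.2
      ⟨mem_product.2 ⟨mem_range.2 hi', mem_range.2 hh⟩, h1, h2⟩)
    exact hnc.2 ⟨v, hvd, by simp only [row, hfv]⟩

end CCOInstance

/-! ### Reasoning about runs -/

namespace Imp

open Ex Cm

/-- The state `S'` differs from `S` only in the variables `vs` and the arrays `as`. -/
structure Frame (vs : List Var) (as : List Arr) (S S' : HState) : Prop where
  reg : ∀ y, y ∉ vs → S'.reg y = S.reg y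
  arr : ∀ a, a ∉ as → S'.arr a = S.arr a
  low : S'.low = S.low
  base : S'.base = S.base
  cap : S'.cap = S.cap

theorem Cm.frame (p : Cm) (S : HState) (hp : p.wl = false) : Frame p.wv p.wa S (p.run S) :=
  ⟨fun _ h => run_reg p S h, fun _ h => run_arr p S h, run_low p S hp, run_base p S, run_cap p S⟩

/-- Induction over the rounds of a loop. -/
theorem loop_spec {x b : Var} {p : Cm} {S : HState} (Q : ℕ → HState → Prop)
    (hp : p.wl = false) (h0 : Q 0 (S.setReg x 0))
    (hs : ∀ i < S.reg b, ∀ S', Frame (x :: p.wv) p.wa S S' → S'.reg x = i → Q i S' →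
      Q (i + 1) ((p.run S').setReg x (i + 1))) :
    Q (S.reg b) ((Cm.loop x b p).run S) := by
  have key : ∀ i ≤ S.reg b, Frame (x :: p.wv) p.wa S (loopRun p.run x S i) ∧
      (loopRun p.run x S i).reg x = i ∧ Q i (loopRun p.run x S i) := by
    intro i
    induction i with
    | zero =>
      refine fun _ => ⟨⟨fun y hy => ?_, fun _ _ => rfl, rfl, rfl, rfl⟩, by simp [loopRun], h0⟩
      simp only [List.mem_cons, not_or] at hy
      simp [loopRun, hy.1]
    | succ i ih =>
      intro hi
      obtain ⟨hF, hx, hQ⟩ := ih (by omega)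
      refine ⟨⟨fun y hy => ?_, fun a ha => ?_, ?_, ?_, ?_⟩, by simp [loopRun],
        hs i (by omega) _ hF hx hQ⟩
      · have hy' := hy
        simp only [List.mem_cons, not_or] at hy
        simp only [loopRun, HState.setReg_reg, if_neg hy.1]
        rw [run_reg p _ hy.2, hF.reg y hy']
      · simp only [loopRun, HState.setReg_arr]
        rw [run_arr p _ ha, hF.arr a ha]
      · simp only [loopRun, HState.setReg_low]
        rw [run_low p _ hp, hF.low]
      · simp only [loopRun, HState.setReg_base]
        rw [run_base, hF.base]
      · simp only [loopRun, HState.setReg_cap]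
        rw [run_cap, hF.cap]
  exact (key _ le_rfl).2.2

theorem run_set {S : HState} {x : Var} {e : Ex} {v : ℕ} (h : e.eval S = v) (hv : v < S.cap) :
    (Cm.set x e).run S = S.setReg x v := by
  subst h
  rw [Cm.run, HState.clamp_of_lt hv]

theorem run_put {S : HState} {a : Arr} {i e : Ex} {u v : ℕ} (hu : i.eval S = u)
    (h : e.eval S = v) (hv : v < S.cap) : (Cm.put a i e).run S = S.setArr a u v := by
  subst h hu
  rw [Cm.run, HState.clamp_of_lt hv]

theorem run_seq (p q : Cm) (S : HState) : (p ;; q).run S = q.run (p.run S) := rfl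

theorem run_ite (e : Ex) (p q : Cm) (S : HState) :
    (Cm.ite e p q).run S = if 0 < e.eval S then p.run S else q.run S := rfl

/-- A loop that adds up the values of an expression. -/
theorem run_sumLoop {x b acc : Var} {e : Ex} {S : HState} (f : ℕ → ℕ) (hx : acc ≠ x)
    (he : ∀ i < S.reg b, ∀ v, e.eval ((S.setReg acc v).setReg x i) = f i)
    (hcap : S.reg acc + ∑ i ∈ range (S.reg b), f i < S.cap) :
    (Cm.loop x b (.set acc (♯acc + e))).run S =
      (S.setReg acc (S.reg acc + ∑ i ∈ range (S.reg b), f i)).setReg x (S.reg b) := by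
  have key : ∀ i ≤ S.reg b, loopRun (Cm.set acc (♯acc + e)).run x S i =
      (S.setReg acc (S.reg acc + ∑ i' ∈ range i, f i')).setReg x i := by
    intro i
    induction i with
    | zero =>
      intro _
      simp only [loopRun, range_zero, sum_empty, Nat.add_zero]
      congr 1
      simp [HState.setReg]
    | succ i ih =>
      intro hi
      rw [loopRun, ih (by omega)]
      have h1 : S.reg acc + ∑ i' ∈ range (i + 1), f i' ≤
          S.reg acc + ∑ i' ∈ range (S.reg b), f i' :=
        Nat.add_le_add_left (sum_le_sum_of_subset (range_subset_range.2 hi)) _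
      rw [run_set (v := S.reg acc + ∑ i' ∈ range (i + 1), f i')]
      · rw [HState.setReg_comm _ hx, HState.setReg_setReg, HState.setReg_comm _ hx.symm,
          HState.setReg_setReg]
      · rw [eval_add, he i (by omega), sum_range_succ, ← Nat.add_assoc]
        simp [hx]
      · simp only [HState.setReg_cap]; omega
  exact key _ le_rfl

end Imp

namespace CCOInstance

open Imp Ex Cm

/-- The variables that describe the instance have their values, the memory below `base` starts with
the input, and values below `I.size ^ 4` are not clamped. -/
structure Env (I : CCOInstance) (S : HState) : Prop where
  m : S.reg .m = I.m
  n : S.reg .n = I.n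
  s : S.reg .s = I.s
  k : S.reg .k = I.k
  B : S.reg .B = I.B
  l : S.reg .l = I.ℓ
  sk : S.reg .sk = I.s ^ I.k
  oR : S.reg .oR = 6 + I.n * I.m
  base : I.input.length ≤ S.base
  cap : S.cap = I.size ^ 4
  low : ∀ a < I.input.length, S.low a = I.input.getD a 0

variable {I : CCOInstance}

theorem length_input (I : CCOInstance) :
    I.input.length = 6 + I.n * I.m + I.m * I.s ^ I.k := by
  simp [input]; omega

theorem size_eq (I : CCOInstance) :
    I.size = 6 + I.n * I.m + I.m * I.s ^ I.k + I.s + I.k + I.B + I.ℓ := by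
  rw [size, length_input]

theorem input_ent (I : CCOInstance) {h j : ℕ} (hh : h < I.m) (hj : j < I.n) :
    I.input.getD (6 + j * I.m + h) 0 = I.ent h j := by
  have h1 : j * I.m + h < I.n * I.m :=
    calc j * I.m + h < j * I.m + I.m := by omega
      _ = (j + 1) * I.m := by ring
      _ ≤ _ := Nat.mul_le_mul_right _ hj
  have h2 : finProdFinEquiv.symm (⟨j * I.m + h, h1⟩ : Fin (I.n * I.m)) = (⟨j, hj⟩, ⟨h, hh⟩) := by
    rw [Equiv.symm_apply_eq, Fin.ext_iff, finProdFinEquiv_apply_val]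
    simp only; ring
  rw [input, List.append_assoc, show 6 + j * I.m + h = 6 + (j * I.m + h) by ring,
    List.getD_append_right _ _ _ _ (by simp)]
  rw [List.getD_append _ _ _ _ (by simp; omega)]
  rw [List.getD_eq_getElem _ _ (by simp; omega)]
  simp only [List.length_cons, List.length_nil, List.getElem_ofFn]
  simp only [show 6 + (j * I.m + h) - (0 + 1 + 1 + 1 + 1 + 1 + 1) = j * I.m + h by omega, h2]
  rw [ent, dif_pos ⟨hh, hj⟩]

theorem input_tab (I : CCOInstance) {h x : ℕ} (hh : h < I.m) (hx : x < I.s ^ I.k) :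
    I.input.getD (6 + I.n * I.m + h * I.s ^ I.k + x) 0 = I.tab h x := by
  have h1 : h * I.s ^ I.k + x < I.m * I.s ^ I.k :=
    calc h * I.s ^ I.k + x < h * I.s ^ I.k + I.s ^ I.k := by omega
      _ = (h + 1) * I.s ^ I.k := by ring
      _ ≤ _ := Nat.mul_le_mul_right _ hh
  have h2 : finProdFinEquiv.symm (⟨h * I.s ^ I.k + x, h1⟩ : Fin (I.m * I.s ^ I.k)) =
      (⟨h, hh⟩, ⟨x, hx⟩) := by
    rw [Equiv.symm_apply_eq, Fin.ext_iff, finProdFinEquiv_apply_val]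
    simp only; ring
  rw [input, List.getD_append_right _ _ _ _ (by simp; omega)]
  rw [List.getD_eq_getElem _ _ (by simp; omega)]
  simp only [List.length_cons, List.length_nil, List.getElem_ofFn, List.length_append,
    List.length_ofFn]
  simp only [show 6 + I.n * I.m + h * I.s ^ I.k + x - (0 + 1 + 1 + 1 + 1 + 1 + 1 + I.n * I.m) =
    h * I.s ^ I.k + x by omega, h2]
  rw [tab, dif_pos ⟨hh, hx⟩]

theorem size_ge (I : CCOInstance) : 10 ≤ I.size := by
  have h1 := I.m_pos
  have h2 := I.n_pos
  have h3 := I.k_pos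
  have h4 := I.s_pos
  have h5 : 0 < I.n * I.m := Nat.mul_pos h2 h1
  have h6 : 0 < I.m * I.s ^ I.k := Nat.mul_pos h1 (Nat.pow_pos h4)
  rw [size_eq]; omega

theorem le_size (I : CCOInstance) : I.m ≤ I.size ∧ I.n ≤ I.size ∧ I.s ≤ I.size ∧ I.k ≤ I.size ∧
    I.B ≤ I.size ∧ I.ℓ ≤ I.size ∧ I.n * I.m ≤ I.size ∧ I.s ^ I.k ≤ I.size ∧
    6 + I.n * I.m + I.m * I.s ^ I.k ≤ I.size := by
  have h1 : I.m ≤ I.n * I.m := Nat.le_mul_of_pos_left _ I.n_pos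
  have h2 : I.n ≤ I.n * I.m := Nat.le_mul_of_pos_right _ I.m_pos
  have h3 : I.s ^ I.k ≤ I.m * I.s ^ I.k := Nat.le_mul_of_pos_left _ I.m_pos
  rw [size_eq]; omega

namespace Env

variable {S S' : HState}

theorem frame (h : Env I S) {vs : List Var} {as : List Arr} (hF : Frame vs as S S')
    (hv : ∀ y ∈ fixedVars, y ∉ vs := by decide +kernel) : Env I S' := by
  refine ⟨?_, ?_, ?_, ?_, ?_, ?_, ?_, ?_, ?_, ?_, ?_⟩
  · rw [hF.reg _ (hv _ (by decide)), h.m]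
  · rw [hF.reg _ (hv _ (by decide)), h.n]
  · rw [hF.reg _ (hv _ (by decide)), h.s]
  · rw [hF.reg _ (hv _ (by decide)), h.k]
  · rw [hF.reg _ (hv _ (by decide)), h.B]
  · rw [hF.reg _ (hv _ (by decide)), h.l]
  · rw [hF.reg _ (hv _ (by decide)), h.sk]
  · rw [hF.reg _ (hv _ (by decide)), h.oR]
  · rw [hF.base]; exact h.base
  · rw [hF.cap]; exact h.cap
  · rw [hF.low]; exact h.low

theorem run (h : Env I S) (p : Cm) (hp : p.wl = false := by decide +kernel)
    (hv : ∀ y ∈ fixedVars, y ∉ p.wv := by decide +kernel) : Env I (p.run S) :=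
  h.frame (p.frame S hp) hv

theorem setReg (h : Env I S) (x : Var) (v : ℕ) (hx : x ∉ fixedVars := by decide +kernel) :
    Env I (S.setReg x v) :=
  h.frame (vs := [x]) (as := [])
    ⟨fun y hy => by simp only [List.mem_singleton] at hy; simp [hy], fun _ _ => rfl, rfl, rfl, rfl⟩
    (fun y hy => by simp only [List.mem_singleton]; rintro rfl; exact hx hy)

theorem setArr (h : Env I S) (a : Arr) (i v : ℕ) : Env I (S.setArr a i v) :=
  h.frame (vs := []) (as := [a])
    ⟨fun _ _ => rfl, fun b hb => by
      simp only [List.mem_singleton] at hb; funext i'; simp [hb], rfl, rfl, rfl⟩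
    (fun _ _ => List.not_mem_nil)

theorem lt_cap (h : Env I S) {v : ℕ} (h' : v < 100 * I.size ^ 2) : v < S.cap := by
  have h1 := I.size_ge
  have h2 : 10 * 10 ≤ I.size * I.size := Nat.mul_le_mul h1 h1
  rw [h.cap]
  calc v < 100 * I.size ^ 2 := h'
    _ ≤ I.size * I.size * I.size ^ 2 := Nat.mul_le_mul_right _ (by omega)
    _ = _ := by ring

theorem eval_entry (h : Env I S) {a b : Ex} {x y : ℕ} (ha : a.eval S = x) (hb : b.eval S = y)
    (hx : x < I.m) (hy : y < I.n) : (Ex.entry a b).eval S = I.ent x y := by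
  subst ha hb
  have hb := h.base
  have h1 : b.eval S * I.m + I.m ≤ I.n * I.m := by
    rw [← Nat.succ_mul]; exact Nat.mul_le_mul_right _ hy
  rw [length_input] at hb
  simp only [Ex.entry, eval_peek, eval_add, eval_mul, eval_six, eval_var, h.m]
  rw [if_pos (by omega), h.low _ (by rw [length_input]; omega), input_ent I hx hy]

theorem eval_truth (h : Env I S) {a b : Ex} {x y : ℕ} (ha : a.eval S = x) (hb : b.eval S = y)
    (hx : x < I.m) (hy : y < I.s ^ I.k) : (Ex.truth a b).eval S = I.tab x y := by
  subst ha hb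
  have hb := h.base
  have h1 : a.eval S * I.s ^ I.k + I.s ^ I.k ≤ I.m * I.s ^ I.k := by
    rw [← Nat.succ_mul]; exact Nat.mul_le_mul_right _ hx
  rw [length_input] at hb
  simp only [Ex.truth, eval_peek, eval_add, eval_mul, eval_var, h.oR, h.sk]
  rw [if_pos (by omega), h.low _ (by rw [length_input]; omega), input_tab I hx hy]

end Env

end CCOInstance

/-! ### Verification of a solution by the program -/

namespace CCOInstance

open Imp Ex Cm

variable {I : CCOInstance} {S : HState}

namespace Env

theorem small_lt_cap (h : Env I S) {v : ℕ} (hv : v ≤ 30 * I.size) : v < S.cap := by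
  refine h.lt_cap ?_
  have h1 := I.size_ge
  nlinarith

theorem dst_le (I : CCOInstance) (j : ℕ) (c : ℕ → ℕ) : I.dst j c ≤ I.m :=
  (card_filter_le _ _).trans (by simp)

theorem run_distTo (h : Env I S) {o : Ex} {j : ℕ} {c : ℕ → ℕ} (hj : S.reg .j = j) (hjn : j < I.n)
    (ho : ∀ x < I.m, ∀ v, o.eval ((S.setReg .dist v).setReg .h x) = c x) :
    (distTo o).run S = (S.setReg .dist (I.dst j c)).setReg .h I.m := by
  have hle := I.le_size
  have h0 : (Cm.set .dist 0).run S = S.setReg .dist 0 :=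
    run_set rfl (h.small_lt_cap (Nat.zero_le _))
  have hsum : ∑ x ∈ range I.m, (if I.ent x j ≠ c x then 1 else 0) = I.dst j c :=
    (card_filter _ _).symm
  rw [distTo, run_seq, h0, run_sumLoop (fun x => if I.ent x j ≠ c x then 1 else 0) (by decide)]
  · simp only [HState.setReg_reg, if_true, HState.setReg_setReg, Nat.zero_add, reduceCtorEq,
      if_false, h.m, hsum]
  · intro x hx v
    simp only [HState.setReg_setReg]
    rw [HState.setReg_reg, if_neg (by decide), h.m] at hx
    have hE : Env I ((S.setReg .dist v).setReg .h x) := (h.setReg _ _).setReg _ _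
    rw [eval_ne, hE.eval_entry (x := x) (y := j) (by simp) (by simpa using hj) hx hjn, ho x hx]
  · have := dst_le I j c
    simp only [HState.setReg_reg, if_true, HState.setReg_cap, Nat.zero_add]
    rw [if_neg (by decide), h.m, hsum]
    exact h.small_lt_cap (by omega)

theorem sum_pow_lt {s : ℕ} {t : ℕ → ℕ} (i : ℕ) (ht : ∀ i' < i, t i' < s) :
    ∑ i' ∈ range i, t i' * s ^ i' < s ^ i := by
  induction i with
  | zero => simp
  | succ i ih =>
    rw [sum_range_succ, pow_succ]
    have h1 := ih fun i' h => ht i' (by omega)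
    have h2 : (t i + 1) * s ^ i ≤ s * s ^ i := Nat.mul_le_mul_right _ (ht i (by omega))
    rw [Nat.succ_mul] at h2
    rw [Nat.mul_comm (s ^ i)]
    omega

theorem run_index (h : Env I S) {o : Ex} {t : ℕ → ℕ} (ht : ∀ i < I.k, t i < I.s)
    (ho : ∀ i < I.k, ∀ a b,
      o.eval (((S.setReg .idx a).setReg .pw b).setReg .i i) = t i) :
    (index o).run S =
      ((S.setReg .idx (I.tupleIdx t)).setReg .pw (I.s ^ I.k)).setReg .i I.k := by
  have hle := I.le_size
  have h0 : (Cm.set .idx 0).run S = S.setReg .idx 0 :=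
    run_set rfl (h.small_lt_cap (Nat.zero_le _))
  have h1 : (Cm.set .pw 1).run (S.setReg .idx 0) = (S.setReg .idx 0).setReg .pw 1 :=
    run_set rfl ((h.setReg _ _).small_lt_cap (by have := I.size_ge; omega))
  rw [index, run_seq, run_seq, h0, h1]
  have hk : ((S.setReg .idx 0).setReg .pw 1).reg .k = I.k := by simp [h.k]
  have key := loop_spec (x := .i) (b := .k) (p := .set .idx (♯.idx + o * ♯.pw) ;;
      .set .pw (♯.pw * ♯.s)) (S := (S.setReg .idx 0).setReg .pw 1)
    (fun i S' => S' = ((S.setReg .idx (∑ i' ∈ range i, t i' * I.s ^ i')).setReg .pw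
      (I.s ^ i)).setReg .i i) rfl (by simp) ?_
  · rw [hk] at key
    exact key
  · rintro i hi _ - - rfl
    rw [hk] at hi
    have hpow : I.s ^ (i + 1) ≤ I.s ^ I.k := Nat.pow_le_pow_right I.s_pos hi
    have hsum := sum_pow_lt (s := I.s) (i + 1) fun i' h => ht i' (by omega)
    set S1 := ((S.setReg .idx (∑ i' ∈ range i, t i' * I.s ^ i')).setReg .pw (I.s ^ i)).setReg .i i
    have hE1 : Env I S1 := ((h.setReg _ _).setReg _ _).setReg _ _
    have e1 : (Cm.set .idx (♯.idx + o * ♯.pw)).run S1 =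
        S1.setReg .idx (∑ i' ∈ range (i + 1), t i' * I.s ^ i') := by
      refine run_set ?_ (hE1.small_lt_cap (by omega))
      rw [eval_add, eval_mul, ho i hi, sum_range_succ]
      simp [S1]
    have e2 : (Cm.set .pw (♯.pw * ♯.s)).run
        (S1.setReg .idx (∑ i' ∈ range (i + 1), t i' * I.s ^ i')) =
        (S1.setReg .idx (∑ i' ∈ range (i + 1), t i' * I.s ^ i')).setReg .pw (I.s ^ (i + 1)) := by
      refine run_set ?_ ((hE1.setReg _ _).small_lt_cap (by omega))
      simp [S1, h.s, pow_succ]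
    rw [run_seq, e1, e2]
    simp only [S1]
    rw [HState.setReg_comm _ (x := .i) (y := .idx) (by decide),
      HState.setReg_comm _ (x := .pw) (y := .idx) (by decide), HState.setReg_setReg,
      HState.setReg_comm _ (x := .i) (y := .pw) (by decide), HState.setReg_setReg,
      HState.setReg_setReg]

/-- The centers in the array `cen`. -/
abbrev _root_.Imp.HState.cen (S : HState) (m : ℕ) : ℕ → ℕ → ℕ := fun i h => S.arr .cen (i * m + h)

theorem run_checkRel (h : Env I S) (hbad : S.reg .bad ≤ I.size) :
    ∃ X, (checkRel.run S).reg .bad = S.reg .bad + X ∧ X ≤ I.m * (I.k + 1) ∧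
      (X = 0 ↔ ∀ x < I.m, (∀ i < I.k, S.cen I.m i x < I.s) ∧
        I.tab x (I.tupleIdx fun i => S.cen I.m i x) = 1) := by
  have hle := I.le_size
  have hmk : I.m * (I.k + 1) ≤ 2 * (I.size * I.size) := by
    have h1 := Nat.mul_le_mul hle.1 (Nat.add_le_add_right hle.2.2.2.1 1)
    have h2 := I.size_ge
    nlinarith
  have key := loop_spec (x := .h) (b := .m) (S := S)
    (p := .loop .i .k (.set .bad (♯.bad + (1 - lt (get .cen (♯.i * ♯.m + ♯.h)) ♯.s))) ;;
      index (get .cen (♯.i * ♯.m + ♯.h)) ;; .set .bad (♯.bad + (1 - truth ♯.h ♯.idx)))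
    (fun y S' => ∃ X, S'.reg .bad = S.reg .bad + X ∧ X ≤ y * (I.k + 1) ∧
      (X = 0 ↔ ∀ x < y, (∀ i < I.k, S.cen I.m i x < I.s) ∧
        I.tab x (I.tupleIdx fun i => S.cen I.m i x) = 1)) rfl ⟨0, by simp⟩ ?_
  · rw [h.m] at key
    exact key
  · rintro y hy S1 hF hx ⟨X, hX1, hX2, hX3⟩
    rw [h.m] at hy
    have hE1 : Env I S1 := h.frame hF
    have hcen : S1.arr .cen = S.arr .cen := hF.arr _ (by decide +kernel)
    set f : ℕ → ℕ := fun i => if S.cen I.m i y < I.s then 0 else 1 with hf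
    have hfle : ∑ i ∈ range I.k, f i ≤ I.k := by
      refine (sum_le_card_nsmul _ _ 1 fun i _ => ?_).trans (by simp)
      simp only [hf]; split <;> omega
    have hX4 : X ≤ 2 * (I.size * I.size) :=
      hX2.trans (le_trans (Nat.mul_le_mul_right _ hy.le) hmk)
    have hsz := I.size_ge
    have hss : 10 * I.size ≤ I.size * I.size := Nat.mul_le_mul_right _ hsz
    have hcap2 : ∀ v ≤ 10 * (I.size * I.size), v < S1.cap := fun v hv =>
      hE1.lt_cap (by rw [pow_two]; omega)
    have e1 : (Cm.loop .i .k
        (.set .bad (♯.bad + (1 - lt (get .cen (♯.i * ♯.m + ♯.h)) ♯.s)))).run S1 =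
        (S1.setReg .bad (S1.reg .bad + ∑ i ∈ range I.k, f i)).setReg .i I.k := by
      rw [run_sumLoop f (by decide)]
      · rw [hE1.k]
      · intro i _ v
        simp [hE1.m, hE1.s, hx, hcen, hf]
        split <;> rfl
      · rw [hE1.k, hX1]
        exact hcap2 _ (by omega)
    rw [run_seq, run_seq, e1]
    set S2 := (S1.setReg .bad (S1.reg .bad + ∑ i ∈ range I.k, f i)).setReg .i I.k
    have hE2 : Env I S2 := (hE1.setReg _ _).setReg _ _
    set S3 := (index (get .cen (♯.i * ♯.m + ♯.h))).run S2 with hS3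
    have hE3 : Env I S3 := hE2.run _
    have hb3 : S3.reg .bad = S1.reg .bad + ∑ i ∈ range I.k, f i := by
      rw [hS3, run_reg _ _ (by decide +kernel)]; simp [S2]
    set Z := (1 - truth ♯.h ♯.idx : Ex).eval S3 with hZ
    have hZ1 : Z ≤ 1 := by simp only [hZ, eval_sub, eval_one]; omega
    have hcap3 : S3.cap = S1.cap := by rw [hE3.cap, hE1.cap]
    rw [run_set (v := S.reg .bad + (X + (∑ i ∈ range I.k, f i + Z)))
      (by rw [eval_add, eval_var, hb3, hX1, ← hZ]; omega)
      (by rw [hcap3]; exact hcap2 _ (by omega))]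
    refine ⟨X + (∑ i ∈ range I.k, f i + Z), by simp, by rw [Nat.succ_mul]; omega, ?_⟩
    have hfz : ∑ i ∈ range I.k, f i = 0 ↔ ∀ i < I.k, S.cen I.m i y < I.s := by
      rw [sum_eq_zero_iff]
      simp only [hf, mem_range, ite_eq_left_iff, one_ne_zero, imp_false, not_not]
    have hZz : (∀ i < I.k, S.cen I.m i y < I.s) →
        (Z = 0 ↔ I.tab y (I.tupleIdx fun i => S.cen I.m i y) = 1) := by
      intro hlt
      have e3 := hE2.run_index (o := get .cen (♯.i * ♯.m + ♯.h))
        (t := fun i => S.cen I.m i y) hlt (fun i _ a b => by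
          simp [S2, hE1.m, hx, hcen])
      have hR : (truth ♯.h ♯.idx).eval S3 = I.tab y (I.tupleIdx fun i => S.cen I.m i y) := by
        refine hE3.eval_truth ?_ ?_ hy (I.tupleIdx_lt hlt)
        · rw [hS3, e3]; simp [S2, hx]
        · rw [hS3, e3]; simp
      have := I.tab_le_one y (I.tupleIdx fun i => S.cen I.m i y)
      rw [hZ, eval_sub, eval_one, hR]
      omega
    have : X + (∑ i ∈ range I.k, f i + Z) = 0 ↔
        X = 0 ∧ (∑ i ∈ range I.k, f i = 0 ∧ Z = 0) := by omega
    rw [this, hX3, hfz]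
    constructor
    · rintro ⟨h1, h2, h3⟩ x hxy
      rcases Nat.lt_succ_iff_lt_or_eq.1 hxy with h4 | rfl
      · exact h1 x h4
      · exact ⟨h2, (hZz h2).1 h3⟩
    · intro h1
      have h2 := h1 y (by omega)
      exact ⟨fun x hxy => h1 x (by omega), h2.1, (hZz h2.1).2 h2.2⟩

theorem run_checkCost (h : Env I S) (hbad : S.reg .bad ≤ 10 * I.size ^ 2) :
    (checkCost.run S).reg .bad = S.reg .bad + (#{j ∈ range I.n | I.k < S.arr .lab j} +
      ((if I.ℓ < #{j ∈ range I.n | S.arr .lab j = 0} then 1 else 0) +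
      if I.B < ∑ j ∈ range I.n with S.arr .lab j ≠ 0, I.dst j (S.cen I.m (S.arr .lab j - 1))
      then 1 else 0)) := by
  have hle := I.le_size
  have hsz := I.size_ge
  have hss : 10 * I.size ≤ I.size * I.size := Nat.mul_le_mul_right _ hsz
  set lab := S.arr .lab with hlab
  have hcount : ∀ (p : ℕ → Prop) [DecidablePred p] (y : ℕ), y ≤ I.n →
      #{j ∈ range y | p j} ≤ I.n := fun p _ y hy =>
    (card_filter_le _ _).trans (by simpa using hy)
  have htotle : ∀ y ≤ I.n, ∑ j ∈ range y with lab j ≠ 0, I.dst j (S.cen I.m (lab j - 1)) ≤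
      I.n * I.m := by
    intro y hy
    refine (sum_le_card_nsmul _ _ I.m fun j _ => dst_le I _ _).trans ?_
    rw [smul_eq_mul]
    exact Nat.mul_le_mul_right _ (hcount _ y hy)
  have e1 : (Cm.set .cnt 0).run S = S.setReg .cnt 0 := run_set rfl (h.small_lt_cap (by omega))
  have e2 : (Cm.set .tot 0).run (S.setReg .cnt 0) = (S.setReg .cnt 0).setReg .tot 0 :=
    run_set rfl ((h.setReg _ _).small_lt_cap (by omega))
  rw [checkCost, run_seq, run_seq, run_seq, e1, e2]
  set S0 := (S.setReg .cnt 0).setReg .tot 0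
  have hE0 : Env I S0 := (h.setReg _ _).setReg _ _
  have key := loop_spec (x := .j) (b := .n) (S := S0)
    (p := .set .cnt (♯.cnt + eq (get .lab ♯.j) 0) ;;
      .set .bad (♯.bad + lt ♯.k (get .lab ♯.j)) ;;
      .loop .h .m (.set .tot (♯.tot + ne (get .lab ♯.j) 0 *
        ne (entry ♯.h ♯.j) (get .cen ((get .lab ♯.j - 1) * ♯.m + ♯.h)))))
    (fun y S' => S'.reg .cnt = #{j ∈ range y | lab j = 0} ∧
      S'.reg .bad = S.reg .bad + #{j ∈ range y | I.k < lab j} ∧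
      S'.reg .tot = ∑ j ∈ range y with lab j ≠ 0, I.dst j (S.cen I.m (lab j - 1)))
    rfl (by simp [S0]) ?_
  · rw [hE0.n] at key
    set S1 := (Cm.loop .j .n (.set .cnt (♯.cnt + eq (get .lab ♯.j) 0) ;;
      .set .bad (♯.bad + lt ♯.k (get .lab ♯.j)) ;;
      .loop .h .m (.set .tot (♯.tot + ne (get .lab ♯.j) 0 *
        ne (entry ♯.h ♯.j) (get .cen ((get .lab ♯.j - 1) * ♯.m + ♯.h)))))).run S0
    have hE1 : Env I S1 := hE0.run _
    have hc := hcount (fun j => I.k < lab j) I.n le_rfl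
    rw [run_set (v := S.reg .bad + (#{j ∈ range I.n | I.k < lab j} +
      ((if I.ℓ < #{j ∈ range I.n | lab j = 0} then 1 else 0) +
      if I.B < ∑ j ∈ range I.n with lab j ≠ 0, I.dst j (S.cen I.m (lab j - 1))
      then 1 else 0)))]
    · simp
    · simp only [eval_add, eval_var, eval_lt', key, hE1.l, hE1.B, Nat.add_assoc]
    · refine hE1.lt_cap ?_
      rw [pow_two] at hbad ⊢
      split_ifs <;> omega
  · rintro y hy S1 hF hx ⟨hc, hb, ht⟩
    rw [hE0.n] at hy
    have hE1 : Env I S1 := hE0.frame hF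
    have hlab1 : S1.arr .lab = lab := hF.arr _ (by decide +kernel)
    have hcen1 : S1.arr .cen = S.arr .cen := hF.arr _ (by decide +kernel)
    have hsucc : ∀ (p : ℕ → Prop) [DecidablePred p],
        #{j ∈ range y | p j} + (if p y then 1 else 0) = #{j ∈ range (y + 1) | p j} := by
      intro p _
      rw [card_filter, card_filter, sum_range_succ]
    have c1 := hcount (fun j => lab j = 0) (y + 1) hy
    have c2 := hcount (fun j => I.k < lab j) (y + 1) hy
    have e3 : (Cm.set .cnt (♯.cnt + eq (get .lab ♯.j) 0)).run S1 =
        S1.setReg .cnt #{j ∈ range (y + 1) | lab j = 0} := by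
      refine run_set ?_ (hE1.small_lt_cap (by omega))
      rw [← hsucc]
      simp [hc, hx, hlab1]
    have e4 : (Cm.set .bad (♯.bad + lt ♯.k (get .lab ♯.j))).run
        (S1.setReg .cnt #{j ∈ range (y + 1) | lab j = 0}) =
        (S1.setReg .cnt #{j ∈ range (y + 1) | lab j = 0}).setReg .bad
          (S.reg .bad + #{j ∈ range (y + 1) | I.k < lab j}) := by
      refine run_set ?_ ((hE1.setReg _ _).lt_cap (by rw [pow_two] at hbad ⊢; omega))
      rw [← hsucc fun j => I.k < lab j]
      simp [hb, hx, hlab1, hE1.k, Nat.add_assoc]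
    rw [run_seq, run_seq, e3, e4]
    set S2 := (S1.setReg .cnt #{j ∈ range (y + 1) | lab j = 0}).setReg .bad
          (S.reg .bad + #{j ∈ range (y + 1) | I.k < lab j})
    have hE2 : Env I S2 := (hE1.setReg _ _).setReg _ _
    set f : ℕ → ℕ := fun x => (if lab y ≠ 0 then 1 else 0) *
      if I.ent x y ≠ S.cen I.m (lab y - 1) x then 1 else 0 with hf
    have hfs : ∑ x ∈ range I.m, f x =
        if lab y ≠ 0 then I.dst y (S.cen I.m (lab y - 1)) else 0 := by
      simp only [hf, ← mul_sum]
      rw [← card_filter]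
      by_cases h0 : lab y ≠ 0
      · rw [if_pos h0, if_pos h0, Nat.one_mul]; rfl
      · rw [if_neg h0, if_neg h0, Nat.zero_mul]
    have htot : S2.reg .tot + ∑ x ∈ range I.m, f x =
        ∑ j ∈ range (y + 1) with lab j ≠ 0, I.dst j (S.cen I.m (lab j - 1)) := by
      rw [hfs, sum_filter, sum_range_succ, ← sum_filter, ← ht]
      simp [S2]
    rw [run_sumLoop f (by decide)]
    · rw [hE2.m, htot]
      simp [S2]
    · intro x hxm v
      rw [hE2.m] at hxm
      have hE3 : Env I ((S2.setReg .tot v).setReg .h x) := (hE2.setReg _ _).setReg _ _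
      rw [eval_mul, eval_ne, eval_ne,
        hE3.eval_entry (x := x) (y := y) (by simp) (by simp [S2, hx]) hxm hy]
      simp [S2, hx, hlab1, hcen1, hE1.m, hf]
    · rw [hE2.m, htot]
      have := htotle (y + 1) hy
      exact hE2.small_lt_cap (by omega)

theorem run_checkNonempty (h : Env I S) (hbad : S.reg .bad ≤ 20 * I.size ^ 2) :
    (checkNonempty.run S).reg .bad = S.reg .bad +
      #{i ∈ range I.k | #(I.members (S.arr .lab) i) = 0} := by
  have hle := I.le_size
  have hsz := I.size_ge
  have hss : 10 * I.size ≤ I.size * I.size := Nat.mul_le_mul_right _ hsz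
  set lab := S.arr .lab with hlab
  have key := loop_spec (x := .i) (b := .k) (S := S)
    (p := .set .cnt 0 ;;
      .loop .j .n (.set .cnt (♯.cnt + eq (get .lab ♯.j) (♯.i + 1))) ;;
      .set .bad (♯.bad + eq ♯.cnt 0))
    (fun y S' => S'.reg .bad = S.reg .bad + #{i ∈ range y | #(I.members lab i) = 0})
    rfl (by simp) ?_
  · rw [h.k] at key
    exact key
  · rintro y hy S1 hF hx hb
    rw [h.k] at hy
    have hE1 : Env I S1 := h.frame hF
    have hlab1 : S1.arr .lab = lab := hF.arr _ (by decide +kernel)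
    have e1 : (Cm.set .cnt 0).run S1 = S1.setReg .cnt 0 :=
      run_set rfl (hE1.small_lt_cap (by omega))
    have hm : #(I.members lab y) ≤ I.n := (card_filter_le _ _).trans (by simp)
    have e2 : (Cm.loop .j .n (.set .cnt (♯.cnt + eq (get .lab ♯.j) (♯.i + 1)))).run
        (S1.setReg .cnt 0) = (S1.setReg .cnt #(I.members lab y)).setReg .j I.n := by
      have hs : ∑ j ∈ range I.n, (if lab j = y + 1 then 1 else 0) = #(I.members lab y) :=
        (card_filter _ _).symm
      rw [run_sumLoop (fun j => if lab j = y + 1 then 1 else 0) (by decide)]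
      · simp [hE1.n, hs]
      · intro j _ v
        simp [hx, hlab1]
      · simp only [HState.setReg_reg, if_true, HState.setReg_cap, Nat.zero_add]
        rw [if_neg (by decide), hE1.n, hs]
        exact hE1.small_lt_cap (by omega)
    rw [run_seq, run_seq, e1, e2]
    have hc : #{i ∈ range (y + 1) | #(I.members lab i) = 0} ≤ y + 1 :=
      (card_filter_le _ _).trans (by simp)
    have hsucc : #{i ∈ range y | #(I.members lab i) = 0} +
        (if #(I.members lab y) = 0 then 1 else 0) =
        #{i ∈ range (y + 1) | #(I.members lab i) = 0} := by
      rw [card_filter, card_filter, sum_range_succ]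
    rw [run_set (v := S.reg .bad + #{i ∈ range (y + 1) | #(I.members lab i) = 0})]
    · simp
    · rw [← hsucc]
      simp only [eval_add, eval_var, eval_eq, eval_zero]
      simp [hb, Nat.add_assoc]
    · refine ((hE1.setReg _ _).setReg _ _).lt_cap ?_
      rw [pow_two] at hbad ⊢
      omega

/-- The verification accepts exactly the solutions. -/
theorem run_verify (h : Env I S) :
    (verify.run S).reg .bad = 0 ↔ I.Valid (S.arr .lab) (S.cen I.m) := by
  have hle := I.le_size
  have hsz := I.size_ge
  have hss : 10 * I.size ≤ I.size * I.size := Nat.mul_le_mul_right _ hsz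
  have hmk : I.m * (I.k + 1) ≤ 2 * (I.size * I.size) := by
    have h1 := Nat.mul_le_mul hle.1 (Nat.add_le_add_right hle.2.2.2.1 1)
    nlinarith
  have e1 : (Cm.set .bad 0).run S = S.setReg .bad 0 := run_set rfl (h.small_lt_cap (by omega))
  rw [verify, run_seq, run_seq, run_seq, e1]
  set S1 := S.setReg .bad 0
  have hE1 : Env I S1 := h.setReg _ _
  obtain ⟨X, hX1, hX2, hX3⟩ := hE1.run_checkRel (by simp [S1])
  rw [show S1.reg .bad = 0 by simp [S1], Nat.zero_add] at hX1
  have ha : ∀ a, (checkRel.run S1).arr a = S.arr a := fun a => by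
    rw [run_arr _ _ (by rw [show checkRel.wa = [] from rfl]; exact List.not_mem_nil)]
    rfl
  set S2 := checkRel.run S1
  have hE2 : Env I S2 := hE1.run _
  have hb2 := hE2.run_checkCost (by rw [hX1, pow_two]; omega)
  have ha' : ∀ a, (checkCost.run S2).arr a = S.arr a := fun a => by
    rw [run_arr _ _ (by rw [show checkCost.wa = [] from rfl]; exact List.not_mem_nil), ha]
  have hE3 : Env I (checkCost.run S2) := hE2.run _
  have hcount : #{j ∈ range I.n | I.k < S2.arr .lab j} ≤ I.n :=
    (card_filter_le _ _).trans (by simp)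
  have hb3 := hE3.run_checkNonempty (by
    rw [hb2, hX1, pow_two]; split_ifs <;> omega)
  have hcen : S2.cen I.m = S.cen I.m := by funext i x; simp only [HState.cen, ha]
  rw [hb3, hb2, hX1, ha', hcen, ha]
  simp only [HState.cen, S1, HState.setReg_arr] at hX3
  rw [Nat.add_eq_zero_iff, Nat.add_eq_zero_iff, Nat.add_eq_zero_iff, Nat.add_eq_zero_iff, hX3,
    card_eq_zero, card_eq_zero, filter_eq_empty_iff, filter_eq_empty_iff]
  simp only [mem_range, not_lt, ite_eq_right_iff, one_ne_zero, imp_false, card_eq_zero,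
    ← nonempty_iff_ne_empty]
  constructor
  · rintro ⟨⟨h1, h2, h3, h4⟩, h5⟩
    exact ⟨fun j hj => h2 hj, h3, fun i hi => h5 hi, fun i hi x hx => (h1 x hx).1 i hi,
      fun x hx => (h1 x hx).2, h4⟩
  · intro hv
    exact ⟨⟨fun x hx => ⟨fun i hi => hv.lt i hi x hx, hv.rel x hx⟩, fun j hj => hv.lab_le j hj,
      hv.card_outliers, hv.cost⟩, fun i hi => hv.nonempty i hi⟩

end Env

end CCOInstance

/-! ### Labels by nearest centers, and the encoding of numbers by ternary digits -/

namespace CCOInstance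

variable {I : CCOInstance}

/-- The columns that are not reference columns. -/
def nonRefs (I : CCOInstance) (r : ℕ → ℕ) : Finset ℕ := {j ∈ range I.n | ∀ i < I.k, r i ≠ j}

/-- If the centers and reference columns of a solution are known, then a solution is obtained by
assigning the other columns to nearest centers and removing the most expensive ones. -/
theorem Valid.nearest_labels {lab lab' : ℕ → ℕ} {c : ℕ → ℕ → ℕ} {r a : ℕ → ℕ}
    (hv : I.Valid lab c) (hr : I.IsRef lab r) (ha : ∀ j < I.n, a j < I.k)
    (hmin : ∀ j < I.n, ∀ i < I.k, I.dst j (c (a j)) ≤ I.dst j (c i))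
    (href : ∀ i < I.k, lab' (r i) = i + 1)
    (hlab : ∀ j ∈ I.nonRefs r, lab' j =
      if rank (I.nonRefs r) (fun j => I.dst j (c (a j))) j < I.ℓ then 0 else a j + 1) :
    I.Valid lab' c := by
  set R := I.nonRefs r with hR
  set w : ℕ → ℕ := fun j => I.dst j (c (a j)) with hw
  have hrn : ∀ i < I.k, r i < I.n := fun i hi => (mem_members.1 (hr i hi)).1
  have hcase : ∀ j < I.n, j ∈ R ∨ ∃ i < I.k, r i = j := by
    intro j hj
    by_cases h : ∃ i < I.k, r i = j
    · exact Or.inr h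
    · push Not at h
      exact Or.inl (mem_filter.2 ⟨mem_range.2 hj, h⟩)
  have hRn : ∀ j ∈ R, j < I.n ∧ ∀ i < I.k, r i ≠ j := fun j hj => by
    simpa [hR, nonRefs] using hj
  have hsplit : ∀ f : ℕ → ℕ, (∑ j ∈ range I.n, f j) =
      (∑ j ∈ R, f j) + ∑ j ∈ range I.n with ¬ ∀ i < I.k, r i ≠ j, f j := fun f =>
    (sum_filter_add_sum_filter_not _ _ _).symm
  refine ⟨?_, ?_, ?_, hv.lt, hv.rel, ?_⟩
  · intro j hj
    rcases hcase j hj with h | ⟨i, hi, rfl⟩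
    · rw [hlab j h]; have := ha j hj; split <;> omega
    · rw [href i hi]; omega
  · refine le_trans (card_le_card fun j hj => ?_) (card_rank_lt_le R w I.ℓ)
    simp only [mem_filter, mem_range] at hj ⊢
    rcases hcase j hj.1 with h | ⟨i, hi, rfl⟩
    · refine ⟨h, ?_⟩
      by_contra hcon
      rw [hlab j h, if_neg hcon] at hj
      omega
    · rw [href i hi] at hj; omega
  · exact fun i hi => ⟨r i, mem_members.2 ⟨hrn i hi, href i hi⟩⟩
  · refine le_trans ?_ hv.cost
    have h1 : ∑ j ∈ R with lab j = 0, w j ≤ ∑ j ∈ R with rank R w j < I.ℓ, w j :=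
      sum_le_sum_rank_lt w (filter_subset _ _) (le_trans
        (card_le_card (filter_subset_filter _ (filter_subset _ _))) hv.card_outliers)
    have h2 := sum_filter_add_sum_filter_not R (fun j => lab j = 0) w
    have h3 := sum_filter_add_sum_filter_not R (fun j => rank R w j < I.ℓ) w
    rw [sum_filter, sum_filter, hsplit, hsplit]
    refine Nat.add_le_add ?_ (le_of_eq (sum_congr rfl fun j hj => ?_))
    · have h4 : ∑ j ∈ R, (if lab' j ≠ 0 then I.dst j (c (lab' j - 1)) else 0) =
          ∑ j ∈ R with ¬ rank R w j < I.ℓ, w j := by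
        rw [sum_filter]
        refine sum_congr rfl fun j hj => ?_
        have h5 := hlab j hj
        by_cases h6 : rank R w j < I.ℓ
        · rw [if_pos h6] at h5
          rw [h5, if_neg (not_not.2 h6), if_neg (not_not.2 rfl)]
        · rw [if_neg h6] at h5
          rw [h5, if_pos h6, if_pos (Nat.succ_ne_zero _), Nat.add_sub_cancel]
      have h5 : ∑ j ∈ R with ¬ lab j = 0, w j ≤
          ∑ j ∈ R, (if lab j ≠ 0 then I.dst j (c (lab j - 1)) else 0) := by
        rw [sum_filter]
        refine sum_le_sum fun j hj => ?_
        have h6 := hRn j hj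
        have h7 := hv.lab_le j h6.1
        split
        · exact hmin j h6.1 _ (by omega)
        · exact le_rfl
      omega
    · simp only [mem_filter, mem_range, not_forall, not_not] at hj
      obtain ⟨_, i, hi, rfl⟩ := hj
      rw [href i hi, (mem_members.1 (hr i hi)).2]

end CCOInstance

/-- The total length of the codes of the first `v` numbers. -/
def codeStart (x : ℕ → ℕ) (v : ℕ) : ℕ := ∑ u ∈ range v, (Nat.size (x u) + 1)

theorem codeStart_succ (x : ℕ → ℕ) (v : ℕ) :
    codeStart x (v + 1) = codeStart x v + (Nat.size (x v) + 1) := sum_range_succ _ _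

theorem codeStart_mono (x : ℕ → ℕ) {u v : ℕ} (h : u ≤ v) : codeStart x u ≤ codeStart x v :=
  sum_le_sum_of_subset (range_subset_range.2 h)

/-- Numbers `x v`, `v < d`, can be written one after the other, in binary with the leading digit
first and with the digit `2` as terminator. -/
theorem exists_stream (x : ℕ → ℕ) (d : ℕ) :
    ∃ st : ℕ → ℕ, (∀ b, st b < 3) ∧ (∀ b, codeStart x d ≤ b → st b = 0) ∧
      ∀ v < d, st (codeStart x v + Nat.size (x v)) = 2 ∧
        ∀ t < Nat.size (x v), st (codeStart x v + t) = x v / 2 ^ (Nat.size (x v) - (t + 1)) % 2 := by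
  induction d with
  | zero => exact ⟨fun _ => 0, by simp⟩
  | succ d ih =>
    obtain ⟨st, h1, h2, h3⟩ := ih
    refine ⟨fun b => if b < codeStart x d then st b else
      if b < codeStart x d + Nat.size (x d) then
        x d / 2 ^ (Nat.size (x d) - (b - codeStart x d + 1)) % 2 else
      if b = codeStart x d + Nat.size (x d) then 2 else 0, ?_, ?_, ?_⟩
    · intro b
      have := h1 b
      dsimp only
      split_ifs <;> omega
    · intro b hb
      rw [codeStart_succ] at hb
      dsimp only
      rw [if_neg (by omega), if_neg (by omega), if_neg (by omega)]
    · intro v hv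
      rcases Nat.lt_succ_iff_lt_or_eq.1 hv with h | rfl
      · have h4 := codeStart_mono x (Nat.succ_le_of_lt h)
        rw [Nat.succ_eq_add_one, codeStart_succ] at h4
        refine ⟨?_, fun t ht => ?_⟩
        · dsimp only
          rw [if_pos (by omega), (h3 v h).1]
        · dsimp only
          rw [if_pos (by omega), (h3 v h).2 t ht]
      · refine ⟨?_, fun t ht => ?_⟩
        · dsimp only
          rw [if_neg (by omega), if_neg (by omega), if_pos rfl]
        · dsimp only
          rw [if_neg (by omega), if_pos (by omega), Nat.add_sub_cancel_left]

/-- Reading the next digit of a number. -/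
theorem two_mul_div_pow_add (x : ℕ) {s t : ℕ} (ht : t < s) :
    2 * (x / 2 ^ (s - t)) + x / 2 ^ (s - (t + 1)) % 2 = x / 2 ^ (s - (t + 1)) := by
  have h : s - t = (s - (t + 1)) + 1 := by omega
  rw [h, pow_succ, ← Nat.div_div_eq_div_mul]
  omega

namespace Imp

open Ex Cm

/-- A loop that computes the entries of an array. -/
theorem run_mapLoop {x b : Var} {a : Arr} {e : Ex} {S : HState} (f : ℕ → ℕ)
    (he : ∀ i < S.reg b, ∀ S', Frame [x] [a] S S' → S'.reg x = i → S'.arr a i = S.arr a i →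
      e.eval S' = f i) (hcap : ∀ i < S.reg b, f i < S.cap) :
    ∀ i < S.reg b, ((Cm.loop x b (.put a ♯x e)).run S).arr a i = f i := by
  have key := loop_spec (x := x) (b := b) (p := .put a ♯x e) (S := S)
    (fun y S' => ∀ i, S'.arr a i = if i < y then f i else S.arr a i) rfl (by simp) ?_
  · intro i hi
    rw [key, if_pos hi]
  · intro y hy S1 hF hx hQ i
    have h1 := he y hy S1 hF hx (by rw [hQ, if_neg (lt_irrefl _)])
    rw [run_put (i := ♯x) (u := y) (v := f y) hx h1 (by rw [hF.cap]; exact hcap y hy)]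
    simp only [HState.setReg_arr, HState.setArr_arr, true_and, hQ]
    rcases lt_trichotomy i y with h | rfl | h
    · rw [if_neg (by omega), if_pos h, if_pos (by omega)]
    · rw [if_pos rfl, if_pos (by omega)]
    · rw [if_neg (by omega), if_neg (by omega), if_neg (by omega)]

end Imp

/-! ### Decoding the rows -/

namespace CCOInstance

open Imp Ex Cm

variable {I : CCOInstance} {S S' : HState} {r cl tt ve te st : ℕ → ℕ} {sy : ℕ → ℕ → ℕ}

/-- The layout of the guess vectors: the variables hold the positions of their parts. -/
structure Layout (I : CCOInstance) (S : HState) : Prop extends Env I S where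
  L : S.reg .L = I.codeLen
  gT : S.reg .gT = I.k + I.B
  gV : S.reg .gV = I.k + I.B + I.B
  gU : S.reg .gU = I.k + I.B + I.B + I.B
  gS : S.reg .gS = I.k + I.B + I.B + I.B + I.B
  gY : S.reg .gY = I.k + I.B + I.B + I.B + I.B + I.codeLen
  T : S.reg .T = I.k + I.B + I.B + I.B + I.B + I.codeLen + I.k * I.B

/-- The guess vector consists of reference columns `r`, data `cl`, `tt`, `ve`, `te` by which rows
are decoded, a stream of digits `st`, and symbols `sy`. -/
structure Guess (I : CCOInstance) (r cl tt ve te st : ℕ → ℕ) (sy : ℕ → ℕ → ℕ) (S : HState) : Prop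
    extends Layout I S where
  hr : ∀ i < I.k, S.arr .G i = r i
  hcl : ∀ v < I.B, S.arr .G (I.k + v) = cl v
  htt : ∀ v < I.B, S.arr .G (I.k + I.B + v) = tt v
  hve : ∀ e < I.B, S.arr .G (I.k + I.B + I.B + e) = ve e
  hte : ∀ e < I.B, S.arr .G (I.k + I.B + I.B + I.B + e) = te e
  hst : ∀ b < I.codeLen, S.arr .G (I.k + I.B + I.B + I.B + I.B + b) = st b
  hsy : ∀ u < I.B, ∀ i < I.k,
    S.arr .G (I.k + I.B + I.B + I.B + I.B + I.codeLen + (u * I.k + i)) = sy u i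

theorem Layout.frame (h : Layout I S) {vs : List Var} {as : List Arr} (hF : Frame vs as S S')
    (hv : ∀ y ∈ fixedVars, y ∉ vs := by decide +kernel) : Layout I S' := by
  refine ⟨h.toEnv.frame hF hv, ?_, ?_, ?_, ?_, ?_, ?_, ?_⟩
  · rw [hF.reg _ (hv _ (by decide)), h.L]
  · rw [hF.reg _ (hv _ (by decide)), h.gT]
  · rw [hF.reg _ (hv _ (by decide)), h.gV]
  · rw [hF.reg _ (hv _ (by decide)), h.gU]
  · rw [hF.reg _ (hv _ (by decide)), h.gS]
  · rw [hF.reg _ (hv _ (by decide)), h.gY]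
  · rw [hF.reg _ (hv _ (by decide)), h.T]

namespace Guess

theorem frame (h : Guess I r cl tt ve te st sy S) {vs : List Var} {as : List Arr}
    (hF : Frame vs as S S') (hv : ∀ y ∈ fixedVars, y ∉ vs := by decide +kernel)
    (ha : Arr.G ∉ as := by decide +kernel) : Guess I r cl tt ve te st sy S' := by
  have hG := hF.arr _ ha
  refine ⟨h.toLayout.frame hF hv, ?_, ?_, ?_, ?_, ?_, ?_, ?_⟩ <;> rw [hG]
  exacts [h.hr, h.hcl, h.htt, h.hve, h.hte, h.hst, h.hsy]

theorem run (h : Guess I r cl tt ve te st sy S) (p : Cm)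
    (hp : p.wl = false := by decide +kernel)
    (hv : ∀ y ∈ fixedVars, y ∉ p.wv := by decide +kernel)
    (ha : Arr.G ∉ p.wa := by decide +kernel) : Guess I r cl tt ve te st sy (p.run S) :=
  h.frame (p.frame S hp) hv ha

theorem setReg (h : Guess I r cl tt ve te st sy S) (x : Var) (v : ℕ)
    (hx : x ∉ fixedVars := by decide +kernel) : Guess I r cl tt ve te st sy (S.setReg x v) :=
  h.frame (vs := [x]) (as := [])
    ⟨fun y hy => by simp only [List.mem_singleton] at hy; simp [hy], fun _ _ => rfl, rfl, rfl, rfl⟩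
    (fun y hy => by simp only [List.mem_singleton]; rintro rfl; exact hx hy) List.not_mem_nil

/-- The condition under which `pickFilter` selects column `j`. -/
def Sel (I : CCOInstance) (r0 : ℕ) (row ve te : ℕ → ℕ) (t v j : ℕ) : Prop :=
  I.dst j (fun h => I.ent h r0) ≤ I.B ∧
    ∀ e < I.B, te e = t → ve e < v → I.ent (row (ve e)) j ≠ I.ent (row (ve e)) r0

open scoped Classical in
theorem run_pickFilter (h : Guess I r cl tt ve te st sy S) {j r0 t v : ℕ} {row : ℕ → ℕ}
    (hj : S.reg .j = j) (hjn : j < I.n) (hr0 : S.reg .rr = r0) (hr0n : r0 < I.n)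
    (ht : S.reg .tt = t) (hv : S.reg .v = v) (hrow : ∀ u < v, S.arr .hrow u = row u)
    (hrowm : ∀ u < v, row u < I.m) :
    (pickFilter.run S).reg .ok = if Sel I r0 row ve te t v j then 1 else 0 := by
  have hsz := I.size_ge
  have e1 := h.run_distTo (o := entry ♯.h ♯.rr) (c := fun h => I.ent h r0) hj hjn
    (fun x hx a => by
      have hE : Env I ((S.setReg .dist a).setReg .h x) := (h.toEnv.setReg _ _).setReg _ _
      exact hE.eval_entry (by simp) (by simp [hr0]) hx hr0n)
  rw [pickFilter, run_seq, run_seq, e1]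
  set S1 := (S.setReg .dist (I.dst j fun h => I.ent h r0)).setReg .h I.m
  have h1 : Guess I r cl tt ve te st sy S1 := (h.setReg _ _).setReg _ _
  have e2 : (Cm.set .ok (1 - lt ♯.B ♯.dist)).run S1 =
      S1.setReg .ok (if I.dst j (fun h => I.ent h r0) ≤ I.B then 1 else 0) := by
    refine run_set ?_ (h1.toEnv.small_lt_cap (by split <;> omega))
    simp only [eval_sub, eval_one, eval_lt', eval_var, h1.B]
    simp only [S1, HState.setReg_reg, reduceCtorEq, if_false, if_true]
    split_ifs <;> omega
  rw [e2]
  set S2 := S1.setReg .ok (if I.dst j (fun h => I.ent h r0) ≤ I.B then 1 else 0)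
  have h2 : Guess I r cl tt ve te st sy S2 := h1.setReg _ _
  have key := loop_spec (x := .e) (b := .B) (S := S2)
    (p := .set .w (get .hrow (get .G (♯.gV + ♯.e))) ;;
      .set .ok (♯.ok * (1 - eq (get .G (♯.gU + ♯.e)) ♯.tt * lt (get .G (♯.gV + ♯.e)) ♯.v *
        eq (entry ♯.w ♯.j) (entry ♯.w ♯.rr))))
    (fun y S' => S'.reg .ok = if I.dst j (fun h => I.ent h r0) ≤ I.B ∧
      ∀ e < y, te e = t → ve e < v → I.ent (row (ve e)) j ≠ I.ent (row (ve e)) r0 then 1 else 0)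
    rfl (by simp [S2]) ?_
  · rw [key, h2.B]
    exact if_congr Iff.rfl rfl rfl
  · intro y hy S3 hF hx hQ
    rw [h2.B] at hy
    have h3 : Guess I r cl tt ve te st sy S3 := h2.frame hF
    set S4 := (Cm.set .w (get .hrow (get .G (♯.gV + ♯.e)))).run S3 with hS4
    have h4 : Guess I r cl tt ve te st sy S4 := h3.run _
    have hreg4 : ∀ x, x ≠ .w → S4.reg x = S3.reg x := fun x hx => by
      rw [hS4, Cm.run]; simp [hx]
    have hreg3 : ∀ x, x ∉ [Var.e, .w, .ok] → S3.reg x = S2.reg x := fun x hx => hF.reg _ hx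
    have hregS : ∀ x, x ∉ [Var.e, .w, .ok, .dist, .h] → S4.reg x = S.reg x := fun x hx => by
      simp only [List.mem_cons, List.not_mem_nil, or_false, not_or] at hx
      rw [hreg4 _ hx.2.1, hreg3 _ (by simp [hx.1, hx.2.1, hx.2.2.1])]
      simp [S2, S1, hx.2.2.1, hx.2.2.2.1, hx.2.2.2.2]
    have hw : ve y < v → S4.reg .w = row (ve y) := by
      intro hlt
      have : (get .hrow (get .G (♯.gV + ♯.e)) : Ex).eval S3 = row (ve y) := by
        simp only [eval_get, eval_add, eval_var, h3.gV, hx, h3.hve y hy]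
        rw [hF.arr .hrow (by decide +kernel)]
        exact hrow _ hlt
      rw [hS4, run_set this (h3.toEnv.small_lt_cap (by
        have := hrowm _ hlt; have := I.le_size; omega))]
      simp
    rw [run_seq, ← hS4, run_set (v := if I.dst j (fun h => I.ent h r0) ≤ I.B ∧ ∀ e < y + 1, te e = t →
      ve e < v → I.ent (row (ve e)) j ≠ I.ent (row (ve e)) r0 then 1 else 0)]
    · simp
    · have f0 : S4.reg .e = y := by rw [hreg4 _ (by decide), hx]
      have f1 : (get .G (♯.gU + ♯.e) : Ex).eval S4 = te y := by
        simp [h4.gU, f0, h4.hte y hy]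
      have f2 : (get .G (♯.gV + ♯.e) : Ex).eval S4 = ve y := by
        simp [h4.gV, f0, h4.hve y hy]
      have f3 := hreg4 .ok (by decide)
      rw [hQ] at f3
      have f4 := hregS .tt (by decide)
      have f5 := hregS .v (by decide)
      rw [ht] at f4
      rw [hv] at f5
      simp only [eval_mul, eval_sub, eval_one, eval_eq, eval_lt', f1, f2, eval_var, f3, f4, f5]
      have hsucc : (∀ e < y + 1, te e = t → ve e < v →
          I.ent (row (ve e)) j ≠ I.ent (row (ve e)) r0) ↔ (∀ e < y, te e = t → ve e < v →
          I.ent (row (ve e)) j ≠ I.ent (row (ve e)) r0) ∧ (te y = t → ve y < v →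
          I.ent (row (ve y)) j ≠ I.ent (row (ve y)) r0) := by
        constructor
        · exact fun H => ⟨fun e he => H e (by omega), H y (by omega)⟩
        · rintro ⟨H1, H2⟩ e he
          rcases Nat.lt_succ_iff_lt_or_eq.1 he with h | rfl
          exacts [H1 e h, H2]
      rw [if_congr (and_congr_right fun _ => hsucc) rfl rfl]
      by_cases c1 : te y = t
      · by_cases c2 : ve y < v
        · have hA : (entry ♯.w ♯.j).eval S4 = I.ent (row (ve y)) j :=
            h4.toEnv.eval_entry (by simp [hw c2]) (by rw [eval_var, hregS .j (by decide), hj])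
              (hrowm _ c2) hjn
          have hA' : (entry ♯.w ♯.rr).eval S4 = I.ent (row (ve y)) r0 :=
            h4.toEnv.eval_entry (by simp [hw c2]) (by rw [eval_var, hregS .rr (by decide), hr0])
              (hrowm _ c2) hr0n
          rw [hA, hA']
          by_cases c3 : I.ent (row (ve y)) j = I.ent (row (ve y)) r0
          · simp [c1, c2, c3]
          · simp [c1, c2, c3]
        · simp [c2]
      · simp [c1]
    · exact h4.toEnv.small_lt_cap (by split <;> omega)

open scoped Classical in
theorem run_pickDeg (h : Guess I r cl tt ve te st sy S) {r0 t v : ℕ} {row : ℕ → ℕ}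
    (hr0 : S.reg .rr = r0) (hr0n : r0 < I.n)
    (ht : S.reg .tt = t) (hv : S.reg .v = v) (hrow : ∀ u < v, S.arr .hrow u = row u)
    (hrowm : ∀ u < v, row u < I.m) :
    ∀ x < I.m, (pickDeg.run S).arr .deg x =
      #{j ∈ range I.n | Sel I r0 row ve te t v j ∧ I.ent x j ≠ I.ent x r0} := by
  have hsz := I.size_ge
  have hle := I.le_size
  have hc : ∀ (p : ℕ → Prop) [DecidablePred p] (y : ℕ), y ≤ I.n →
      #{j ∈ range y | p j} ≤ I.n := fun p _ y hy =>
    (card_filter_le _ _).trans (by simpa using hy)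
  rw [pickDeg, run_seq]
  have e1 := run_mapLoop (x := .h) (b := .m) (a := .deg) (e := 0) (S := S) (fun _ => 0)
    (fun _ _ _ _ _ _ => rfl) (fun _ _ => h.toEnv.small_lt_cap (by omega))
  set S1 := (Cm.loop .h .m (.put .deg ♯.h 0)).run S with hS1
  have h1 : Guess I r cl tt ve te st sy S1 := h.run _
  have hreg1 : ∀ x, x ≠ .h → S1.reg x = S.reg x := fun x hx => by
    rw [hS1, run_reg _ _ (by simpa [Cm.wv] using hx)]
  have hrow1 : S1.arr .hrow = S.arr .hrow := run_arr _ _ (by decide)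
  have key := loop_spec (x := .j) (b := .n) (S := S1)
    (p := pickFilter ;;
      .loop .h .m (.put .deg ♯.h (get .deg ♯.h + ♯.ok * ne (entry ♯.h ♯.j) (entry ♯.h ♯.rr))))
    (fun y S' => ∀ x < I.m, S'.arr .deg x =
      #{j ∈ range y | Sel I r0 row ve te t v j ∧ I.ent x j ≠ I.ent x r0}) (by decide +kernel) ?_ ?_
  · rw [h1.n] at key
    exact key
  · rw [h.m] at e1
    simpa using e1
  · intro y hy S2 hF hx hQ
    rw [h1.n] at hy
    have h2 : Guess I r cl tt ve te st sy S2 := h1.frame hF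
    have hr2 : S2.reg .rr = r0 := by rw [hF.reg _ (by decide +kernel), hreg1 _ (by decide), hr0]
    have e2 := h2.run_pickFilter (row := row) hx hy hr2 hr0n
      (by rw [hF.reg _ (by decide +kernel), hreg1 _ (by decide), ht])
      (by rw [hF.reg _ (by decide +kernel), hreg1 _ (by decide), hv])
      (by rw [hF.arr _ (by decide +kernel), hrow1]; exact hrow) hrowm
    rw [run_seq]
    set S3 := pickFilter.run S2 with hS3
    have h3 : Guess I r cl tt ve te st sy S3 := h2.run _
    have hd3 : S3.arr .deg = S2.arr .deg := run_arr _ _ (by decide +kernel)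
    have hj3 : S3.reg .j = y := by rw [hS3, run_reg _ _ (by decide +kernel), hx]
    have hr3 : S3.reg .rr = r0 := by rw [hS3, run_reg _ _ (by decide +kernel), hr2]
    have e3 := run_mapLoop (x := .h) (b := .m) (a := .deg)
      (e := get .deg ♯.h + ♯.ok * ne (entry ♯.h ♯.j) (entry ♯.h ♯.rr)) (S := S3)
      (fun x => #{j ∈ range (y + 1) | Sel I r0 row ve te t v j ∧ I.ent x j ≠ I.ent x r0})
      (fun x hxm S4 hF4 hx4 hd4 => ?_)
      (fun x _ => h3.toEnv.small_lt_cap ((hc _ _ hy).trans (by omega)))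
    · rw [h3.m] at e3
      exact e3
    · rw [h3.m] at hxm
      have h4 : Guess I r cl tt ve te st sy S4 := h3.frame hF4
      rw [eval_add, eval_mul, eval_ne, eval_get, eval_var, eval_var, hx4, hd4, hd3, hQ x hxm,
        hF4.reg _ (by decide), e2,
        h4.toEnv.eval_entry (x := x) (y := y) (by simp [hx4])
          (by rw [eval_var, hF4.reg _ (by decide), hj3]) hxm hy,
        h4.toEnv.eval_entry (x := x) (y := r0) (by simp [hx4])
          (by rw [eval_var, hF4.reg _ (by decide), hr3]) hxm hr0n]
      rw [card_filter, card_filter, sum_range_succ]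
      congr 1
      by_cases c1 : Sel I r0 row ve te t v y <;> simp [c1]

theorem run_pickRow (h : Guess I r cl tt ve te st sy S) {v x0 : ℕ} (hv : S.reg .v = v)
    (hx0 : x0 < I.m) (hrho : S.reg .rho = rank (range I.m) (S.arr .deg) x0) :
    (∀ u, (pickRow.run S).arr .hrow u = if u = v then x0 else S.arr .hrow u) ∧
      ∀ x, (pickRow.run S).arr .pk x = if x = x0 then 1 else S.arr .pk x := by
  have hsz := I.size_ge
  have hle := I.le_size
  have key := loop_spec (x := .h) (b := .m) (S := S)
    (p := .set .cnt 0 ;;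
      .loop .h2 .m (.set .cnt (♯.cnt + precedes .deg .h .h2)) ;;
      .ite (eq ♯.cnt ♯.rho) (.put .hrow ♯.v ♯.h ;; .put .pk ♯.h 1) .skip)
    (fun y S' => (∀ u, S'.arr .hrow u = if u = v ∧ x0 < y then x0 else S.arr .hrow u) ∧
      ∀ x, S'.arr .pk x = if x = x0 ∧ x0 < y then 1 else S.arr .pk x) (by decide +kernel)
    (by simp) ?_
  · rw [h.m] at key
    simp only [hx0, and_true] at key
    exact key
  · rintro y hy S1 hF hx ⟨hQ1, hQ2⟩
    rw [h.m] at hy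
    have h1 : Guess I r cl tt ve te st sy S1 := h.frame hF
    have hd1 : S1.arr .deg = S.arr .deg := hF.arr _ (by decide +kernel)
    have e1 : (Cm.set .cnt 0).run S1 = S1.setReg .cnt 0 :=
      run_set rfl (h1.toEnv.small_lt_cap (by omega))
    have hrk : rank (range I.m) (S.arr .deg) y < I.m := by
      simpa using rank_lt_card (R := range I.m) (w := S.arr .deg) (mem_range.2 hy)
    have hsum : ∑ z ∈ range I.m, (if S.arr .deg y < S.arr .deg z ∨
        (S.arr .deg y = S.arr .deg z ∧ z < y) then 1 else 0) =
        rank (range I.m) (S.arr .deg) y := (card_filter _ _).symm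
    have e2 : (Cm.loop .h2 .m (.set .cnt (♯.cnt + precedes .deg .h .h2))).run (S1.setReg .cnt 0) =
        (S1.setReg .cnt (rank (range I.m) (S.arr .deg) y)).setReg .h2 I.m := by
      rw [run_sumLoop (fun z => if S.arr .deg y < S.arr .deg z ∨
        (S.arr .deg y = S.arr .deg z ∧ z < y) then 1 else 0) (by decide)]
      · simp [h1.m, hsum]
      · intro z _ a
        simp [precedes, hx, hd1]
        split_ifs <;> omega
      · simp only [HState.setReg_reg, if_true, HState.setReg_cap, Nat.zero_add]
        rw [if_neg (by decide), h1.m, hsum]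
        exact h1.toEnv.small_lt_cap (by omega)
    rw [run_seq, run_seq, e1, e2]
    set S2 := (S1.setReg .cnt (rank (range I.m) (S.arr .deg) y)).setReg .h2 I.m
    have h2 : Guess I r cl tt ve te st sy S2 := (h1.setReg _ _).setReg _ _
    have hrho2 : S2.reg .rho = rank (range I.m) (S.arr .deg) x0 := by
      simp only [S2, HState.setReg_reg, reduceCtorEq, if_false]
      rw [hF.reg _ (by decide +kernel), hrho]
    have hv2 : S2.reg .v = v := by
      simp only [S2, HState.setReg_reg, reduceCtorEq, if_false]
      rw [hF.reg _ (by decide +kernel), hv]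
    rw [run_ite, eval_eq, eval_var, eval_var, hrho2]
    have hc2 : S2.reg .cnt = rank (range I.m) (S.arr .deg) y := by simp [S2]
    rw [hc2]
    by_cases hxy : y = x0
    · subst hxy
      rw [if_pos rfl, if_pos Nat.one_pos, run_seq,
        run_put (i := ♯.v) (u := v) (v := y) (by simp [hv2]) (by simp [S2, hx])
          (h2.toEnv.small_lt_cap (by omega)),
        run_put (i := ♯.h) (u := y) (v := 1) (by simp [S2, hx]) rfl
          ((h2.toEnv.setArr _ _ _).small_lt_cap (by omega))]
      constructor
      · intro u
        simp [S2, hQ1]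
      · intro x
        simp [S2, hQ2]
    · rw [if_neg fun hr => hxy (rank_injOn _ _ (by simpa using hy) (by simpa using hx0) hr),
        if_neg (lt_irrefl _)]
      simp only [Cm.run, HState.setReg_arr, S2, hQ1, hQ2]
      have : x0 < y + 1 ↔ x0 < y := by omega
      simp only [this, implies_true, and_self]

theorem run_pick (h : Guess I r cl tt ve te st sy S) {v : ℕ} {row : ℕ → ℕ} (hv : S.reg .v = v)
    (hvB : v < I.B) (hrk : ∀ i < I.k, r i < I.n) (hclk : cl v < I.k) (httB : tt v < I.B)
    (hrho : S.reg .rho = I.pickRank r row cl tt ve te v) (hrow : ∀ u < v, S.arr .hrow u = row u)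
    (hrowm : ∀ u ≤ v, row u < I.m) :
    (∀ u, (pick.run S).arr .hrow u = if u = v then row v else S.arr .hrow u) ∧
      ∀ x, (pick.run S).arr .pk x = if x = row v then 1 else S.arr .pk x := by
  have hsz := I.size_ge
  have hle := I.le_size
  have hrv := hrk _ hclk
  classical
  have e1 : (Cm.set .cl (get .G (♯.k + ♯.v))).run S = S.setReg .cl (cl v) := by
    refine run_set ?_ (h.toEnv.small_lt_cap (by omega))
    simp [h.k, hv, h.hcl v hvB]
  have e2 : (Cm.set .tt (get .G (♯.gT + ♯.v))).run (S.setReg .cl (cl v)) =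
      (S.setReg .cl (cl v)).setReg .tt (tt v) := by
    refine run_set ?_ ((h.setReg _ _).toEnv.small_lt_cap (by omega))
    simp [h.gT, hv, h.htt v hvB]
  have e3 : (Cm.set .rr (get .G ♯.cl)).run ((S.setReg .cl (cl v)).setReg .tt (tt v)) =
      ((S.setReg .cl (cl v)).setReg .tt (tt v)).setReg .rr (r (cl v)) := by
    refine run_set ?_ (((h.setReg _ _).setReg _ _).toEnv.small_lt_cap (by omega))
    simp [h.hr _ hclk]
  rw [pick, run_seq, run_seq, run_seq, run_seq, e1, e2, e3]
  set S1 := ((S.setReg .cl (cl v)).setReg .tt (tt v)).setReg .rr (r (cl v))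
  have h1 : Guess I r cl tt ve te st sy S1 := ((h.setReg _ _).setReg _ _).setReg _ _
  have e4 := h1.run_pickDeg (r0 := r (cl v)) (t := tt v) (v := v) (row := row) (by simp [S1]) hrv
    (by simp [S1]) (by simp [S1, hv]) hrow (fun u hu => hrowm u hu.le)
  set S2 := pickDeg.run S1 with hS2
  have h2 : Guess I r cl tt ve te st sy S2 := h1.run _
  have hrho2 : S2.reg .rho = rank (range I.m) (S2.arr .deg) (row v) := by
    rw [hS2, run_reg _ _ (by decide +kernel)]
    simp only [S1, HState.setReg_reg, reduceCtorEq, if_false]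
    rw [hrho, pickRank, rank, rank]
    have hdeg : ∀ x < I.m, S2.arr .deg x = I.pickDegree r row cl tt ve te v x := fun x hx => by
      rw [e4 x hx, pickDegree]
      refine congrArg card (Finset.ext fun j => ?_)
      rw [mem_filter, mem_filter]
      exact Iff.rfl
    congr 1
    refine filter_congr fun x hx => ?_
    rw [← hdeg x (mem_range.1 hx), ← hdeg _ (hrowm v le_rfl)]
  obtain ⟨e5, e6⟩ := h2.run_pickRow (v := v) (by
    rw [hS2, run_reg _ _ (by decide +kernel)]; simp [S1, hv]) (hrowm v le_rfl) hrho2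
  have ha : S2.arr .hrow = S.arr .hrow := by rw [hS2, run_arr _ _ (by decide +kernel)]; rfl
  have ha' : S2.arr .pk = S.arr .pk := by rw [hS2, run_arr _ _ (by decide +kernel)]; rfl
  rw [ha] at e5
  rw [ha'] at e6
  exact ⟨e5, e6⟩

end Guess

end CCOInstance

namespace CCOInstance

open Imp Ex Cm

variable {I : CCOInstance} {S S' : HState} {r cl tt ve te st : ℕ → ℕ} {sy : ℕ → ℕ → ℕ}

namespace Guess

theorem codeLen_le (I : CCOInstance) : I.codeLen ≤ 6 * I.size ^ 2 := by
  have hle := I.le_size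
  have hsz := I.size_ge
  have h1 : Nat.clog 2 I.B ≤ I.B := Nat.clog_le_of_le_pow Nat.lt_two_pow_self.le
  have h2 : Nat.clog 2 I.n ≤ I.n := Nat.clog_le_of_le_pow Nat.lt_two_pow_self.le
  have h3 : I.B * (2 + 2 * Nat.clog 2 I.B) ≤ I.size * (2 + 2 * I.size) :=
    Nat.mul_le_mul hle.2.2.2.2.1 (by omega)
  have h4 : I.k * Nat.clog 2 I.n ≤ I.size * I.size :=
    Nat.mul_le_mul hle.2.2.2.1 (by omega)
  have h5 : 10 * I.size ≤ I.size * I.size := Nat.mul_le_mul_right _ hsz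
  have h6 : I.size * (2 + 2 * I.size) = 2 * I.size + 2 * (I.size * I.size) := by ring
  rw [codeLen, pow_two]
  omega

/-- If the stream of digits encodes the ranks of the rows `row v`, `v < d`, then these rows are
decoded. -/
theorem run_picks (h : Guess I r cl tt ve te st sy S) {d : ℕ} {row : ℕ → ℕ} (hd : d ≤ I.B)
    (hrk : ∀ i < I.k, r i < I.n) (hclk : ∀ v < d, cl v < I.k) (httB : ∀ v < d, tt v < I.B)
    (hrowm : ∀ v < d, row v < I.m)
    (hlen : codeStart (I.pickRank r row cl tt ve te) d ≤ I.codeLen)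
    (hst0 : ∀ b, codeStart (I.pickRank r row cl tt ve te) d ≤ b → st b = 0)
    (hst : ∀ v < d, st (codeStart (I.pickRank r row cl tt ve te) v +
        Nat.size (I.pickRank r row cl tt ve te v)) = 2 ∧
      ∀ t < Nat.size (I.pickRank r row cl tt ve te v),
        st (codeStart (I.pickRank r row cl tt ve te) v + t) =
          I.pickRank r row cl tt ve te v / 2 ^ (Nat.size (I.pickRank r row cl tt ve te v) - (t + 1))
            % 2) :
    ∀ x < I.m, ((picks.run S).arr .pk x = 0 ∨ (picks.run S).arr .pk x = 1) ∧
      ((picks.run S).arr .pk x = 1 ↔ ∃ v < d, row v = x) := by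
  have hsz := I.size_ge
  have hle := I.le_size
  set ρ := I.pickRank r row cl tt ve te with hρ
  have hρm : ∀ v < d, ρ v < I.m := fun v hv =>
    (rank_lt_card (mem_range.2 (hrowm v hv))).trans_eq (card_range _)
  rw [picks, run_seq, run_seq, run_seq]
  have e1 := run_mapLoop (x := .h) (b := .m) (a := .pk) (e := 0) (S := S) (fun _ => 0)
    (fun _ _ _ _ _ _ => rfl) (fun _ _ => h.toEnv.small_lt_cap (by omega))
  set S1 := (Cm.loop .h .m (.put .pk ♯.h 0)).run S with hS1
  have h1 : Guess I r cl tt ve te st sy S1 := h.run _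
  rw [h.m] at e1
  have e2 : (Cm.set .v 0).run S1 = S1.setReg .v 0 :=
    run_set rfl (h1.toEnv.small_lt_cap (by omega))
  have e3 : (Cm.set .rho 0).run (S1.setReg .v 0) = (S1.setReg .v 0).setReg .rho 0 :=
    run_set rfl ((h1.setReg _ _).toEnv.small_lt_cap (by omega))
  rw [e2, e3]
  set S2 := (S1.setReg .v 0).setReg .rho 0
  have h2 : Guess I r cl tt ve te st sy S2 := (h1.setReg _ _).setReg _ _
  -- In every round the stream is read inside the code of the row with number `v`, or all codes
  -- have been read.
  have key := loop_spec (x := .b) (b := .L) (S := S2)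
    (p := .set .x (get .G (♯.gS + ♯.b)) ;;
      .ite (lt ♯.x 2) (.set .rho (2 * ♯.rho + ♯.x)) (pick ;; .set .v (♯.v + 1) ;; .set .rho 0))
    (fun b S' => ∃ v ≤ d, S'.reg .v = v ∧ (∀ u < v, S'.arr .hrow u = row u) ∧
      (∀ x < I.m, (S'.arr .pk x = 0 ∨ S'.arr .pk x = 1) ∧
        (S'.arr .pk x = 1 ↔ ∃ u < v, row u = x)) ∧
      ((v = d ∧ codeStart ρ d ≤ b ∧ S'.reg .rho = 0) ∨
        (v < d ∧ ∃ t ≤ Nat.size (ρ v), b = codeStart ρ v + t ∧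
          S'.reg .rho = ρ v / 2 ^ (Nat.size (ρ v) - t)))) (by decide +kernel) ?_ ?_
  · rw [h2.L] at key
    obtain ⟨v, hv, -, -, hpk, hcase⟩ := key
    rcases hcase with ⟨rfl, -, -⟩ | ⟨hvd, t, ht, hb, -⟩
    · exact hpk
    · have := codeStart_mono ρ (Nat.succ_le_of_lt hvd)
      rw [Nat.succ_eq_add_one, codeStart_succ] at this
      omega
  · refine ⟨0, Nat.zero_le _, by simp [S2], by simp, fun x hx => ?_, ?_⟩
    · simp [S2, e1 x hx]
    · rcases Nat.eq_zero_or_pos d with rfl | hd0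
      · exact Or.inl ⟨rfl, by simp [codeStart], by simp [S2]⟩
      · refine Or.inr ⟨hd0, 0, Nat.zero_le _, by simp [codeStart], ?_⟩
        rw [Nat.sub_zero, Nat.div_eq_of_lt (Nat.lt_size_self _)]
        simp [S2]
  · rintro b hb S3 hF hx ⟨v, hvd, hv3, hrow3, hpk3, hcase⟩
    rw [h2.L] at hb
    have h3 : Guess I r cl tt ve te st sy S3 := h2.frame hF
    have hstb : ∀ y, st b = y → y ≤ 2 → (Cm.set .x (get .G (♯.gS + ♯.b))).run S3 = S3.setReg .x y := by
      intro y hy hy2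
      refine run_set ?_ (h3.toEnv.small_lt_cap (by omega))
      simp [h3.gS, hx, h3.hst b hb, hy]
    -- Reading a digit other than `2` changes only `rho`.
    have hdigit : ∀ y, st b = y → y < 2 → 2 * S3.reg .rho + y < I.m →
        (Cm.set .x (get .G (♯.gS + ♯.b)) ;;
          .ite (lt ♯.x 2) (.set .rho (2 * ♯.rho + ♯.x))
            (pick ;; .set .v (♯.v + 1) ;; .set .rho 0)).run S3 =
        (S3.setReg .x y).setReg .rho (2 * S3.reg .rho + y) := by
      intro y hy hy2 hlt
      rw [run_seq, hstb y hy hy2.le, run_ite, if_pos (by simp [hy2])]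
      refine run_set (by simp) ((h3.setReg _ _).toEnv.small_lt_cap (by omega))
    rcases hcase with ⟨rfl, hcb, hrho⟩ | ⟨hvd', t, ht, hbt, hrho⟩
    · rw [hdigit 0 (hst0 b hcb) (by omega) (by rw [hrho]; exact I.m_pos)]
      refine ⟨v, le_rfl, by simp [hv3], by simpa using hrow3, by simpa using hpk3,
        Or.inl ⟨rfl, by omega, by simp [hrho]⟩⟩
    · obtain ⟨hst2, hstt⟩ := hst v hvd'
      rcases Nat.lt_or_ge t (Nat.size (ρ v)) with ht' | ht'
      · have hval := two_mul_div_pow_add (ρ v) ht'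
        rw [← hrho] at hval
        have hs := hstt t ht'
        rw [← hbt] at hs
        have hle' : ρ v / 2 ^ (Nat.size (ρ v) - (t + 1)) ≤ ρ v := Nat.div_le_self _ _
        rw [hdigit _ hs (Nat.mod_lt _ (by omega)) (by have := hρm v hvd'; omega), hval]
        refine ⟨v, hvd, by simp [hv3], by simpa using hrow3, by simpa using hpk3,
          Or.inr ⟨hvd', t + 1, ht', by omega, by simp⟩⟩
      · obtain rfl : t = Nat.size (ρ v) := by omega
        rw [Nat.sub_self, pow_zero, Nat.div_one] at hrho
        rw [← hbt] at hst2
        rw [run_seq, hstb 2 hst2 le_rfl, run_ite, if_neg (by simp), run_seq, run_seq]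
        set S4 := S3.setReg .x 2
        have h4 : Guess I r cl tt ve te st sy S4 := h3.setReg _ _
        obtain ⟨e5, e6⟩ := h4.run_pick (v := v) (row := row) (by simp [S4, hv3])
          (by omega) hrk (hclk v hvd') (httB v hvd') (by simp [S4, hrho, hρ]) hrow3
          (fun u hu => hrowm u (by omega))
        set S5 := pick.run S4 with hS5
        have h5 : Guess I r cl tt ve te st sy S5 := h4.run _
        have hv5 : S5.reg .v = v := by
          rw [hS5, run_reg _ _ (by decide +kernel)]; simp [S4, hv3]
        rw [run_set (x := .v) (v := v + 1) (by simp [hv5]) (h5.toEnv.small_lt_cap (by omega)),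
          run_set (x := .rho) (v := 0) rfl ((h5.setReg _ _).toEnv.small_lt_cap (by omega))]
        refine ⟨v + 1, hvd', by simp, fun u hu => ?_, fun x hxm => ?_, ?_⟩
        · simp only [HState.setReg_arr, e5]
          split
          · rename_i huv; rw [huv]
          · exact hrow3 u (by omega)
        · have hp := hpk3 x hxm
          simp only [HState.setReg_arr, e6]
          by_cases hxr : x = row v
          · rw [if_pos hxr]
            exact ⟨Or.inr rfl, fun _ => ⟨v, by omega, hxr.symm⟩, fun _ => rfl⟩
          · rw [if_neg hxr]
            refine ⟨hp.1, hp.2.trans ⟨?_, ?_⟩⟩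
            · rintro ⟨u, hu, h⟩; exact ⟨u, by omega, h⟩
            · rintro ⟨u, hu, h⟩
              rcases Nat.lt_succ_iff_lt_or_eq.1 hu with h' | rfl
              · exact ⟨u, h', h⟩
              · exact (hxr h.symm).elim
        · have hcs := codeStart_succ ρ v
          rcases Nat.lt_or_ge (v + 1) d with h6 | h6
          · refine Or.inr ⟨h6, 0, Nat.zero_le _, by omega, ?_⟩
            rw [Nat.sub_zero, Nat.div_eq_of_lt (Nat.lt_size_self _)]
            simp
          · obtain rfl : v + 1 = d := by omega
            exact Or.inl ⟨rfl, by omega, by simp⟩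

end Guess

end CCOInstance

/-! ### Computing the solution from a guess -/

namespace CCOInstance

open Imp Ex Cm

variable {I : CCOInstance} {S S' : HState} {r cl tt ve te st : ℕ → ℕ} {sy : ℕ → ℕ → ℕ}

namespace Guess

/-- A loop over the clusters that computes one row of the centers. -/
theorem run_cenLoop (h : Guess I r cl tt ve te st sy S) {o : Ex} {x : ℕ} {f : ℕ → ℕ}
    (hx : S.reg .h = x) (hxm : x < I.m) (hf : ∀ i < I.k, f i < I.s)
    (ho : ∀ i < I.k, ∀ S', Frame [.i] [.cen] S S' → S'.reg .i = i → o.eval S' = f i) :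
    ∀ i < I.k, ∀ y < I.m,
      ((Cm.loop .i .k (.put .cen (♯.i * ♯.m + ♯.h) o)).run S).cen I.m i y =
        if y = x then f i else S.cen I.m i y := by
  have hle := I.le_size
  have key := loop_spec (x := .i) (b := .k) (p := .put .cen (♯.i * ♯.m + ♯.h) o) (S := S)
    (fun i' S' => ∀ i < I.k, ∀ y < I.m, S'.cen I.m i y =
      if y = x ∧ i < i' then f i else S.cen I.m i y) rfl
    (fun i _ y _ => by simp only [not_lt_zero, and_false, if_false]; rfl) ?_
  · rw [h.k] at key
    intro i hi y hy
    rw [key i hi y hy]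
    simp only [hi, and_true]
  · intro i' hi' S1 hF hi1 hQ i hi y hy
    rw [h.k] at hi'
    replace hF : Frame [.i] [.cen] S S1 := hF
    have h1 : Guess I r cl tt ve te st sy S1 := h.frame hF
    have hx1 : S1.reg .h = x := by rw [hF.reg _ (by decide +kernel), hx]
    have hfi := hf i' hi'
    rw [run_put (u := i' * I.m + x) (v := f i') (by simp [hi1, h1.m, hx1])
      (ho i' hi' S1 hF hi1) (h1.toEnv.small_lt_cap (by omega))]
    simp only [HState.cen, HState.setReg_arr, HState.setArr_arr, true_and]
    by_cases hc : i = i' ∧ y = x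
    · obtain ⟨rfl, rfl⟩ := hc
      rw [if_pos rfl, if_pos ⟨rfl, by omega⟩]
    · have hne : ¬ i * I.m + y = i' * I.m + x := by
        intro he
        apply hc
        have e1 := congrArg (· / I.m) he
        have e2 := congrArg (· % I.m) he
        simp only [Nat.mul_add_mod_of_lt hy, Nat.mul_add_mod_of_lt hxm] at e2
        simp only [Nat.mul_comm _ I.m, Nat.mul_add_div I.m_pos, Nat.div_eq_of_lt hy,
          Nat.div_eq_of_lt hxm, Nat.add_zero] at e1
        exact ⟨e1, e2⟩
      rw [if_neg hne]
      refine (hQ i hi y hy).trans (if_congr ?_ rfl rfl)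
      constructor
      · rintro ⟨rfl, h⟩; exact ⟨rfl, by omega⟩
      · rintro ⟨rfl, h⟩
        refine ⟨rfl, ?_⟩
        rcases Nat.lt_succ_iff_lt_or_eq.1 h with h' | rfl
        exacts [h', (hc ⟨rfl, rfl⟩).elim]

open scoped Classical in
theorem run_centers (h : Guess I r cl tt ve te st sy S) {d : ℕ} {row : ℕ → ℕ} {c : ℕ → ℕ → ℕ}
    (hrk : ∀ i < I.k, r i < I.n)
    (hpk : ∀ x < I.m, (S.arr .pk x = 0 ∨ S.arr .pk x = 1) ∧
      (S.arr .pk x = 1 ↔ ∃ v < d, row v = x))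
    (hB : #{x ∈ range I.m | I.Changed r row d x} ≤ I.B)
    (hc : ∀ i < I.k, ∀ x < I.m, c i x < I.s)
    (hsy : ∀ x < I.m, I.Changed r row d x → ∀ i < I.k,
      sy #{x' ∈ range x | I.Changed r row d x'} i = c i x)
    (heq : ∀ x < I.m, ¬ I.Changed r row d x → ∀ i < I.k, c i x = I.ent x (r i)) :
    ∀ i < I.k, ∀ x < I.m, (centers.run S).cen I.m i x = c i x := by
  have hsz := I.size_ge
  have hle := I.le_size
  rw [centers, run_seq]
  have e1 : (Cm.set .u 0).run S = S.setReg .u 0 := run_set rfl (h.toEnv.small_lt_cap (by omega))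
  rw [e1]
  set S1 := S.setReg .u 0
  have h1 : Guess I r cl tt ve te st sy S1 := h.setReg _ _
  have key := loop_spec (x := .h) (b := .m) (S := S1)
    (p := index (entry ♯.h (get .G ♯.i)) ;;
      .set .x ((1 - truth ♯.h ♯.idx) + get .pk ♯.h) ;;
      .loop .i .k (.ite ♯.x
        (.put .cen (♯.i * ♯.m + ♯.h) (get .G (♯.gY + (♯.u * ♯.k + ♯.i))))
        (.put .cen (♯.i * ♯.m + ♯.h) (entry ♯.h (get .G ♯.i)))) ;;
      .ite ♯.x (.set .u (♯.u + 1)) .skip)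
    (fun y S' => S'.reg .u = #{x ∈ range y | I.Changed r row d x} ∧
      ∀ i < I.k, ∀ x < y, S'.cen I.m i x = c i x) (by decide +kernel) (by simp [S1]) ?_
  · rw [h1.m] at key
    exact key.2
  · rintro y hy S2 hF hx ⟨hu2, hcen2⟩
    rw [h1.m] at hy
    have h2 : Guess I r cl tt ve te st sy S2 := h1.frame hF
    have hpk2 : S2.arr .pk = S.arr .pk := hF.arr _ (by decide +kernel)
    have hlt : ∀ i < I.k, I.ent y (r i) < I.s := fun i _ => I.ent_lt _ _
    have e2 := h2.toEnv.run_index (o := entry ♯.h (get .G ♯.i)) (t := fun i => I.ent y (r i)) hlt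
      (fun i hi a b => by
        have hE : Guess I r cl tt ve te st sy (((S2.setReg .idx a).setReg .pw b).setReg .i i) :=
          ((h2.setReg _ _).setReg _ _).setReg _ _
        exact hE.toEnv.eval_entry (by simp [hx]) (by simp [h2.hr i hi]) hy (hrk i hi))
    rw [run_seq, e2]
    set S3 := ((S2.setReg .idx (I.tupleIdx fun i => I.ent y (r i))).setReg .pw
      (I.s ^ I.k)).setReg .i I.k
    have h3 : Guess I r cl tt ve te st sy S3 := ((h2.setReg _ _).setReg _ _).setReg _ _
    set X := (1 - truth ♯.h ♯.idx + get .pk ♯.h : Ex).eval S3 with hX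
    have hX' : X = 1 - I.tab y (I.tupleIdx fun i => I.ent y (r i)) + S.arr .pk y := by
      rw [hX, eval_add, eval_sub, eval_one, eval_get, eval_var,
        h3.toEnv.eval_truth (x := y) (y := I.tupleIdx fun i => I.ent y (r i)) (by simp [S3, hx])
          (by simp [S3]) hy (I.tupleIdx_lt hlt)]
      simp [S3, hx, hpk2]
    have htab := I.tab_le_one y (I.tupleIdx fun i => I.ent y (r i))
    have hXpos : 0 < X ↔ I.Changed r row d y := by
      rw [hX', Changed, ← (hpk y hy).2]
      have := (hpk y hy).1
      omega
    have hX2 : X ≤ 2 := by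
      have := (hpk y hy).1
      omega
    rw [run_seq, run_set hX.symm (h3.toEnv.small_lt_cap (by omega)), run_seq]
    set S4 := S3.setReg .x X
    have h4 : Guess I r cl tt ve te st sy S4 := h3.setReg _ _
    have hx4 : S4.reg .h = y := by simp [S4, S3, hx]
    have hu4 : S4.reg .u = #{x ∈ range y | I.Changed r row d x} := by simp [S4, S3, hu2]
    have hX4 : S4.reg .x = X := by simp [S4]
    have hcen4 : S4.cen I.m = S2.cen I.m := rfl
    -- Inside the loop over the clusters the same branch is taken in every round.
    have hbranch : ∀ (p q : Cm) (i : ℕ), Var.x ∉ p.wv →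
        Var.x ∉ q.wv → loopRun (Cm.ite ♯.x p q).run .i S4 i =
          if 0 < X then loopRun p.run .i S4 i else loopRun q.run .i S4 i := by
      intro p q i hpx hqx
      have hreg : (loopRun (Cm.ite ♯.x p q).run .i S4 i).reg .x = X := by
        rw [loopRun_reg (by decide) fun S' => run_reg _ _ (by simp [Cm.wv, hpx, hqx]), hX4]
      induction i with
      | zero => simp [loopRun]
      | succ i ih =>
        have hreg' : (loopRun (Cm.ite ♯.x p q).run .i S4 i).reg .x = X := by
          rw [loopRun_reg (by decide) fun S' => run_reg _ _ (by simp [Cm.wv, hpx, hqx]), hX4]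
        rw [loopRun, run_ite, eval_var, hreg', ih hreg']
        split_ifs <;> rfl
    set S5 := (Cm.loop .i .k (.ite ♯.x
        (.put .cen (♯.i * ♯.m + ♯.h) (get .G (♯.gY + (♯.u * ♯.k + ♯.i))))
        (.put .cen (♯.i * ♯.m + ♯.h) (entry ♯.h (get .G ♯.i))))).run S4 with hS5
    have h5 : Guess I r cl tt ve te st sy S5 := h4.run _
    have hu5 : S5.reg .u = #{x ∈ range y | I.Changed r row d x} := by
      rw [hS5, run_reg _ _ (by decide +kernel), hu4]
    have hX5 : S5.reg .x = X := by
      rw [hS5, run_reg _ _ (by decide +kernel), hX4]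
    have hcard : #{x ∈ range (y + 1) | I.Changed r row d x} =
        #{x ∈ range y | I.Changed r row d x} + if I.Changed r row d y then 1 else 0 := by
      rw [card_filter, card_filter, sum_range_succ]
    have hcardB : #{x ∈ range (y + 1) | I.Changed r row d x} ≤ I.B :=
      (card_le_card (filter_subset_filter _ (range_subset_range.2 hy))).trans hB
    have hcen5 : ∀ i < I.k, ∀ x < I.m, S5.cen I.m i x =
        if x = y then c i y else S4.cen I.m i x := by
      by_cases hch : I.Changed r row d y
      · have e5 : S5 = (Cm.loop .i .k
            (.put .cen (♯.i * ♯.m + ♯.h) (get .G (♯.gY + (♯.u * ♯.k + ♯.i))))).run S4 := by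
          rw [hS5, Cm.run, Cm.run, hbranch _ _ _ (by decide +kernel) (by decide +kernel),
            if_pos (hXpos.2 hch)]
        rw [e5]
        refine h4.run_cenLoop hx4 hy (fun i hi => hc i hi y hy) fun i hi S' hF' hi' => ?_
        have h' : Guess I r cl tt ve te st sy S' := h4.frame hF'
        rw [eval_get, eval_add, eval_add, eval_mul, eval_var, eval_var, eval_var, eval_var, h'.gY,
          h'.k, hi', hF'.reg _ (by decide), hu4, h'.hsy _ ?_ i hi, hsy y hy hch i hi]
        rw [hcard, if_pos hch] at hcardB
        omega
      · have e5 : S5 = (Cm.loop .i .k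
            (.put .cen (♯.i * ♯.m + ♯.h) (entry ♯.h (get .G ♯.i)))).run S4 := by
          rw [hS5, Cm.run, Cm.run, hbranch _ _ _ (by decide +kernel) (by decide +kernel),
            if_neg (fun h => hch (hXpos.1 h))]
        rw [e5]
        refine h4.run_cenLoop hx4 hy (fun i hi => hc i hi y hy) fun i hi S' hF' hi' => ?_
        have h' : Guess I r cl tt ve te st sy S' := h4.frame hF'
        rw [heq y hy hch i hi]
        exact h'.toEnv.eval_entry (by rw [eval_var, hF'.reg _ (by decide), hx4])
          (by simp [hi', h'.hr i hi]) hy (hrk i hi)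
    have hu6 : (Cm.ite ♯.x (.set .u (♯.u + 1)) .skip).run S5 =
        if I.Changed r row d y then S5.setReg .u (#{x ∈ range y | I.Changed r row d x} + 1)
        else S5 := by
      rw [run_ite, eval_var, hX5]
      by_cases hch : I.Changed r row d y
      · rw [if_pos (hXpos.2 hch), if_pos hch]
        rw [hcard, if_pos hch] at hcardB
        exact run_set (by simp [hu5]) (h5.toEnv.small_lt_cap (by omega))
      · rw [if_neg (fun h => hch (hXpos.1 h)), if_neg hch]
        rfl
    rw [hu6]
    refine ⟨?_, fun i hi x hxy => ?_⟩
    · rw [hcard]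
      split <;> simp [hu5]
    · have hm : x < I.m := by omega
      have e7 : ∀ S', S' = (if I.Changed r row d y then
          S5.setReg .u (#{x ∈ range y | I.Changed r row d x} + 1) else S5) →
          (S'.setReg .h (y + 1)).cen I.m i x = S5.cen I.m i x := by
        rintro _ rfl
        split <;> rfl
      rw [e7 _ rfl, hcen5 i hi x hm]
      split
      · rename_i hxy'; rw [hxy']
      · rw [hcen4]; exact hcen2 i hi x (by omega)

theorem run_nearest (h : Guess I r cl tt ve te st sy S) :
    ∃ a : ℕ → ℕ, (∀ j < I.n, a j < I.k) ∧
      (∀ j < I.n, ∀ i < I.k, I.dst j (S.cen I.m (a j)) ≤ I.dst j (S.cen I.m i)) ∧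
      ∀ j < I.n, (nearest.run S).arr .lab j = a j + 1 ∧
        (nearest.run S).arr .cost j = I.dst j (S.cen I.m (a j)) ∧
        (nearest.run S).arr .ref j = 0 := by
  have hsz := I.size_ge
  have hle := I.le_size
  have key := loop_spec (x := .j) (b := .n) (S := S)
    (p := .set .bc (♯.m + 1) ;;
      .loop .i .k (
        distTo (get .cen (♯.i * ♯.m + ♯.h)) ;;
        .ite (lt ♯.dist ♯.bc) (.set .bc ♯.dist ;; .put .lab ♯.j (♯.i + 1)) .skip) ;;
      .put .cost ♯.j ♯.bc ;;
      .put .ref ♯.j 0)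
    (fun y S' => ∃ a : ℕ → ℕ, (∀ j < y, a j < I.k) ∧
      (∀ j < y, ∀ i < I.k, I.dst j (S.cen I.m (a j)) ≤ I.dst j (S.cen I.m i)) ∧
      ∀ j < y, S'.arr .lab j = a j + 1 ∧ S'.arr .cost j = I.dst j (S.cen I.m (a j)) ∧
        S'.arr .ref j = 0) (by decide +kernel) ⟨fun _ => 0, by simp⟩ ?_
  · rw [h.n] at key
    exact key
  · rintro y hy S1 hF hx ⟨a, ha1, ha2, ha3⟩
    rw [h.n] at hy
    have h1 : Guess I r cl tt ve te st sy S1 := h.frame hF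
    have hcen1 : S1.arr .cen = S.arr .cen := hF.arr _ (by decide +kernel)
    rw [run_seq, run_set (v := I.m + 1) (by simp [h1.m]) (h1.toEnv.small_lt_cap (by omega)),
      run_seq]
    set S2 := S1.setReg .bc (I.m + 1)
    have h2 : Guess I r cl tt ve te st sy S2 := h1.setReg _ _
    have key2 := loop_spec (x := .i) (b := .k) (S := S2)
      (p := distTo (get .cen (♯.i * ♯.m + ♯.h)) ;;
        .ite (lt ♯.dist ♯.bc) (.set .bc ♯.dist ;; .put .lab ♯.j (♯.i + 1)) .skip)
      (fun i' S' => (∀ j, j ≠ y → S'.arr .lab j = S1.arr .lab j) ∧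
        (∀ i < i', S'.reg .bc ≤ I.dst y (S.cen I.m i)) ∧
        ((i' = 0 ∧ S'.reg .bc = I.m + 1) ∨
          ∃ b < i', S'.arr .lab y = b + 1 ∧ S'.reg .bc = I.dst y (S.cen I.m b)))
      (by decide +kernel) (by simp [S2]) ?_
    · rw [h2.k] at key2
      obtain ⟨k1, k2, k3⟩ := key2
      rcases k3 with ⟨k3, -⟩ | ⟨b, hb, k4, k5⟩
      · exact absurd k3 I.k_pos.ne'
      set S3 := (Cm.loop .i .k (distTo (get .cen (♯.i * ♯.m + ♯.h)) ;;
        .ite (lt ♯.dist ♯.bc) (.set .bc ♯.dist ;; .put .lab ♯.j (♯.i + 1)) .skip)).run S2 with hS3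
      have h3 : Guess I r cl tt ve te st sy S3 := h2.run _
      have hj3 : S3.reg .j = y := by
        rw [hS3, run_reg _ _ (by decide +kernel)]; simp [S2, hx]
      have hcost3 : S3.arr .cost = S1.arr .cost := by
        rw [hS3, run_arr _ _ (by decide +kernel)]; rfl
      have href3 : S3.arr .ref = S1.arr .ref := by
        rw [hS3, run_arr _ _ (by decide +kernel)]; rfl
      have hdl := Env.dst_le I y (S.cen I.m b)
      rw [run_seq, run_put (i := ♯.j) (u := y) (v := I.dst y (S.cen I.m b)) hj3
        (by simp [k5]) (h3.toEnv.small_lt_cap (by omega)),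
        run_put (i := ♯.j) (u := y) (v := 0) (by simp [hj3]) rfl
          ((h3.toEnv.setArr _ _ _).small_lt_cap (by omega))]
      refine ⟨Function.update a y b, fun j hj => ?_, fun j hj i hi => ?_, fun j hj => ?_⟩
      · by_cases hjy : j = y
        · subst hjy; simpa using hb
        · rw [Function.update_of_ne hjy]; exact ha1 j (by omega)
      · by_cases hjy : j = y
        · subst hjy
          rw [Function.update_self, ← k5]
          exact k2 i hi
        · rw [Function.update_of_ne hjy]; exact ha2 j (by omega) i hi
      · by_cases hjy : j = y
        · subst hjy
          simp [k4]
        · rw [Function.update_of_ne hjy]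
          have := ha3 j (by omega)
          simp [hjy, k1 j hjy, hcost3, href3, this]
    · rintro i' hi' S3 hF3 hx3 ⟨k1, k2, k3⟩
      rw [h2.k] at hi'
      have h3 : Guess I r cl tt ve te st sy S3 := h2.frame hF3
      have hj3 : S3.reg .j = y := by
        rw [hF3.reg _ (by decide +kernel)]; simp [S2, hx]
      have hcen3 : S3.arr .cen = S.arr .cen := by
        rw [hF3.arr _ (by decide +kernel), ← hcen1]; rfl
      rw [run_seq, h3.toEnv.run_distTo (c := S.cen I.m i') hj3 hy
        (fun x _ v => by simp [hx3, h3.m, hcen3])]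
      set D := I.dst y (S.cen I.m i') with hD
      have hdl : D ≤ I.m := Env.dst_le I y _
      set S4 := (S3.setReg .dist D).setReg .h I.m
      have h4 : Guess I r cl tt ve te st sy S4 := (h3.setReg _ _).setReg _ _
      have hbc4 : S4.reg .bc = S3.reg .bc := by simp [S4]
      have hdist4 : S4.reg .dist = D := by simp [S4]
      rw [run_ite, eval_lt', eval_var, eval_var, hbc4, hdist4]
      by_cases hlt : D < S3.reg .bc
      · rw [if_pos hlt, if_pos Nat.one_pos, run_seq,
          run_set (v := D) (by simp [S4]) (h4.toEnv.small_lt_cap (by omega)),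
          run_put (i := ♯.j) (u := y) (v := i' + 1) (by simp [S4, hj3]) (by simp [S4, hx3])
            ((h4.setReg _ _).toEnv.small_lt_cap (by omega))]
        refine ⟨fun j hj => ?_, fun i hi => ?_, Or.inr ⟨i', by omega, by simp, by simp [D]⟩⟩
        · simp [hj, S4, k1 j hj]
        · simp only [HState.setReg_reg, HState.setArr_reg, reduceCtorEq, if_false, if_true]
          rcases Nat.lt_succ_iff_lt_or_eq.1 hi with h' | rfl
          · have := k2 i h'
            omega
          · exact le_rfl
      · rw [if_neg hlt, if_neg (lt_irrefl _)]
        simp only [Cm.run, HState.setReg_reg, HState.setReg_arr, S4, reduceCtorEq, if_false]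
        refine ⟨k1, fun i hi => ?_, ?_⟩
        · rcases Nat.lt_succ_iff_lt_or_eq.1 hi with h' | rfl
          · exact k2 i h'
          · omega
        · rcases k3 with ⟨-, k3⟩ | ⟨b, hb, k4, k5⟩
          · omega
          · exact Or.inr ⟨b, by omega, k4, k5⟩

end Guess

end CCOInstance

namespace CCOInstance

open Imp Ex Cm

variable {I : CCOInstance} {S S' : HState} {r cl tt ve te st : ℕ → ℕ} {sy : ℕ → ℕ → ℕ}

namespace Guess

theorem run_setRefs (h : Guess I r cl tt ve te st sy S)
    (hinj : ∀ i < I.k, ∀ i' < I.k, r i = r i' → i = i') :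
    (∀ i < I.k, (setRefs.run S).arr .lab (r i) = i + 1 ∧ (setRefs.run S).arr .ref (r i) = 1) ∧
      ∀ j, (∀ i < I.k, r i ≠ j) → (setRefs.run S).arr .lab j = S.arr .lab j ∧
        (setRefs.run S).arr .ref j = S.arr .ref j := by
  have hsz := I.size_ge
  have hle := I.le_size
  have key := loop_spec (x := .i) (b := .k) (S := S)
    (p := .put .lab (get .G ♯.i) (♯.i + 1) ;; .put .ref (get .G ♯.i) 1)
    (fun y S' => (∀ i < y, S'.arr .lab (r i) = i + 1 ∧ S'.arr .ref (r i) = 1) ∧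
      ∀ j, (∀ i < y, r i ≠ j) → S'.arr .lab j = S.arr .lab j ∧ S'.arr .ref j = S.arr .ref j)
    (by decide +kernel) (by simp) ?_
  · rw [h.k] at key
    exact key
  · rintro y hy S1 hF hx ⟨k1, k2⟩
    rw [h.k] at hy
    have h1 : Guess I r cl tt ve te st sy S1 := h.frame hF
    rw [run_seq, run_put (u := r y) (v := y + 1) (by simp [hx, h1.hr y hy]) (by simp [hx])
      (h1.toEnv.small_lt_cap (by omega)),
      run_put (u := r y) (v := 1) (by simp [hx, h1.hr y hy]) rfl
        ((h1.toEnv.setArr _ _ _).small_lt_cap (by omega))]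
    refine ⟨fun i hi => ?_, fun j hj => ?_⟩
    · by_cases hiy : i = y
      · subst hiy; simp
      · have hne : r i ≠ r y := fun he => hiy (hinj i (by omega) y hy he)
        have := k1 i (by omega)
        simp [hne, this]
    · have hne : ¬ j = r y := fun he => hj y (by omega) he.symm
      have := k2 j fun i hi => hj i (by omega)
      simp [hne, this]

theorem run_outliers (h : Guess I r cl tt ve te st sy S)
    (href : ∀ j < I.n, S.arr .ref j = if j ∈ I.nonRefs r then 0 else 1) :
    ∀ j < I.n, (outliers.run S).arr .lab j =
      if j ∈ I.nonRefs r ∧ rank (I.nonRefs r) (S.arr .cost) j < I.ℓ then 0 else S.arr .lab j := by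
  have hsz := I.size_ge
  have hle := I.le_size
  set w := S.arr .cost with hw
  have key := loop_spec (x := .j) (b := .n) (S := S)
    (p := .set .cnt 0 ;;
      .loop .j2 .n (.set .cnt (♯.cnt + (1 - get .ref ♯.j2) * precedes .cost .j .j2)) ;;
      .ite ((1 - get .ref ♯.j) * lt ♯.cnt ♯.l) (.put .lab ♯.j 0) .skip)
    (fun y S' => ∀ j < I.n, S'.arr .lab j =
      if j < y ∧ j ∈ I.nonRefs r ∧ rank (I.nonRefs r) w j < I.ℓ then 0 else S.arr .lab j)
    (by decide +kernel) (by simp) ?_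
  · rw [h.n] at key
    intro j hj
    rw [outliers, key j hj]
    simp only [hj, true_and]
  · rintro y hy S1 hF hx hQ j hj
    rw [h.n] at hy
    have h1 : Guess I r cl tt ve te st sy S1 := h.frame hF
    have hc1 : S1.arr .cost = w := hF.arr _ (by decide +kernel)
    have hr1 : S1.arr .ref = S.arr .ref := hF.arr _ (by decide +kernel)
    have hrk : rank (I.nonRefs r) w y ≤ I.n :=
      (card_filter_le _ _).trans ((card_filter_le _ _).trans (by simp))
    have e1 : (Cm.set .cnt 0).run S1 = S1.setReg .cnt 0 :=
      run_set rfl (h1.toEnv.small_lt_cap (by omega))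
    have hsum : ∑ z ∈ range I.n, (if z ∈ I.nonRefs r ∧ (w y < w z ∨ (w y = w z ∧ z < y))
        then 1 else 0) = rank (I.nonRefs r) w y := by
      rw [← card_filter, rank]
      congr 1
      ext z
      simp only [nonRefs, mem_filter]
      tauto
    have e2 : (Cm.loop .j2 .n (.set .cnt (♯.cnt + (1 - get .ref ♯.j2) *
        precedes .cost .j .j2))).run (S1.setReg .cnt 0) =
        (S1.setReg .cnt (rank (I.nonRefs r) w y)).setReg .j2 I.n := by
      rw [run_sumLoop (fun z => if z ∈ I.nonRefs r ∧ (w y < w z ∨ (w y = w z ∧ z < y))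
        then 1 else 0) (by decide)]
      · simp [h1.n, hsum]
      · intro z hz v
        have hzn : z < I.n := by simpa [h1.n] using hz
        simp only [precedes, eval_mul, eval_sub, eval_one, eval_get, eval_add, eval_lt', eval_eq,
          eval_var, HState.setReg_arr, HState.setReg_reg, reduceCtorEq, if_false, if_true, hx, hc1,
          hr1, href z hzn]
        by_cases hzr : z ∈ I.nonRefs r
        · simp only [hzr, if_true, true_and]
          split_ifs <;> omega
        · simp [hzr]
      · simp only [HState.setReg_reg, if_true, HState.setReg_cap, Nat.zero_add]
        rw [if_neg (by decide), h1.n, hsum]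
        exact h1.toEnv.small_lt_cap (by omega)
    rw [run_seq, run_seq, e1, e2]
    set S2 := (S1.setReg .cnt (rank (I.nonRefs r) w y)).setReg .j2 I.n
    have h2 : Guess I r cl tt ve te st sy S2 := (h1.setReg _ _).setReg _ _
    have hx2 : S2.reg .j = y := by simp [S2, hx]
    have hl2 : S2.arr .lab = S1.arr .lab := rfl
    have hev : ((1 - get .ref ♯.j) * lt ♯.cnt ♯.l : Ex).eval S2 =
        if y ∈ I.nonRefs r ∧ rank (I.nonRefs r) w y < I.ℓ then 1 else 0 := by
      simp only [eval_mul, eval_sub, eval_one, eval_get, eval_lt', eval_var, h2.l]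
      simp only [S2, HState.setReg_arr, HState.setReg_reg, reduceCtorEq, if_false, if_true, hx, hr1,
        href y hy]
      by_cases hyr : y ∈ I.nonRefs r <;> simp [hyr]
    have hlt : j < y + 1 ↔ j < y ∨ j = y := Nat.lt_succ_iff_lt_or_eq
    rw [run_ite, hev]
    by_cases hcase : y ∈ I.nonRefs r ∧ rank (I.nonRefs r) w y < I.ℓ
    · rw [if_pos hcase, if_pos Nat.one_pos, run_put (i := ♯.j) (u := y) (v := 0) hx2 rfl
        (h2.toEnv.small_lt_cap (by omega))]
      simp only [HState.setReg_arr, HState.setArr_arr, true_and, hl2, hQ j hj, hlt]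
      by_cases hjy : j = y
      · subst hjy
        rw [if_pos rfl, if_pos ⟨Or.inr rfl, hcase⟩]
      · simp only [hjy, or_false, if_false]
    · rw [if_neg hcase, if_neg (lt_irrefl _)]
      simp only [Cm.run, HState.setReg_arr, hl2, hQ j hj, hlt]
      by_cases hjy : j = y
      · subst hjy
        rw [if_neg fun h => hcase h.2, if_neg fun h => hcase h.2]
      · simp only [hjy, or_false]

end Guess

theorem tupleIdx_congr_tab {c c' : ℕ → ℕ → ℕ} {x : ℕ} (h : ∀ i < I.k, c i x = c' i x) :
    I.tab x (I.tupleIdx fun i => c i x) = I.tab x (I.tupleIdx fun i => c' i x) := by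
  rw [tupleIdx_congr h]

/-- Validity depends only on the entries of the centers inside the matrix. -/
theorem Valid.congr {lab : ℕ → ℕ} {c c' : ℕ → ℕ → ℕ} (hv : I.Valid lab c)
    (h : ∀ i < I.k, ∀ x < I.m, c' i x = c i x) : I.Valid lab c' := by
  refine ⟨hv.lab_le, hv.card_outliers, hv.nonempty, fun i hi x hx => by
    rw [h i hi x hx]; exact hv.lt i hi x hx, fun x hx => ?_, ?_⟩
  · rw [tupleIdx_congr_tab fun i hi => h i hi x hx]
    exact hv.rel x hx
  · refine le_of_eq_of_le (sum_congr rfl fun j hj => ?_) hv.cost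
    have h1 := mem_filter.1 hj
    have h2 := hv.lab_le j (mem_range.1 h1.1)
    exact congrArg card (filter_congr fun x hx => by
      rw [h _ (by omega) x (mem_range.1 hx)])

theorem dst_congr {j : ℕ} {c c' : ℕ → ℕ} (h : ∀ x < I.m, c x = c' x) : I.dst j c = I.dst j c' :=
  congrArg card (filter_congr fun x hx => by rw [h x (mem_range.1 hx)])

/-- The number of digits of a guess vector. -/
def guessLen (I : CCOInstance) : ℕ := I.k + I.B + I.B + I.B + I.B + I.codeLen + I.k * I.B

/-- The bound of digit `p` of a guess vector. -/
def radix (I : CCOInstance) (p : ℕ) : ℕ :=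
  if p < I.k then I.n else if p < I.k + I.B then I.k
  else if p < I.k + I.B + I.B + I.B + I.B then I.B
  else if p < I.k + I.B + I.B + I.B + I.B + I.codeLen then 3 else I.s

/-- The guess vector with the given parts. -/
def guessVec (I : CCOInstance) (r cl tt ve te st : ℕ → ℕ) (sy : ℕ → ℕ → ℕ) (p : ℕ) : ℕ :=
  if p < I.k then r p
  else if p < I.k + I.B then cl (p - I.k)
  else if p < I.k + I.B + I.B then tt (p - (I.k + I.B))
  else if p < I.k + I.B + I.B + I.B then ve (p - (I.k + I.B + I.B))
  else if p < I.k + I.B + I.B + I.B + I.B then te (p - (I.k + I.B + I.B + I.B))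
  else if p < I.k + I.B + I.B + I.B + I.B + I.codeLen then
    st (p - (I.k + I.B + I.B + I.B + I.B))
  else sy ((p - (I.k + I.B + I.B + I.B + I.B + I.codeLen)) / I.k)
    ((p - (I.k + I.B + I.B + I.B + I.B + I.codeLen)) % I.k)

theorem Layout.guess (h : Layout I S)
    (hG : ∀ p < I.guessLen, S.arr .G p = I.guessVec r cl tt ve te st sy p) :
    Guess I r cl tt ve te st sy S := by
  unfold guessLen at hG
  refine ⟨h, ?_, ?_, ?_, ?_, ?_, ?_, ?_⟩
  · intro i hi
    rw [hG _ (by omega), guessVec, if_pos hi]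
  · intro v hv
    rw [hG _ (by omega), guessVec, if_neg (by omega), if_pos (by omega), Nat.add_sub_cancel_left]
  · intro v hv
    rw [hG _ (by omega), guessVec, if_neg (by omega), if_neg (by omega), if_pos (by omega),
      Nat.add_sub_cancel_left]
  · intro v hv
    rw [hG _ (by omega), guessVec, if_neg (by omega), if_neg (by omega), if_neg (by omega),
      if_pos (by omega), Nat.add_sub_cancel_left]
  · intro v hv
    rw [hG _ (by omega), guessVec, if_neg (by omega), if_neg (by omega), if_neg (by omega),
      if_neg (by omega), if_pos (by omega), Nat.add_sub_cancel_left]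
  · intro v hv
    rw [hG _ (by omega), guessVec, if_neg (by omega), if_neg (by omega), if_neg (by omega),
      if_neg (by omega), if_neg (by omega), if_pos (by omega), Nat.add_sub_cancel_left]
  · intro u hu i hi
    have h1 : u * I.k + i < I.k * I.B := by
      have := Nat.mul_le_mul_right I.k (Nat.succ_le_of_lt hu)
      rw [Nat.succ_mul, Nat.mul_comm I.B] at this
      omega
    rw [hG _ (by omega), guessVec, if_neg (by omega), if_neg (by omega), if_neg (by omega),
      if_neg (by omega), if_neg (by omega), if_neg (by omega), Nat.add_sub_cancel_left,
      Nat.mul_add_mod_of_lt hi, Nat.mul_comm u, Nat.mul_add_div I.k_pos, Nat.div_eq_of_lt hi,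
      Nat.add_zero]

theorem guessVec_lt (I : CCOInstance) (hr : ∀ i < I.k, r i < I.n) (hcl : ∀ v < I.B, cl v < I.k)
    (htt : ∀ v < I.B, tt v < I.B) (hve : ∀ v < I.B, ve v < I.B) (hte : ∀ v < I.B, te v < I.B)
    (hst : ∀ b, st b < 3) (hsy : ∀ u i, sy u i < I.s) (p : ℕ) :
    I.guessVec r cl tt ve te st sy p < I.radix p := by
  unfold guessVec radix
  by_cases h1 : p < I.k
  · rw [if_pos h1, if_pos h1]; exact hr p h1
  rw [if_neg h1, if_neg h1]
  by_cases h2 : p < I.k + I.B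
  · rw [if_pos h2, if_pos h2]; exact hcl _ (by omega)
  rw [if_neg h2, if_neg h2]
  by_cases h3 : p < I.k + I.B + I.B
  · rw [if_pos h3, if_pos (by omega)]; exact htt _ (by omega)
  rw [if_neg h3]
  by_cases h4 : p < I.k + I.B + I.B + I.B
  · rw [if_pos h4, if_pos (by omega)]; exact hve _ (by omega)
  rw [if_neg h4]
  by_cases h5 : p < I.k + I.B + I.B + I.B + I.B
  · rw [if_pos h5, if_pos h5]; exact hte _ (by omega)
  rw [if_neg h5, if_neg h5]
  split
  · exact hst _
  · exact hsy _ _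

/-- For a yes-instance some guess vector leads to a solution. -/
theorem IsYes.exists_guessVec (hI : I.IsYes) :
    ∃ g : ℕ → ℕ, (∀ p < I.guessLen, g p < I.radix p) ∧
      ∀ S, Layout I S → (∀ p < I.guessLen, S.arr .G p = g p) → (attempt.run S).reg .bad = 0 := by
  classical
  obtain ⟨lab, c0, hv0⟩ := hI.exists_valid
  obtain ⟨c, r, d, row, cl0, tt0, ve, te, hg⟩ := hv0.exists_goodGuess
  have hrn : ∀ i < I.k, r i < I.n := fun i hi => (mem_members.1 (hg.ref i hi)).1
  have hrinj : ∀ i < I.k, ∀ i' < I.k, r i = r i' → i = i' := by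
    intro i hi i' hi' he
    have h1 := (mem_members.1 (hg.ref i hi)).2
    have h2 := (mem_members.1 (hg.ref i' hi')).2
    rw [he] at h1
    omega
  set cl : ℕ → ℕ := fun v => if v < d then cl0 v else 0 with hcl
  set tt : ℕ → ℕ := fun v => if v < d then tt0 v else 0 with htt
  have hrank : ∀ v < d, I.pickRank r row cl tt ve te v = I.pickRank r row cl0 tt0 ve te v := by
    intro v hvd
    have h1 : cl v = cl0 v := if_pos hvd
    have h2 : tt v = tt0 v := if_pos hvd
    have h3 : I.pickDegree r row cl tt ve te v = I.pickDegree r row cl0 tt0 ve te v :=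
      funext fun h => by simp only [pickDegree, h1, h2]
    rw [pickRank, pickRank, h3]
  obtain ⟨st, hst3, hst0, hst⟩ := exists_stream (I.pickRank r row cl tt ve te) d
  set sy : ℕ → ℕ → ℕ := fun u i => c i (Nat.nth (fun x => I.Changed r row d x) u) % I.s with hsy
  refine ⟨I.guessVec r cl tt ve te st sy, fun p _ => I.guessVec_lt hrn ?_ ?_ hg.ve_lt hg.te_lt hst3
    (fun u i => Nat.mod_lt _ I.s_pos) p, fun S hL hG => ?_⟩
  · intro v _
    simp only [hcl]; split
    · rename_i h; exact hg.cl_lt v h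
    · exact I.k_pos
  · intro v _
    simp only [htt]; split
    · rename_i h; exact hg.tt_lt v h
    · omega
  have h := hL.guess hG
  have hlen : codeStart (I.pickRank r row cl tt ve te) d ≤ I.codeLen := by
    refine le_of_eq_of_le (sum_congr rfl fun v hv => ?_) hg.size_le
    rw [hrank v (mem_range.1 hv)]
  have e1 := h.run_picks hg.d_le hrn (fun v hv => by simp only [hcl, if_pos hv]; exact hg.cl_lt v hv)
    (fun v hv => by simp only [htt, if_pos hv]; exact hg.tt_lt v hv) hg.row_lt hlen hst0 hst
  rw [attempt, run_seq, run_seq, run_seq, run_seq, run_seq]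
  have h1 : Guess I r cl tt ve te st sy (picks.run S) := h.run _
  have e2 := h1.run_centers (c := c) hrn e1 hg.card_changed (fun i hi x hx => hg.valid.lt i hi x hx)
    (fun x hx hch i hi => by
      have hcount : #{x' ∈ range x | I.Changed r row d x'} =
          Nat.count (fun x => I.Changed r row d x) x := by
        rw [Nat.count_eq_card_filter_range]
      simp only [hsy]
      rw [hcount, Nat.nth_count hch, Nat.mod_eq_of_lt (hg.valid.lt i hi x hx)])
    (fun x hx hch i hi => hg.eq_of_not_changed x hx hch i hi)
  set S2 := centers.run (picks.run S)
  have h2 : Guess I r cl tt ve te st sy S2 := h1.run _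
  obtain ⟨a, ha1, ha2, ha3⟩ := h2.run_nearest
  have hcen3 : (nearest.run S2).arr .cen = S2.arr .cen := run_arr _ _ (by decide +kernel)
  set S3 := nearest.run S2
  have h3 : Guess I r cl tt ve te st sy S3 := h2.run _
  obtain ⟨b1, b2⟩ := h3.run_setRefs hrinj
  have hcen4 : (setRefs.run S3).arr .cen = S3.arr .cen := run_arr _ _ (by decide +kernel)
  have hcost4 : (setRefs.run S3).arr .cost = S3.arr .cost := run_arr _ _ (by decide +kernel)
  set S4 := setRefs.run S3
  have h4 : Guess I r cl tt ve te st sy S4 := h3.run _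
  have hmem : ∀ j < I.n, j ∈ I.nonRefs r ↔ ∀ i < I.k, r i ≠ j := fun j hj => by
    simp [nonRefs, hj]
  have e3 := h4.run_outliers fun j hj => by
    by_cases hjr : j ∈ I.nonRefs r
    · rw [if_pos hjr, (b2 j ((hmem j hj).1 hjr)).2, (ha3 j hj).2.2]
    · rw [if_neg hjr]
      rw [hmem j hj] at hjr
      push Not at hjr
      obtain ⟨i, hi, rfl⟩ := hjr
      exact (b1 i hi).2
  have hcen5 : (outliers.run S4).arr .cen = S4.arr .cen := run_arr _ _ (by decide +kernel)
  set S5 := outliers.run S4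
  have h5 : Guess I r cl tt ve te st sy S5 := h4.run _
  rw [h5.toEnv.run_verify]
  have hcen : S5.cen I.m = S2.cen I.m := by
    funext i x
    simp only [HState.cen, hcen5, hcen4, hcen3]
  rw [hcen]
  refine Valid.congr ?_ e2
  have hdst : ∀ j, ∀ i < I.k, I.dst j (S2.cen I.m i) = I.dst j (c i) := fun j i hi =>
    dst_congr fun x hx => e2 i hi x hx
  refine hg.valid.nearest_labels hg.ref ha1 (fun j hj i hi => ?_) (fun i hi => ?_) fun j hj => ?_
  · rw [← hdst j _ (ha1 j hj), ← hdst j i hi]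
    exact ha2 j hj i hi
  · rw [e3 _ (hrn i hi), if_neg, (b1 i hi).1]
    rintro ⟨h6, -⟩
    exact (hmem _ (hrn i hi)).1 h6 i hi rfl
  · have hjn : j < I.n := mem_range.1 (mem_filter.1 hj).1
    have hw : rank (I.nonRefs r) (S4.arr .cost) j =
        rank (I.nonRefs r) (fun j => I.dst j (c (a j))) j := by
      have hval : ∀ j ∈ I.nonRefs r, S4.arr .cost j = I.dst j (c (a j)) := fun j hj => by
        have hjn : j < I.n := mem_range.1 (mem_filter.1 hj).1
        rw [hcost4, (ha3 j hjn).2.1, hdst j _ (ha1 j hjn)]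
      exact congrArg card (filter_congr fun x hx => by rw [hval x hx, hval j hj])
    rw [e3 j hjn, hw, (b2 j ((hmem j hjn).1 hj)).1, (ha3 j hjn).1]
    simp only [hj, true_and]

/-- An attempt that finds no violation has computed a solution. -/
theorem valid_of_attempt (h : Env I S) (hb : (attempt.run S).reg .bad = 0) :
    I.Valid ((attempt.run S).arr .lab) ((attempt.run S).cen I.m) := by
  rw [attempt, run_seq, run_seq, run_seq, run_seq, run_seq] at hb ⊢
  set S5 := outliers.run (setRefs.run (nearest.run (centers.run (picks.run S))))
  have h5 : Env I S5 := ((((h.run _).run _).run _).run _).run _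
  have h6 := h5.run_verify.1 hb
  have ha : ∀ a, (verify.run S5).arr a = S5.arr a := fun a =>
    run_arr _ _ (by rw [show verify.wa = [] from rfl]; exact List.not_mem_nil)
  have hcen : (verify.run S5).cen I.m = S5.cen I.m := by
    funext i x
    simp only [HState.cen, ha]
  rwa [hcen, ha]

end CCOInstance

/-! ### The search -/

/-- The value of the digits `g` in the mixed radix system with radices `b`, lowest digit first. -/
def mixedVal (b g : ℕ → ℕ) (y : ℕ) : ℕ := ∑ p ∈ range y, g p * ∏ q ∈ range p, b q

theorem mixedVal_lt {b g : ℕ → ℕ} (y : ℕ) (h : ∀ p < y, g p < b p) :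
    mixedVal b g y < ∏ q ∈ range y, b q := by
  induction y with
  | zero => simp [mixedVal]
  | succ y ih =>
    have h1 := ih fun p hp => h p (by omega)
    have h2 := Nat.mul_le_mul_right (∏ q ∈ range y, b q) (h y (by omega))
    rw [Nat.succ_mul] at h2
    rw [mixedVal, sum_range_succ, prod_range_succ, Nat.mul_comm (∏ q ∈ range y, b q)]
    rw [mixedVal] at h1
    omega

theorem mixedVal_inj {b g g' : ℕ → ℕ} (y : ℕ) (h : ∀ p < y, g p < b p) (h' : ∀ p < y, g' p < b p)
    (he : mixedVal b g y = mixedVal b g' y) : ∀ p < y, g p = g' p := by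
  induction y with
  | zero => simp
  | succ y ih =>
    have h1 := mixedVal_lt y fun p hp => h p (by omega)
    have h2 := mixedVal_lt y fun p hp => h' p (by omega)
    have hs : ∀ g, mixedVal b g (y + 1) = mixedVal b g y + g y * ∏ q ∈ range y, b q := fun g =>
      sum_range_succ _ _
    rw [hs, hs] at he
    have hpos : 0 < ∏ q ∈ range y, b q := by omega
    have hdiv := congrArg (· / ∏ q ∈ range y, b q) he
    simp only [Nat.add_mul_div_right _ _ hpos, Nat.div_eq_of_lt h1, Nat.div_eq_of_lt h2,
      Nat.zero_add] at hdiv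
    rw [hdiv] at he
    intro p hp
    rcases Nat.lt_succ_iff_lt_or_eq.1 hp with h3 | rfl
    · exact ih (fun p hp => h p (by omega)) (fun p hp => h' p (by omega)) (by omega) p h3
    · exact hdiv

namespace CCOInstance

open Imp Ex Cm

variable {I : CCOInstance} {S S' : HState}

/-- The number of guess vectors. -/
def guessCount (I : CCOInstance) : ℕ := ∏ p ∈ range I.guessLen, I.radix p

/-- In state `S` the search is about to try guess vector number `v`. -/
structure Search (I : CCOInstance) (v : ℕ) (S : HState) : Prop extends Layout I S where
  rad : ∀ p < I.guessLen, S.arr .rad p = I.radix p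
  lt : ∀ p < I.guessLen, S.arr .G p < I.radix p
  val : mixedVal I.radix (S.arr .G) I.guessLen = v
  ans : S.reg .ans = 0
  zero : S.reg .zero = 0
  go : S.reg .go = 1

theorem radix_le (I : CCOInstance) (p : ℕ) : I.radix p ≤ I.size := by
  have := I.le_size
  have := I.size_ge
  unfold radix
  split_ifs <;> omega

/-- The odometer goes to the next guess vector, unless the present one is the last. -/
theorem run_advance (h : Layout I S) (hrad : ∀ p < I.guessLen, S.arr .rad p = I.radix p)
    (hlt : ∀ p < I.guessLen, S.arr .G p < I.radix p) :
    (∀ p < I.guessLen, (advance.run S).arr .G p < I.radix p) ∧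
      (((advance.run S).reg .carry = 0 ∧ mixedVal I.radix ((advance.run S).arr .G) I.guessLen =
        mixedVal I.radix (S.arr .G) I.guessLen + 1) ∨
      ((advance.run S).reg .carry = 1 ∧
        mixedVal I.radix (S.arr .G) I.guessLen + 1 = I.guessCount)) := by
  have hsz := I.size_ge
  have e1 : (Cm.set .carry 1).run S = S.setReg .carry 1 :=
    run_set rfl (h.toEnv.small_lt_cap (by omega))
  rw [advance, run_seq, e1]
  set S1 := S.setReg .carry 1
  have h1 : Layout I S1 := h.frame (vs := [.carry]) (as := [])
    ⟨fun y hy => by simp only [List.mem_singleton] at hy; simp [S1, hy], fun _ _ => rfl, rfl, rfl,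
      rfl⟩
  set g := S.arr .G with hg
  have hs : ∀ (g : ℕ → ℕ) y, mixedVal I.radix g (y + 1) =
      mixedVal I.radix g y + g y * ∏ q ∈ range y, I.radix q := fun g y => sum_range_succ _ _
  have key := loop_spec (x := .p) (b := .T) (S := S1)
    (p := .ite ♯.carry
      (.ite (lt (get .G ♯.p + 1) (get .rad ♯.p))
        (.put .G ♯.p (get .G ♯.p + 1) ;; .set .carry 0)
        (.put .G ♯.p 0))
      .skip)
    (fun y S' => S'.reg .carry ≤ 1 ∧ (∀ p < y, S'.arr .G p < I.radix p) ∧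
      (∀ p, y ≤ p → S'.arr .G p = g p) ∧
      mixedVal I.radix (S'.arr .G) y + S'.reg .carry * ∏ q ∈ range y, I.radix q =
        mixedVal I.radix g y + 1) (by decide +kernel)
    ⟨by simp [S1], by simp, fun p _ => rfl, by simp [S1, mixedVal]⟩ ?_
  · rw [h1.T] at key
    obtain ⟨k1, k2, -, k3⟩ := key
    refine ⟨k2, ?_⟩
    rcases Nat.le_one_iff_eq_zero_or_eq_one.1 k1 with h0 | h0
    · refine Or.inl ⟨h0, ?_⟩
      rw [h0, Nat.zero_mul, Nat.add_zero] at k3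
      exact k3
    · refine Or.inr ⟨h0, ?_⟩
      have hlast := mixedVal_lt I.guessLen hlt
      rw [h0, Nat.one_mul] at k3
      rw [guessCount]
      unfold guessLen at hlast ⊢
      omega
  · rintro y hy S2 hF hx ⟨k1, k2, k3, k4⟩
    rw [h1.T] at hy
    have h2 : Layout I S2 := h1.frame hF
    have hr2 : S2.arr .rad y = I.radix y := by
      rw [hF.arr _ (by decide +kernel)]; exact hrad y hy
    have hgy := hlt y hy
    have hmv : ∀ g g' : ℕ → ℕ, (∀ p < y, g p = g' p) → mixedVal I.radix g y = mixedVal I.radix g' y :=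
      fun g g' h => sum_congr rfl fun p hp => by rw [h p (mem_range.1 hp)]
    have hcap : ∀ v ≤ I.size, v < S2.cap := fun v hv => h2.toEnv.small_lt_cap (by omega)
    rw [run_ite, eval_var]
    rcases Nat.le_one_iff_eq_zero_or_eq_one.1 k1 with h0 | h0
    · rw [h0, if_neg (lt_irrefl _)]
      rw [h0, Nat.zero_mul, Nat.add_zero] at k4
      simp only [Cm.run, HState.setReg_reg, HState.setReg_arr, reduceCtorEq, if_false, h0,
        Nat.zero_mul, Nat.add_zero]
      refine ⟨Nat.zero_le _, fun p hp => ?_, fun p hp => k3 p (by omega), ?_⟩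
      · rcases Nat.lt_succ_iff_lt_or_eq.1 hp with h' | rfl
        · exact k2 p h'
        · rw [k3 p le_rfl]; exact hgy
      · rw [hs, hs, k3 y le_rfl, k4]
        omega
    · rw [h0, Nat.one_mul] at k4
      rw [h0, if_pos Nat.one_pos, run_ite]
      have hev : (lt (get .G ♯.p + 1) (get .rad ♯.p)).eval S2 =
          if g y + 1 < I.radix y then 1 else 0 := by
        simp [hx, k3 y le_rfl, hr2]
      rw [hev]
      have hrl := I.radix_le y
      by_cases hc : g y + 1 < I.radix y
      · rw [if_pos hc, if_pos Nat.one_pos, run_seq,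
          run_put (i := ♯.p) (u := y) (v := g y + 1) hx (by simp [hx, k3 y le_rfl])
            (hcap _ (by omega)),
          run_set (S := S2.setArr .G y (g y + 1)) (e := 0) (v := 0) rfl (hcap _ (by omega))]
        simp only [HState.setReg_reg, HState.setReg_arr, HState.setArr_arr, reduceCtorEq, if_false,
          if_true, true_and, Nat.zero_mul, Nat.add_zero]
        refine ⟨Nat.zero_le _, fun p hp => ?_, fun p hp => ?_, ?_⟩
        · by_cases hpy : p = y
          · rw [if_pos hpy, hpy]; exact hc
          · rw [if_neg hpy]; exact k2 p (by omega)
        · rw [if_neg (by omega)]; exact k3 p (by omega)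
        · rw [hs, hs, hmv _ (S2.arr .G) fun p hp => ?_]
          · simp only [HState.setArr_arr, true_and, if_true, Nat.add_mul,
              Nat.one_mul]
            omega
          · simp only [HState.setArr_arr, true_and]
            rw [if_neg (by omega)]
      · rw [if_neg hc, if_neg (lt_irrefl _),
          run_put (i := ♯.p) (u := y) (v := 0) hx rfl (hcap _ (by omega))]
        simp only [HState.setReg_reg, HState.setReg_arr, HState.setArr_arr, HState.setArr_reg,
          reduceCtorEq, if_false, true_and, h0]
        refine ⟨le_rfl, fun p hp => ?_, fun p hp => ?_, ?_⟩
        · by_cases hpy : p = y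
          · rw [if_pos hpy, hpy]; omega
          · rw [if_neg hpy]; exact k2 p (by omega)
        · rw [if_neg (by omega)]; exact k3 p (by omega)
        · have hgr : g y + 1 = I.radix y := by omega
          rw [hs, hs, hmv _ (S2.arr .G) fun p hp => ?_, prod_range_succ, ← hgr, Nat.mul_add,
            Nat.mul_one, Nat.one_mul, Nat.mul_comm _ (g y)]
          · simp only [HState.setArr_arr, true_and, if_true, Nat.zero_mul]
            omega
          · simp only [HState.setArr_arr, true_and]
            rw [if_neg (by omega)]

/-- The result of the search: a solution, or the certainty that there is none. -/
structure Found (I : CCOInstance) (S : HState) : Prop extends Layout I S where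
  zero : S.reg .zero = 0
  ans : (S.reg .ans = 1 ∧ I.Valid (S.arr .lab) (S.cen I.m)) ∨ (S.reg .ans = 0 ∧ ¬ I.IsYes)

/-- The search has not yet passed a guess vector that leads to a solution, if there is one. -/
def Pending (I : CCOInstance) (v : ℕ) : Prop :=
  I.IsYes → ∃ g : ℕ → ℕ, (∀ p < I.guessLen, g p < I.radix p) ∧
    (∀ S, Layout I S → (∀ p < I.guessLen, S.arr .G p = g p) → (attempt.run S).reg .bad = 0) ∧
    v ≤ mixedVal I.radix g I.guessLen

theorem pending_zero (I : CCOInstance) : Pending I 0 := fun h => by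
  obtain ⟨g, h1, h2⟩ := h.exists_guessVec
  exact ⟨g, h1, h2, Nat.zero_le _⟩

theorem Pending.succ {v : ℕ} (h : Pending I v) (hS : Search I v S)
    (hb : (attempt.run S).reg .bad ≠ 0) : Pending I (v + 1) := by
  intro hI
  obtain ⟨g, h1, h2, h3⟩ := h hI
  refine ⟨g, h1, h2, lt_of_le_of_ne h3 fun he => hb (h2 S hS.toLayout ?_)⟩
  exact mixedVal_inj _ hS.lt h1 (hS.val.trans he)

/-- A round ends the search with a result, or goes on to the next guess vector. -/
theorem run_round {v : ℕ} (hS : Search I v S) (hp : Pending I v) :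
    ((searchRound.run S).reg .go = 0 ∧ Found I (searchRound.run S)) ∨
      (v + 1 < I.guessCount ∧ Pending I (v + 1) ∧ Search I (v + 1) (searchRound.run S)) := by
  have hsz := I.size_ge
  have hval1 := valid_of_attempt hS.toEnv
  have hp1 : (attempt.run S).reg .bad ≠ 0 → Pending I (v + 1) := fun hb => hp.succ hS hb
  rw [searchRound, run_seq]
  set S1 := attempt.run S with hS1
  have h1 : Layout I S1 := hS.toLayout.frame (attempt.frame S (by decide +kernel))
  have hw1 : ∀ y ∈ [Var.ans, .zero, .go], y ∉ attempt.wv := by decide +kernel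
  have hreg : ∀ y ∈ [Var.ans, .zero, .go], S1.reg y = S.reg y := fun y hy => by
    rw [hS1, run_reg _ _ (hw1 y hy)]
  have hG1 : S1.arr .G = S.arr .G := by rw [hS1, run_arr attempt _ (by decide +kernel)]
  have hR1 : S1.arr .rad = S.arr .rad := by rw [hS1, run_arr attempt _ (by decide +kernel)]
  have hzero : S1.reg .zero = 0 := by rw [hreg _ (by decide), hS.zero]
  have hframe : ∀ (x : Var) (u : ℕ) {S' : HState}, Layout I S' → x ∉ fixedVars →
      Layout I (S'.setReg x u) := fun x u S' hL hx =>
    hL.frame (vs := [x]) (as := [])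
      ⟨fun y hy => by simp only [List.mem_singleton] at hy; simp [hy], fun _ _ => rfl, rfl, rfl,
        rfl⟩
      (fun y hy => by simp only [List.mem_singleton]; rintro rfl; exact hx hy)
  clear_value S1
  rw [run_ite, eval_var]
  by_cases hb : S1.reg .bad = 0
  · rw [if_neg (by omega), run_seq, run_set (v := 1) rfl (h1.toEnv.small_lt_cap (by omega)),
      run_set (v := 0) rfl ((h1.toEnv.setReg _ _).small_lt_cap (by omega))]
    have h2 := hframe .go 0 (hframe .ans 1 h1 (by decide)) (by decide)
    refine Or.inl ⟨by simp, h2, by simp [hzero], Or.inl ⟨by simp, ?_⟩⟩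
    exact hval1 hb
  · rw [if_pos (by omega), run_seq]
    have hp' := hp1 hb
    obtain ⟨a1, a2⟩ := run_advance h1 (by rw [hR1]; exact hS.rad) (by rw [hG1]; exact hS.lt)
    rw [hG1, hS.val] at a2
    set S2 := advance.run S1 with hS2
    have h2 : Layout I S2 := h1.frame (advance.frame S1 (by decide +kernel))
    have hw2 : ∀ y ∈ [Var.ans, .zero, .go], y ∉ advance.wv := by decide +kernel
    have hreg2 : ∀ y ∈ [Var.ans, .zero, .go], S2.reg y = S.reg y := fun y hy => by
      rw [hS2, run_reg _ _ (hw2 y hy), hreg y hy]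
    have hR2 : S2.arr .rad = S1.arr .rad := by rw [hS2, run_arr advance _ (by decide +kernel)]
    clear_value S2
    rw [run_ite, eval_var]
    rcases a2 with ⟨hc, hval⟩ | ⟨hc, hval⟩
    · rw [hc, if_neg (lt_irrefl _)]
      refine Or.inr ⟨?_, hp', h2, by rw [Cm.run, hR2, hR1]; exact hS.rad, a1, hval, ?_, ?_, ?_⟩
      · rw [← hval]
        exact mixedVal_lt _ a1
      · rw [Cm.run, hreg2 _ (by decide), hS.ans]
      · rw [Cm.run, hreg2 _ (by decide), hS.zero]
      · rw [Cm.run, hreg2 _ (by decide), hS.go]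
    · rw [hc, if_pos Nat.one_pos, run_set (v := 0) rfl (h2.toEnv.small_lt_cap (by omega))]
      refine Or.inl ⟨by simp, hframe .go 0 h2 (by decide), ?_, Or.inr ⟨?_, fun hI => ?_⟩⟩
      · simp [hreg2, hS.zero]
      · simp [hreg2, hS.ans]
      · obtain ⟨g, h3, -, h4⟩ := hp' hI
        have := mixedVal_lt _ h3
        rw [← guessCount] at this
        omega

/-- The variables that bound loops during the search. -/
def loopVars : List Var := [.m, .n, .k, .B, .L, .T]

theorem wf_round_loopVars : searchRound.wf 12 loopVars := by decide +kernel

/-- The search loop: `f` more guess vectors remain to be tried. If all values are at most `Y`, then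
all intermediate values, addresses included, are less than `Y ^ 12`. -/
theorem exec_search {W Y : ℕ} (hY : 16 ≤ Y) (hW : Y ^ 12 ≤ W) {ρ : Var → ℕ}
    (f : ℕ) : ∀ {S : HState} {v : ℕ}, v + f = I.guessCount → Search I v S → Pending I v →
      S.Bdd Y → (∀ y ∈ loopVars, S.reg y ≤ ρ y) →
      ∃ t ≤ f * (searchRound.time ρ + 1) + 1, ∃ S', Found I S' ∧ S'.Bdd Y ∧
        (∀ y ∈ fixedVars, S'.reg y = S.reg y) ∧ S'.base = S.base ∧
        WordRAM.Exec W (.while Var.zero.reg Var.go.reg searchRound.code) S.conc t S'.conc := by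
  induction f with
  | zero =>
    intro S v hv hS
    have := mixedVal_lt _ hS.lt
    rw [hS.val, ← guessCount] at this
    omega
  | succ f ih =>
    intro S v hv hS hp hB hρ
    obtain ⟨t1, ht1, hE1⟩ := Cm.exec_code (by norm_num) hY hW searchRound hB wf_round_loopVars hρ
    have hB1 : (searchRound.run S).Bdd Y := Cm.Bdd.run searchRound hB wf_round_loopVars
    have hf1 : ∀ y ∈ fixedVars, (searchRound.run S).reg y = S.reg y := fun y hy =>
      run_reg _ _ (notMem_wv hy _ wf_round)
    have hb1 := run_base searchRound S
    have hsub : ∀ y ∈ loopVars, y ∈ fixedVars := by decide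
    have htest : S.conc.reg Var.zero.reg < S.conc.reg Var.go.reg := by
      rw [HState.conc_reg, HState.conc_reg, hS.zero, hS.go]
      exact Nat.one_pos
    rcases run_round hS hp with ⟨hgo, hF⟩ | ⟨hlt, hp', hS'⟩
    · refine ⟨t1 + 1 + 1, ?_, searchRound.run S, hF, hB1, hf1, hb1,
        .while_true htest hE1 (.while_false ?_)⟩
      · rw [Nat.succ_mul]; omega
      · rw [HState.conc_reg, HState.conc_reg, hgo]
        omega
    · obtain ⟨t2, ht2, S', hF, hB', hf', hb', hE2⟩ := ih (by omega) hS' hp' hB1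
        (fun y hy => (hf1 y (hsub y hy)).trans_le (hρ y hy))
      refine ⟨t1 + t2 + 1, ?_, S', hF, hB', fun y hy => (hf' y hy).trans (hf1 y hy),
        hb'.trans hb1, .while_true htest hE1 hE2⟩
      rw [Nat.succ_mul]; omega

end CCOInstance

/-! ### Preparation and output -/

namespace Imp

open Ex Cm

theorem loop_induct {x b : Var} {p : Cm} {S : HState} (Q : ℕ → HState → Prop)
    (h0 : Q 0 (S.setReg x 0))
    (hs : ∀ i < S.reg b, ∀ S', S'.reg x = i → Q i S' → Q (i + 1) ((p.run S').setReg x (i + 1))) :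
    Q (S.reg b) ((Cm.loop x b p).run S) := by
  have key : ∀ i ≤ S.reg b, (loopRun p.run x S i).reg x = i ∧ Q i (loopRun p.run x S i) := by
    intro i
    induction i with
    | zero => exact fun _ => ⟨by simp [loopRun], h0⟩
    | succ i ih =>
      intro hi
      obtain ⟨h1, h2⟩ := ih (by omega)
      exact ⟨by simp [loopRun], hs i (by omega) _ h1 h2⟩
  exact (key _ le_rfl).2

theorem setLow_low {S : HState} {i : ℕ} (hi : i < S.base) (v a : ℕ) :
    (S.setLow i v).low a = if a = i then v else S.low a := by
  simp [HState.setLow, hi, Function.update_apply]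

theorem run_poke {S : HState} {i e : Ex} {u v : ℕ} (hu : i.eval S = u) (h : e.eval S = v)
    (hv : v < S.cap) : (Cm.poke i e).run S = S.setLow u v := by
  subst h hu
  rw [Cm.run, HState.clamp_of_lt hv]

theorem run_clog {S : HState} {y b : Var} (hy : y ≠ .x ∧ y ≠ .pw) (hb : b ≠ .x ∧ b ≠ .pw ∧ b ≠ y)
    (hcap : 2 * S.reg b + 2 < S.cap) : ((clog y b).run S).reg y = Nat.clog 2 (S.reg b) := by
  set n := S.reg b with hn
  have hcn : Nat.clog 2 n ≤ n := Nat.clog_le_of_le_pow Nat.lt_two_pow_self.le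
  have e1 : (Cm.set y 0).run S = S.setReg y 0 := run_set rfl (by omega)
  have e2 : (Cm.set .pw 1).run (S.setReg y 0) = (S.setReg y 0).setReg .pw 1 :=
    run_set rfl (by rw [HState.setReg_cap]; omega)
  rw [clog, run_seq, run_seq, e1, e2]
  set S1 := (S.setReg y 0).setReg .pw 1
  have hb1 : S1.reg b = n := by simp [S1, hb, hn]
  have key := loop_induct (x := .x) (b := b) (S := S1)
    (p := .ite (lt ♯.pw ♯b) (.set .pw (2 * ♯.pw) ;; .set y (♯y + 1)) .skip)
    (fun i S' => S'.cap = S.cap ∧ S'.reg b = n ∧ S'.reg y = min i (Nat.clog 2 n) ∧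
      S'.reg .pw = 2 ^ min i (Nat.clog 2 n))
    (by simp [S1, hb, hy, hn]) ?_
  · rw [hb1] at key
    rw [key.2.2.1, min_eq_right hcn]
  · rintro i hi S2 hx ⟨k0, k1, k2, k3⟩
    rw [run_ite, eval_lt', eval_var, eval_var, k1, k3]
    by_cases hc : i < Nat.clog 2 n
    · have h1 : 2 ^ i < n := by
        by_contra hcon
        exact absurd (Nat.clog_le_of_le_pow (not_lt.1 hcon)) (not_le.2 hc)
      rw [min_eq_left hc.le] at k2 k3 ⊢
      rw [if_pos h1, if_pos Nat.one_pos, run_seq,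
        run_set (S := S2) (x := .pw) (v := 2 ^ (i + 1)) (by simp [k3, pow_succ, Nat.mul_comm])
          (by rw [k0, pow_succ]; omega),
        run_set (S := S2.setReg .pw (2 ^ (i + 1))) (v := i + 1) (by simp [hy, k2])
          (by rw [HState.setReg_cap, k0]; omega)]
      rw [min_eq_left (Nat.succ_le_of_lt hc)]
      simp [k0, hb, hy, hy.2.symm, k1]
    · have h1 : ¬ 2 ^ min i (Nat.clog 2 n) < n := by
        rw [min_eq_right (not_lt.1 hc)]
        exact not_lt.2 (Nat.le_pow_clog one_lt_two n)
      rw [if_neg h1, if_neg (lt_irrefl _)]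
      rw [min_eq_right (not_lt.1 hc)] at k2 k3
      rw [min_eq_right (by omega : Nat.clog 2 n ≤ i + 1)]
      simp [Cm.run, k0, k1, k2, k3, hb, hy]

end Imp

namespace CCOInstance

open Imp Ex Cm

variable {I : CCOInstance} {S S' : HState}

/-- The state in which the variables other than `sk` and those of the input are still `0`. -/
def startState (I : CCOInstance) : HState where
  reg := fun x => match x with
    | .m => I.m
    | .n => I.n
    | .s => I.s
    | .k => I.k
    | .B => I.B
    | .l => I.ℓ
    | .sk => I.s ^ I.k
    | _ => 0
  arr := fun _ _ => 0
  low := fun a => I.input.getD a 0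
  base := I.input.length + I.n + I.k * I.m
  cap := I.size ^ 4

theorem run_layout (I : CCOInstance) :
    Layout I (layout.run I.startState) ∧
      (layout.run I.startState).reg .out1 = I.input.length ∧
      (layout.run I.startState).reg .out2 = I.input.length + I.n ∧
      (layout.run I.startState).reg .go = 1 ∧ (layout.run I.startState).reg .zero = 0 ∧
      (layout.run I.startState).reg .ans = 0 := by
  have hsz := I.size_ge
  have hle := I.le_size
  have hcl := Guess.codeLen_le I
  have hlen := I.length_input
  have hss : 10 * I.size ≤ I.size * I.size := Nat.mul_le_mul_right _ hsz
  have hkB : I.k * I.B ≤ I.size * I.size := Nat.mul_le_mul hle.2.2.2.1 hle.2.2.2.2.1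
  rw [pow_two] at hcl
  have hcap : ∀ v < 100 * (I.size * I.size), v < I.size ^ 4 := fun v hv => by
    have h2 : 10 * 10 ≤ I.size * I.size := Nat.mul_le_mul hsz hsz
    calc v < 100 * (I.size * I.size) := hv
      _ ≤ I.size * I.size * (I.size * I.size) := Nat.mul_le_mul_right _ (by omega)
      _ = _ := by ring
  set S0 := I.startState with hS0
  have hc0 : S0.cap = I.size ^ 4 := rfl
  have e1 : (Cm.set .oR (6 + ♯.n * ♯.m)).run S0 = S0.setReg .oR (6 + I.n * I.m) :=
    run_set rfl (by rw [hc0]; exact hcap _ (by omega))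
  set S1 := S0.setReg .oR (6 + I.n * I.m) with hS1
  have e2 : (Cm.set .out1 (♯.oR + ♯.m * ♯.sk)).run S1 = S1.setReg .out1 I.input.length :=
    run_set (by rw [hlen]; rfl) (by rw [hS1, HState.setReg_cap, hc0]; exact hcap _ (by omega))
  set S2 := S1.setReg .out1 I.input.length with hS2
  have e3 : (Cm.set .out2 (♯.out1 + ♯.n)).run S2 = S2.setReg .out2 (I.input.length + I.n) :=
    run_set rfl (by
      rw [hS2, HState.setReg_cap, hS1, HState.setReg_cap, hc0]; exact hcap _ (by omega))
  set S3 := S2.setReg .out2 (I.input.length + I.n) with hS3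
  have e4 : (Cm.set .kB (♯.k * ♯.B)).run S3 = S3.setReg .kB (I.k * I.B) :=
    run_set rfl (by
      rw [hS3, HState.setReg_cap, hS2, HState.setReg_cap, hS1, HState.setReg_cap, hc0]
      exact hcap _ (by omega))
  set S4 := S3.setReg .kB (I.k * I.B) with hS4
  have hc4 : S4.cap = I.size ^ 4 := rfl
  have e5 := run_clog (S := S4) (y := .lamB) (b := .B) (by decide) (by decide)
    (by rw [hc4, show S4.reg .B = I.B from rfl]; exact hcap _ (by omega))
  set S5 := (clog .lamB .B).run S4 with hS5
  have hr5 : ∀ y, y ∉ (clog .lamB .B).wv → S5.reg y = S4.reg y := fun y hy => by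
    rw [hS5, run_reg _ _ hy]
  have hc5 : S5.cap = I.size ^ 4 := by rw [hS5, run_cap, hc4]
  have hn5 : S5.reg .n = I.n := hr5 _ (by decide +kernel)
  have e6 := run_clog (S := S5) (y := .lamn) (b := .n) (by decide) (by decide)
    (by rw [hc5, hn5]; exact hcap _ (by omega))
  set S6 := (clog .lamn .n).run S5 with hS6
  have hr6 : ∀ y, y ∉ (clog .lamn .n).wv → S6.reg y = S5.reg y := fun y hy => by
    rw [hS6, run_reg _ _ hy]
  have hc6 : S6.cap = I.size ^ 4 := by rw [hS6, run_cap, hc5]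
  have hb6 : S6.base = S0.base := by rw [hS6, run_base, hS5, run_base]; rfl
  have hl6 : S6.low = S0.low := by
    rw [hS6, run_low _ _ (by decide), hS5, run_low _ _ (by decide)]; rfl
  rw [hn5] at e6
  have hlamB : S6.reg .lamB = Nat.clog 2 I.B := by
    rw [hr6 _ (by decide +kernel), e5]; rfl
  have hr : ∀ y ∈ [Var.m, .n, .s, .k, .B, .l, .sk, .oR, .out1, .out2, .kB, .zero, .ans],
      S6.reg y = S4.reg y := fun y hy => by
    have h1 : ∀ y ∈ [Var.m, .n, .s, .k, .B, .l, .sk, .oR, .out1, .out2, .kB, .zero, .ans],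
      y ∉ (clog .lamn .n).wv ∧ y ∉ (clog .lamB .B).wv := by decide +kernel
    rw [hr6 _ (h1 y hy).1, hr5 _ (h1 y hy).2]
  have g1 : S6.reg .m = I.m := hr _ (by decide)
  have g2 : S6.reg .n = I.n := hr _ (by decide)
  have g3 : S6.reg .s = I.s := hr _ (by decide)
  have g4 : S6.reg .k = I.k := hr _ (by decide)
  have g5 : S6.reg .B = I.B := hr _ (by decide)
  have g6 : S6.reg .l = I.ℓ := hr _ (by decide)
  have g7 : S6.reg .sk = I.s ^ I.k := hr _ (by decide)
  have g8 : S6.reg .oR = 6 + I.n * I.m := hr _ (by decide)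
  have g9 : S6.reg .out1 = I.input.length := hr _ (by decide)
  have g10 : S6.reg .out2 = I.input.length + I.n := hr _ (by decide)
  have g11 : S6.reg .kB = I.k * I.B := hr _ (by decide)
  have g12 : S6.reg .zero = 0 := hr _ (by decide)
  have g13 : S6.reg .ans = 0 := hr _ (by decide)
  have hrun : layout.run S0 = ((.set .L (♯.B * (2 + 2 * ♯.lamB) + 2 * (♯.k * ♯.lamn)) ;;
      .set .gT (♯.k + ♯.B) ;;
      .set .gV (♯.gT + ♯.B) ;;
      .set .gU (♯.gV + ♯.B) ;;
      .set .gS (♯.gU + ♯.B) ;;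
      .set .gY (♯.gS + ♯.L) ;;
      .set .T (♯.gY + ♯.kB) ;;
      .set .go 1 : Cm)).run S6 := by
    rw [layout, run_seq, e1, run_seq, e2, run_seq, e3, run_seq, e4, run_seq, ← hS5, run_seq, ← hS6]
  rw [hrun]
  clear_value S6
  simp only [run_seq]
  rw [run_set (S := S6) (x := .L) (v := I.codeLen) (by simp [g5, hlamB, g4, e6, codeLen])
    (by rw [hc6]; exact hcap _ (by omega))]
  set S7 := S6.setReg .L I.codeLen with hS7
  rw [run_set (S := S7) (x := .gT) (v := I.k + I.B) (by simp [S7, g4, g5])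
    (by rw [hS7, HState.setReg_cap, hc6]; exact hcap _ (by omega))]
  set S8 := S7.setReg .gT (I.k + I.B) with hS8
  rw [run_set (S := S8) (x := .gV) (v := I.k + I.B + I.B) (by simp [S8, S7, g5])
    (by simp only [hS8, hS7, HState.setReg_cap, hc6]; exact hcap _ (by omega))]
  set S9 := S8.setReg .gV (I.k + I.B + I.B) with hS9
  rw [run_set (S := S9) (x := .gU) (v := I.k + I.B + I.B + I.B) (by simp [S9, S8, S7, g5])
    (by simp only [hS9, hS8, hS7, HState.setReg_cap, hc6]; exact hcap _ (by omega))]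
  set S10 := S9.setReg .gU (I.k + I.B + I.B + I.B) with hS10
  rw [run_set (S := S10) (x := .gS) (v := I.k + I.B + I.B + I.B + I.B)
    (by simp [S10, S9, S8, S7, g5])
    (by simp only [hS10, hS9, hS8, hS7, HState.setReg_cap, hc6]; exact hcap _ (by omega))]
  set S11 := S10.setReg .gS (I.k + I.B + I.B + I.B + I.B) with hS11
  rw [run_set (S := S11) (x := .gY) (v := I.k + I.B + I.B + I.B + I.B + I.codeLen)
    (by simp [S11, S10, S9, S8, S7])
    (by simp only [hS11, hS10, hS9, hS8, hS7, HState.setReg_cap, hc6]; exact hcap _ (by omega))]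
  set S12 := S11.setReg .gY (I.k + I.B + I.B + I.B + I.B + I.codeLen) with hS12
  rw [run_set (S := S12) (x := .T) (v := I.k + I.B + I.B + I.B + I.B + I.codeLen + I.k * I.B)
    (by simp [S12, S11, S10, S9, S8, S7, g11])
    (by simp only [hS12, hS11, hS10, hS9, hS8, hS7, HState.setReg_cap, hc6]
        exact hcap _ (by omega))]
  set S13 := S12.setReg .T (I.k + I.B + I.B + I.B + I.B + I.codeLen + I.k * I.B) with hS13
  rw [run_set (S := S13) (x := .go) (v := 1) rfl
    (by simp only [hS13, hS12, hS11, hS10, hS9, hS8, hS7, HState.setReg_cap, hc6]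
        exact hcap _ (by omega))]
  simp only [hS13, hS12, hS11, hS10, hS9, hS8, hS7]
  refine ⟨⟨⟨?_, ?_, ?_, ?_, ?_, ?_, ?_, ?_, ?_, ?_, ?_⟩, ?_, ?_, ?_, ?_, ?_, ?_, ?_⟩, ?_, ?_, ?_, ?_, ?_⟩ <;>
    simp only [HState.setReg_reg, HState.setReg_low, HState.setReg_base, HState.setReg_cap, hb6, hl6,
      reduceCtorEq, if_false, if_true, g1, g2, g3, g4, g5, g6, g7, g8, g9, g10, g12, g13, hc6]
  · exact (by omega : I.input.length ≤ I.input.length + I.n + I.k * I.m)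
  · exact fun a _ => rfl

theorem run_radices (h : Layout I S) :
    ∀ p < I.guessLen, (radices.run S).arr .rad p = I.radix p := by
  have hsz := I.size_ge
  have key := loop_spec (x := .p) (b := .T) (S := S)
    (p := .ite (lt ♯.p ♯.k) (.put .rad ♯.p ♯.n) <|
      .ite (lt ♯.p ♯.gT) (.put .rad ♯.p ♯.k) <|
      .ite (lt ♯.p ♯.gS) (.put .rad ♯.p ♯.B) <|
      .ite (lt ♯.p ♯.gY) (.put .rad ♯.p 3) (.put .rad ♯.p ♯.s))
    (fun y S' => ∀ p < y, S'.arr .rad p = I.radix p) (by decide +kernel) (by simp) ?_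
  · rw [h.T] at key
    exact key
  · intro y hy S1 hF hx hQ
    have h1 : Layout I S1 := h.frame hF
    have hrun : (Cm.ite (lt ♯.p ♯.k) (.put .rad ♯.p ♯.n) <|
      .ite (lt ♯.p ♯.gT) (.put .rad ♯.p ♯.k) <|
      .ite (lt ♯.p ♯.gS) (.put .rad ♯.p ♯.B) <|
      .ite (lt ♯.p ♯.gY) (.put .rad ♯.p 3) (.put .rad ♯.p ♯.s)).run S1 =
        S1.setArr .rad y (I.radix y) := by
      have hcap : I.radix y < S1.cap := h1.toEnv.small_lt_cap (by have := I.radix_le y; omega)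
      have hput : ∀ e : Ex, e.eval S1 = I.radix y →
          (Cm.put .rad ♯.p e).run S1 = S1.setArr .rad y (I.radix y) := fun e he =>
        run_put (i := ♯.p) hx he hcap
      simp only [run_ite, eval_lt', eval_var, hx, h1.k, h1.gT, h1.gS, h1.gY]
      unfold radix at hput ⊢
      by_cases c1 : y < I.k
      · simp only [c1, if_true, Nat.one_pos] at hput ⊢
        exact hput _ h1.n
      by_cases c2 : y < I.k + I.B
      · simp only [c1, c2, if_true, if_false, Nat.one_pos, lt_irrefl] at hput ⊢
        exact hput _ h1.k
      by_cases c3 : y < I.k + I.B + I.B + I.B + I.B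
      · simp only [c1, c2, c3, if_true, if_false, Nat.one_pos, lt_irrefl] at hput ⊢
        exact hput _ h1.B
      by_cases c4 : y < I.k + I.B + I.B + I.B + I.B + I.codeLen
      · simp only [c1, c2, c3, c4, if_true, if_false, Nat.one_pos, lt_irrefl] at hput ⊢
        exact hput _ rfl
      · simp only [c1, c2, c3, c4, if_false, lt_irrefl] at hput ⊢
        exact hput _ h1.s
    rw [hrun]
    intro p hp
    simp only [HState.setReg_arr, HState.setArr_arr, true_and]
    split
    · rename_i hpy; rw [hpy]
    · exact hQ p (by omega)

/-- The first guess vector consists of zeros. -/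
theorem search_start (I : CCOInstance) :
    Search I 0 (radices.run (layout.run I.startState)) := by
  obtain ⟨h1, h2, h3, h4, h5, h6⟩ := I.run_layout
  have hG : (radices.run (layout.run I.startState)).arr .G = fun _ => 0 := by
    rw [run_arr _ _ (by decide +kernel), run_arr _ _ (by decide +kernel)]
    rfl
  have hrad := run_radices h1
  have hreg : ∀ y, y ∉ radices.wv → (radices.run (layout.run I.startState)).reg y =
      (layout.run I.startState).reg y := fun y hy => run_reg _ _ hy
  refine ⟨h1.frame (radices.frame _ (by decide +kernel)), hrad, fun p hp => ?_, ?_, ?_, ?_, ?_⟩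
  · rw [hG]
    change 0 < I.radix p
    rw [radix]
    have := I.n_pos
    have := I.k_pos
    have := I.s_pos
    split_ifs <;> omega
  · rw [hG, mixedVal]; simp
  · rw [hreg _ (by decide +kernel), h6]
  · rw [hreg _ (by decide +kernel), h5]
  · rw [hreg _ (by decide +kernel), h4]

/-- The output is written below `base`, after the input. -/
theorem run_output (h : Env I S) (hv : I.Valid (S.arr .lab) (S.cen I.m))
    (h1 : S.reg .out1 = I.input.length) (h2 : S.reg .out2 = I.input.length + I.n)
    (hbase : S.base = I.input.length + I.n + I.k * I.m) :
    (∀ j < I.n, (output.run S).low (I.input.length + j) = S.arr .lab j) ∧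
      ∀ i < I.k, ∀ x < I.m, (output.run S).low (I.input.length + I.n + (i * I.m + x)) =
        S.cen I.m i x := by
  have hsz := I.size_ge
  have hle := I.le_size
  set E : HState → Prop := fun S' => (∀ y, y ∉ [Var.i, .j, .h] → S'.reg y = S.reg y) ∧
    S'.arr = S.arr ∧ S'.base = S.base ∧ S'.cap = S.cap with hE
  have hEset : ∀ {S' : HState} (x : Var) (v : ℕ), E S' → x ∈ [Var.i, .j, .h] → E (S'.setReg x v) := by
    rintro S' x v ⟨k1, k2, k3, k4⟩ hx
    refine ⟨fun y hy => ?_, k2, k3, k4⟩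
    rw [HState.setReg_reg, if_neg (by rintro rfl; exact hy hx), k1 y hy]
  have hElow : ∀ {S' : HState} (i v : ℕ), E S' → E (S'.setLow i v) := by
    rintro S' i v ⟨k1, k2, k3, k4⟩
    exact ⟨fun y hy => by rw [HState.setLow_reg, k1 y hy], by rw [HState.setLow_arr, k2],
      by rw [HState.setLow_base, k3], by rw [HState.setLow_cap, k4]⟩
  have hcap : ∀ v ≤ I.size, v < S.cap := fun v hv => h.small_lt_cap (by omega)
  have hidx : ∀ i < I.k, ∀ x < I.m, i * I.m + x < I.k * I.m := fun i hi x hx => by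
    have := Nat.mul_le_mul_right I.m (Nat.succ_le_of_lt hi)
    rw [Nat.succ_mul] at this
    omega
  have hinj : ∀ i x i' x', x < I.m → x' < I.m → i * I.m + x = i' * I.m + x' → i = i' ∧ x = x' := by
    intro i x i' x' hx hx' he
    have e1 := congrArg (· / I.m) he
    have e2 := congrArg (· % I.m) he
    simp only [Nat.mul_add_mod_of_lt hx, Nat.mul_add_mod_of_lt hx'] at e2
    simp only [Nat.mul_comm _ I.m, Nat.mul_add_div I.m_pos, Nat.div_eq_of_lt hx,
      Nat.div_eq_of_lt hx', Nat.add_zero] at e1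
    exact ⟨e1, e2⟩
  rw [output, run_seq]
  have key1 := loop_induct (x := .j) (b := .n) (S := S) (p := .poke (♯.out1 + ♯.j) (get .lab ♯.j))
    (fun y S' => E S' ∧ ∀ j < y, S'.low (I.input.length + j) = S.arr .lab j)
    ⟨hEset _ _ ⟨fun _ _ => rfl, rfl, rfl, rfl⟩ (by decide), by simp⟩ (by
      rintro y hy S1 hx ⟨k1, k2⟩
      rw [h.n] at hy
      have hl := hv.lab_le y hy
      rw [run_poke (u := I.input.length + y) (v := S.arr .lab y)
        (by simp [k1.1 .out1 (by decide), h1, hx]) (by simp [hx, k1.2.1])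
        (by rw [k1.2.2.2]; exact hcap _ (by omega))]
      refine ⟨hEset _ _ (hElow _ _ k1) (by decide), fun j hj => ?_⟩
      rw [HState.setReg_low, setLow_low (by rw [k1.2.2.1, hbase]; omega)]
      by_cases hjy : j = y
      · subst hjy; rw [if_pos rfl]
      · rw [if_neg (by omega)]; exact k2 j (by omega))
  rw [h.n] at key1
  set S1 := (Cm.loop .j .n (.poke (♯.out1 + ♯.j) (get .lab ♯.j))).run S
  obtain ⟨k1, k2⟩ := key1
  have key2 := loop_induct (x := .i) (b := .k) (S := S1) (p := .loop .h .m
      (.poke (♯.out2 + (♯.i * ♯.m + ♯.h)) (get .cen (♯.i * ♯.m + ♯.h))))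
    (fun y S' => E S' ∧ (∀ j < I.n, S'.low (I.input.length + j) = S.arr .lab j) ∧
      ∀ i < y, ∀ x < I.m, S'.low (I.input.length + I.n + (i * I.m + x)) = S.cen I.m i x)
    ⟨hEset _ _ k1 (by decide), k2, by simp⟩ (by
      rintro y hy S2 hx ⟨a1, a2, a3⟩
      rw [k1.1 .k (by decide), h.k] at hy
      have hm2 : S2.reg .m = I.m := by rw [a1.1 .m (by decide), h.m]
      have key3 := loop_induct (x := .h) (b := .m) (S := S2)
        (p := .poke (♯.out2 + (♯.i * ♯.m + ♯.h)) (get .cen (♯.i * ♯.m + ♯.h)))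
        (fun z S' => E S' ∧ S'.reg .i = y ∧
          (∀ j < I.n, S'.low (I.input.length + j) = S.arr .lab j) ∧
          (∀ i < y, ∀ x < I.m, S'.low (I.input.length + I.n + (i * I.m + x)) = S.cen I.m i x) ∧
          ∀ x < z, S'.low (I.input.length + I.n + (y * I.m + x)) = S.cen I.m y x)
        ⟨hEset _ _ a1 (by decide), by simp [hx], a2, a3, by simp⟩ (by
          rintro z hz S3 hz3 ⟨b1, b2, b3, b4, b5⟩
          rw [hm2] at hz
          have hs := hv.lt y hy z hz
          have hyz := hidx y hy z hz
          rw [run_poke (u := I.input.length + I.n + (y * I.m + z)) (v := S.cen I.m y z)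
            (by simp [b1.1 .out2 (by decide), b1.1 .m (by decide), h.m, h2, hz3, b2])
            (by simp [b1.1 .m (by decide), h.m, hz3, b2, b1.2.1])
            (by rw [b1.2.2.2]; exact hcap _ (by omega))]
          have hlow := fun a => setLow_low (S := S3) (i := I.input.length + I.n + (y * I.m + z))
            (by rw [b1.2.2.1, hbase]; omega) (S.cen I.m y z) a
          refine ⟨hEset _ _ (hElow _ _ b1) (by decide), by simp [b2], fun j hj => ?_,
            fun i hi x hxm => ?_, fun x hxz => ?_⟩
          · rw [HState.setReg_low, hlow, if_neg (by omega)]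
            exact b3 j hj
          · rw [HState.setReg_low, hlow, if_neg]
            · exact b4 i hi x hxm
            · intro he
              have := hinj i x y z hxm hz (by omega)
              omega
          · rw [HState.setReg_low, hlow]
            by_cases hxz' : x = z
            · subst hxz'; rw [if_pos rfl]
            · rw [if_neg (by omega)]; exact b5 x (by omega))
      rw [hm2] at key3
      obtain ⟨c1, c2, c3, c4, c5⟩ := key3
      refine ⟨hEset _ _ c1 (by decide), c3, fun i hi => ?_⟩
      rcases Nat.lt_succ_iff_lt_or_eq.1 hi with h' | rfl
      · exact c4 i h'
      · exact c5)
  rw [k1.1 .k (by decide), h.k] at key2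
  exact key2.2

end CCOInstance

/-! ### Loading the input -/

namespace CCOInstance

open WordRAM

/-- The machine state after the input has been loaded into the registers of the variables; `sk`,
`b`, and `c` are the contents of the registers of the variable `sk` and of the two constants. -/
def loaded (I : CCOInstance) (sk b c : ℕ) : State where
  reg := fun r => if r = 4 then I.m else if r = 5 then I.n else if r = 6 then I.s else
    if r = 7 then I.k else if r = 8 then I.B else if r = 9 then I.ℓ else
    if r = 10 then sk else if r = 64 then b else if r = 65 then c else 0
  mem := (init I.input).mem

theorem conc_startState (I : CCOInstance) : I.startState.conc =
    I.loaded (I.s ^ I.k) (I.input.length + I.n + I.k * I.m) (I.size ^ 4) := by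
  refine State.ext_setReg (fun r => ?_) (funext fun a => ?_)
  · by_cases hr : ∃ x : Imp.Var, x.reg = r
    · obtain ⟨x, rfl⟩ := hr
      rw [Imp.HState.conc_reg]
      cases x <;> rfl
    · have hne : ∀ x : Imp.Var, r ≠ x.reg := fun x hx => hr ⟨x, hx.symm⟩
      simp only [Imp.HState.conc]
      rw [Function.extend_apply' _ _ _ hr]
      simp only [loaded]
      have h4 : ¬ r = 4 := hne .m
      have h5 : ¬ r = 5 := hne .n
      have h6 : ¬ r = 6 := hne .s
      have h7 : ¬ r = 7 := hne .k
      have h8 : ¬ r = 8 := hne .B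
      have h9 : ¬ r = 9 := hne .l
      have h10 : ¬ r = 10 := hne .sk
      simp only [h4, h5, h6, h7, h8, h9, h10, if_false]
      rfl
  · by_cases h : a < I.startState.base
    · exact Imp.HState.conc_mem_low I.startState h
    · have hb : I.startState.base = I.input.length + I.n + I.k * I.m := rfl
      refine (if_neg h).trans ?_
      have hv : (I.loaded (I.s ^ I.k) (I.input.length + I.n + I.k * I.m) (I.size ^ 4)).mem a = 0 :=
        List.getD_eq_default _ _ (by omega)
      rw [hv]
      by_cases ha : ∃ x : Imp.Arr, x.slot = (a - I.startState.base) % Imp.stride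
      · obtain ⟨x, hx⟩ := ha
        rw [← hx, Imp.Arr.slot_injective.extend_apply]
        rfl
      · rw [Function.extend_apply' _ _ _ ha]

/-- Load word `a` of the memory into register `d`. -/
def loadWord (d a : ℕ) : Prog := .seq (.instr (.const 66 a)) (.instr (.load d 66))

theorem exec_loadWord {W d a v : ℕ} {σ : State} (h : a < W) (hv : σ.mem a = v) :
    Exec W (loadWord d a) σ 2 ((σ.setReg 66 a).setReg d v) :=
  .seq (Exec.const' h) (Exec.load' (by simpa using hv))

/-- Load the six numbers of the input. -/
def loads : Prog :=
  .seq (loadWord 4 0) <| .seq (loadWord 5 1) <| .seq (loadWord 6 2) <| .seq (loadWord 7 3) <|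
  .seq (loadWord 8 4) <| .seq (loadWord 9 5) (.instr (.const 66 0))

theorem exec_loads (I : CCOInstance) {W : ℕ} (hW : 6 ≤ W) :
    Exec W loads (init I.input) 13 (I.loaded 0 0 0) := by
  have h := Exec.seq (exec_loadWord (W := W) (d := 4) (a := 0) (v := I.m) (σ := init I.input)
    (by omega) rfl) <| .seq (exec_loadWord (d := 5) (a := 1) (v := I.n) (by omega) rfl) <|
    .seq (exec_loadWord (d := 6) (a := 2) (v := I.s) (by omega) rfl) <|
    .seq (exec_loadWord (d := 7) (a := 3) (v := I.k) (by omega) rfl) <|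
    .seq (exec_loadWord (d := 8) (a := 4) (v := I.B) (by omega) rfl) <|
    .seq (exec_loadWord (d := 9) (a := 5) (v := I.ℓ) (by omega) rfl) <|
    Exec.const' (d := 66) (v := 0) (by omega)
  refine h.congr (State.ext_setReg (fun r => ?_) rfl)
  simp only [State.setReg_reg, loaded, init]
  by_cases h66 : r = 66
  · subst h66; rfl
  simp only [h66, if_false]
  by_cases h9 : r = 9
  · subst h9; rfl
  by_cases h8 : r = 8
  · subst h8; rfl
  by_cases h7 : r = 7
  · subst h7; rfl
  by_cases h6 : r = 6
  · subst h6; rfl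
  by_cases h5 : r = 5
  · subst h5; rfl
  by_cases h4 : r = 4
  · subst h4; rfl
  simp [*]

/-- Compute `s ^ k`. -/
def power : Prog :=
  .seq (.instr (.const 10 1)) <| .seq (.instr (.const 67 1)) <|
  .seq (.while 66 7 (.seq (.instr (.op .mul 10 10 6)) (.instr (.op .add 66 66 67)))) <|
  .seq (.instr (.const 66 0)) (.instr (.const 67 0))

theorem exec_power (I : CCOInstance) {W : ℕ} (hW : I.size ^ 2 < W) :
    Exec W power (I.loaded 0 0 0) (3 * I.k + 5) (I.loaded (I.s ^ I.k) 0 0) := by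
  have hsz := I.size_ge
  have hle := I.le_size
  rw [pow_two] at hW
  have hss : 10 * I.size ≤ I.size * I.size := Nat.mul_le_mul_right _ hsz
  have hloop : ∀ f i, i + f = I.k →
      Exec W (.while 66 7 (.seq (.instr (.op .mul 10 10 6)) (.instr (.op .add 66 66 67))))
        (((I.loaded (I.s ^ i) 0 0).setReg 67 1).setReg 66 i) (3 * f + 1)
        (((I.loaded (I.s ^ I.k) 0 0).setReg 67 1).setReg 66 I.k) := by
    intro f
    induction f with
    | zero =>
      rintro i rfl
      exact .while_false (by simp [loaded])
    | succ f ih =>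
      intro i hi
      have hpow : I.s ^ (i + 1) ≤ I.s ^ I.k := Nat.pow_le_pow_right I.s_pos (by omega)
      have h1 := Exec.seq (Exec.op' (W := W) (o := .mul) (d := 10) (a := 10) (b := 6)
          (σ := ((I.loaded (I.s ^ i) 0 0).setReg 67 1).setReg 66 i) (v := I.s ^ (i + 1))
          (by simp [loaded, Op.eval, pow_succ]) (by omega)) <|
        Exec.op' (o := .add) (d := 66) (a := 66) (b := 67) (v := i + 1)
          (by simp [Op.eval]) (by omega)
      have h2 := h1.congr (σ'' := ((I.loaded (I.s ^ (i + 1)) 0 0).setReg 67 1).setReg 66 (i + 1))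
        (State.ext_setReg (fun r => by
          simp only [State.setReg_reg, loaded]
          by_cases h66 : r = 66
          · simp only [h66, if_true]
          by_cases h67 : r = 67
          · subst h67; rfl
          by_cases h10 : r = 10
          · subst h10; rfl
          simp only [h66, h67, h10, if_false]) rfl)
      have h3 := Exec.while_true (a := 66) (b := 7) (by simp [loaded]; omega) h2
        (ih (i + 1) (by omega))
      have ht : 3 * (f + 1) + 1 = 1 + 1 + (3 * f + 1) + 1 := by ring
      rw [ht]
      exact h3
  have h := Exec.seq (Exec.const' (W := W) (d := 10) (v := 1) (σ := I.loaded 0 0 0) (by omega)) <|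
    .seq ((Exec.const' (d := 67) (v := 1) (by omega)).congr
      (σ'' := ((I.loaded (I.s ^ 0) 0 0).setReg 67 1).setReg 66 0)
      (State.ext_setReg (fun r => by
          simp only [State.setReg_reg, loaded, pow_zero]
          by_cases h66 : r = 66
          · subst h66; rfl
          by_cases h67 : r = 67
          · subst h67; rfl
          by_cases h10 : r = 10
          · subst h10; rfl
          simp only [h66, h67, h10, if_false]) rfl)) <|
    .seq (hloop I.k 0 (Nat.zero_add _)) <| .seq (Exec.const' (d := 66) (v := 0) (by omega)) <|
    Exec.const' (d := 67) (v := 0) (by omega)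
  have ht : 3 * I.k + 5 = 1 + (1 + (3 * I.k + 1 + (1 + 1))) := by ring
  rw [ht]
  refine h.congr (State.ext_setReg (fun r => ?_) rfl)
  simp only [State.setReg_reg, loaded]
  by_cases h66 : r = 66
  · subst h66; rfl
  by_cases h67 : r = 67
  · subst h67; rfl
  simp only [h66, h67, if_false]

/-- Compute the two constants: the address behind the input and the output, and the fourth power of
the size of the instance. -/
def setup : Prog :=
  .seq (.instr (.const 64 6)) <|
  .seq (.instr (.op .mul 66 5 4)) <| .seq (.instr (.op .add 64 64 66)) <|
  .seq (.instr (.op .mul 66 4 10)) <| .seq (.instr (.op .add 64 64 66)) <|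
  .seq (.instr (.op .add 65 64 6)) <| .seq (.instr (.op .add 65 65 7)) <|
  .seq (.instr (.op .add 65 65 8)) <| .seq (.instr (.op .add 65 65 9)) <|
  .seq (.instr (.op .mul 65 65 65)) <| .seq (.instr (.op .mul 65 65 65)) <|
  .seq (.instr (.op .add 64 64 5)) <|
  .seq (.instr (.op .mul 66 7 4)) <| .seq (.instr (.op .add 64 64 66)) (.instr (.const 66 0))

theorem exec_setup (I : CCOInstance) {W : ℕ} (hW : I.size ^ 4 < W) (hkn : I.k ≤ I.n) :
    Exec W setup (I.loaded (I.s ^ I.k) 0 0) 15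
      (I.loaded (I.s ^ I.k) (I.input.length + I.n + I.k * I.m) (I.size ^ 4)) := by
  have hsz := I.size_ge
  have hle := I.le_size
  have hss : 10 * I.size ≤ I.size * I.size := Nat.mul_le_mul_right _ hsz
  have hs4 : I.size * I.size * (I.size * I.size) < W := by
    calc _ = I.size ^ 4 := by ring
      _ < W := hW
  have hs2 : I.size * I.size ≤ I.size * I.size * (I.size * I.size) :=
    Nat.le_mul_of_pos_right _ (by omega)
  have hkm : I.k * I.m ≤ I.n * I.m := Nat.mul_le_mul_right _ hkn
  set b := 6 + I.n * I.m + I.m * I.s ^ I.k with hb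
  have hsize : I.size = b + I.s + I.k + I.B + I.ℓ := I.size_eq
  have h := Exec.seq (Exec.const' (W := W) (d := 64) (v := 6) (σ := I.loaded (I.s ^ I.k) 0 0)
      (by omega)) <|
    .seq (Exec.op' (o := .mul) (d := 66) (a := 5) (b := 4) (v := I.n * I.m)
      (by simp [loaded, Op.eval]) (by omega)) <|
    .seq (Exec.op' (o := .add) (d := 64) (a := 64) (b := 66) (v := 6 + I.n * I.m)
      (by simp [Op.eval]) (by omega)) <|
    .seq (Exec.op' (o := .mul) (d := 66) (a := 4) (b := 10) (v := I.m * I.s ^ I.k)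
      (by simp [loaded, Op.eval]) (by omega)) <|
    .seq (Exec.op' (o := .add) (d := 64) (a := 64) (b := 66) (v := b)
      (by simp [Op.eval, hb]) (by omega)) <|
    .seq (Exec.op' (o := .add) (d := 65) (a := 64) (b := 6) (v := b + I.s)
      (by simp [loaded, Op.eval]) (by omega)) <|
    .seq (Exec.op' (o := .add) (d := 65) (a := 65) (b := 7) (v := b + I.s + I.k)
      (by simp [loaded, Op.eval]) (by omega)) <|
    .seq (Exec.op' (o := .add) (d := 65) (a := 65) (b := 8) (v := b + I.s + I.k + I.B)
      (by simp [loaded, Op.eval]) (by omega)) <|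
    .seq (Exec.op' (o := .add) (d := 65) (a := 65) (b := 9) (v := I.size)
      (by simp [loaded, Op.eval, hsize]) (by omega)) <|
    .seq (Exec.op' (o := .mul) (d := 65) (a := 65) (b := 65) (v := I.size * I.size)
      (by simp [Op.eval]) (by omega)) <|
    .seq (Exec.op' (o := .mul) (d := 65) (a := 65) (b := 65) (v := I.size ^ 4)
      (by simp [Op.eval]; ring) hW) <|
    .seq (Exec.op' (o := .add) (d := 64) (a := 64) (b := 5) (v := b + I.n)
      (by simp [loaded, Op.eval]) (by omega)) <|
    .seq (Exec.op' (o := .mul) (d := 66) (a := 7) (b := 4) (v := I.k * I.m)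
      (by simp [loaded, Op.eval]) (by omega)) <|
    .seq (Exec.op' (o := .add) (d := 64) (a := 64) (b := 66) (v := b + I.n + I.k * I.m)
      (by simp [Op.eval]) (by omega)) <|
    Exec.const' (d := 66) (v := 0) (by omega)
  rw [I.length_input]
  refine h.congr (State.ext_setReg (fun r => ?_) rfl)
  simp only [State.setReg_reg, loaded]
  by_cases h66 : r = 66
  · subst h66; rfl
  by_cases h64 : r = 64
  · subst h64; rfl
  by_cases h65 : r = 65
  · subst h65; rfl
  simp only [h66, h64, h65, if_false]

end CCOInstance

/-! ### The number of guess vectors -/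

namespace CCOInstance

theorem two_pow_clog_le {x : ℕ} (hx : 1 ≤ x) : 2 ^ Nat.clog 2 x ≤ x ^ 2 := by
  rcases Nat.lt_or_ge 1 x with h | h
  · have h1 := Nat.pow_pred_clog_lt_self one_lt_two h
    have h2 := Nat.clog_pos one_lt_two h
    have h3 : Nat.clog 2 x = (Nat.clog 2 x).pred + 1 := (Nat.succ_pred_eq_of_pos h2).symm
    rw [h3, pow_succ, pow_two]
    nlinarith
  · obtain rfl : x = 1 := by omega
    simp

theorem two_pow_codeLen_le (I : CCOInstance) :
    2 ^ I.codeLen ≤ 4 ^ I.B * I.B ^ (4 * I.B) * I.n ^ (4 * I.k) := by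
  have hn := two_pow_clog_le (x := I.n) I.n_pos
  have h1 : (2 ^ Nat.clog 2 I.B) ^ (2 * I.B) ≤ I.B ^ (4 * I.B) := by
    rcases Nat.eq_zero_or_pos I.B with h | h
    · simp [h]
    · calc _ ≤ (I.B ^ 2) ^ (2 * I.B) := Nat.pow_le_pow_left (two_pow_clog_le h) _
        _ = _ := by rw [← pow_mul]; ring_nf
  have h2 : (2 ^ Nat.clog 2 I.n) ^ (2 * I.k) ≤ I.n ^ (4 * I.k) := by
    calc _ ≤ (I.n ^ 2) ^ (2 * I.k) := Nat.pow_le_pow_left hn _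
      _ = _ := by rw [← pow_mul]; ring_nf
  calc 2 ^ I.codeLen
      = 4 ^ I.B * (2 ^ Nat.clog 2 I.B) ^ (2 * I.B) * (2 ^ Nat.clog 2 I.n) ^ (2 * I.k) := by
        rw [show (4 : ℕ) = 2 ^ 2 by norm_num]
        simp only [← pow_mul, ← pow_add, codeLen]
        congr 1
        ring
    _ ≤ _ := Nat.mul_le_mul (Nat.mul_le_mul_left _ h1) h2

theorem guessCount_eq (I : CCOInstance) : I.guessCount =
    I.n ^ I.k * I.k ^ I.B * I.B ^ (3 * I.B) * 3 ^ I.codeLen * I.s ^ (I.k * I.B) := by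
  have hblock : ∀ (a l x : ℕ), (∀ p, a ≤ p → p < a + l → I.radix p = x) →
      ∏ p ∈ range (a + l), I.radix p = (∏ p ∈ range a, I.radix p) * x ^ l := by
    intro a l x h
    rw [prod_range_add]
    congr 1
    rw [prod_congr rfl fun p hp => h (a + p) (by omega) (by have := mem_range.1 hp; omega)]
    simp
  rw [guessCount, guessLen, hblock _ _ I.s, hblock _ _ 3,
    show I.k + I.B + I.B + I.B + I.B = I.k + I.B + 3 * I.B by ring, hblock _ _ I.B,
    hblock _ _ I.k]
  · congr 5
    rw [prod_congr rfl fun p hp => show I.radix p = I.n from if_pos (mem_range.1 hp)]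
    simp
  · intro p h1 h2
    rw [radix, if_neg (by omega), if_pos h2]
  · intro p h1 h2
    rw [radix, if_neg (by omega), if_neg (by omega), if_pos (by omega)]
  · intro p h1 h2
    rw [radix, if_neg (by omega), if_neg (by omega), if_neg (by omega), if_pos h2]
  · intro p h1 h2
    rw [radix, if_neg (by omega), if_neg (by omega), if_neg (by omega), if_neg (by omega)]

theorem guessCount_le (I : CCOInstance) : I.guessCount ≤
    16 * (I.k * I.B) ^ (16 * (I.k * I.B)) * I.s ^ (I.k * I.B) * I.n ^ (9 * I.k) := by
  rw [guessCount_eq]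
  set K := I.k * I.B with hK
  have hk := I.k_pos
  have h3 : 3 ^ I.codeLen ≤ 16 ^ I.B * I.B ^ (8 * I.B) * I.n ^ (8 * I.k) := by
    calc 3 ^ I.codeLen ≤ 4 ^ I.codeLen := Nat.pow_le_pow_left (by norm_num) _
      _ = (2 ^ I.codeLen) ^ 2 := by
        rw [show (4 : ℕ) = 2 ^ 2 by norm_num, ← pow_mul, ← pow_mul, Nat.mul_comm]
      _ ≤ (4 ^ I.B * I.B ^ (4 * I.B) * I.n ^ (4 * I.k)) ^ 2 :=
        Nat.pow_le_pow_left I.two_pow_codeLen_le _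
      _ = _ := by
        rw [mul_pow, mul_pow, show (16 : ℕ) = 4 ^ 2 by norm_num]
        simp only [← pow_mul]
        ring_nf
  have hmain : I.k ^ I.B * I.B ^ (3 * I.B) * (16 ^ I.B * I.B ^ (8 * I.B)) ≤ 16 * K ^ (16 * K) := by
    rcases Nat.eq_zero_or_pos I.B with h0 | h0
    · simp [hK, h0]
    have hkK : I.k ≤ K := Nat.le_mul_of_pos_right _ h0
    have hBK : I.B ≤ K := Nat.le_mul_of_pos_left _ hk
    have hK1 : 1 ≤ K := h0.trans_le hBK
    have hpow : ∀ x e e', x ≤ K → e ≤ e' → x ^ e ≤ K ^ e' := fun x e e' hx he =>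
      (Nat.pow_le_pow_left hx e).trans (Nat.pow_le_pow_right hK1 he)
    have h16 : 16 ^ I.B ≤ 16 * K ^ (4 * K) := by
      rcases Nat.lt_or_ge 1 K with h | h
      · calc 16 ^ I.B ≤ 16 ^ K := Nat.pow_le_pow_right (by norm_num) hBK
          _ = 2 ^ (4 * K) := by rw [show (16 : ℕ) = 2 ^ 4 by norm_num, ← pow_mul]
          _ ≤ K ^ (4 * K) := Nat.pow_le_pow_left h _
          _ ≤ _ := Nat.le_mul_of_pos_left _ (by norm_num)
      · have hB1 : I.B = 1 := by omega
        have hK1' : K = 1 := by omega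
        rw [hB1, hK1']
        norm_num
    calc _ ≤ K ^ K * K ^ (3 * K) * (16 * K ^ (4 * K) * K ^ (8 * K)) :=
          Nat.mul_le_mul (Nat.mul_le_mul (hpow _ _ _ hkK hBK) (hpow _ _ _ hBK (by omega)))
            (Nat.mul_le_mul h16 (hpow _ _ _ hBK (by omega)))
      _ = 16 * K ^ (K + 3 * K + (4 * K + 8 * K)) := by simp only [pow_add]; ring
      _ = _ := by congr 2; ring
  calc I.n ^ I.k * I.k ^ I.B * I.B ^ (3 * I.B) * 3 ^ I.codeLen * I.s ^ K
      ≤ I.n ^ I.k * I.k ^ I.B * I.B ^ (3 * I.B) *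
          (16 ^ I.B * I.B ^ (8 * I.B) * I.n ^ (8 * I.k)) * I.s ^ K :=
        Nat.mul_le_mul_right _ (Nat.mul_le_mul_left _ h3)
    _ = (I.k ^ I.B * I.B ^ (3 * I.B) * (16 ^ I.B * I.B ^ (8 * I.B))) * I.s ^ K *
          (I.n ^ I.k * I.n ^ (8 * I.k)) := by ring
    _ ≤ 16 * K ^ (16 * K) * I.s ^ K * I.n ^ (9 * I.k) := by
        rw [← pow_add, show I.k + 8 * I.k = 9 * I.k by ring]
        exact Nat.mul_le_mul_right _ (Nat.mul_le_mul_right _ hmain)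

/-- A bound for all loops of the program over a range other than that of the rows. -/
def loopBound (I : CCOInstance) : ℕ := I.guessLen + I.n

theorem loopBound_le (I : CCOInstance) (hkn : I.k ≤ I.n) :
    I.loopBound ^ 3 ≤ 20 ^ 3 * (I.k * I.B) ^ (6 * (I.k * I.B)) * I.n ^ (6 * I.k) := by
  set K := I.k * I.B with hK
  have hk := I.k_pos
  have hn := I.n_pos
  have hcB : Nat.clog 2 I.B ≤ I.B := Nat.clog_le_of_le_pow Nat.lt_two_pow_self.le
  have hcn : Nat.clog 2 I.n ≤ I.n := Nat.clog_le_of_le_pow Nat.lt_two_pow_self.le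
  have h2 : I.k * Nat.clog 2 I.n ≤ I.n * I.n := Nat.mul_le_mul hkn hcn
  have hnn : I.n ≤ I.n * I.n := Nat.le_mul_of_pos_left _ hn
  have hn6 : I.n ^ 6 ≤ I.n ^ (6 * I.k) := Nat.pow_le_pow_right hn (by omega)
  rcases Nat.eq_zero_or_pos I.B with h0 | h0
  · have h1 : I.loopBound ≤ 20 * I.n ^ 2 := by
      rw [loopBound, guessLen, codeLen, h0, pow_two]
      omega
    have h3 : K = 0 := by simp [hK, h0]
    rw [h3, Nat.mul_zero, pow_zero, Nat.mul_one]
    calc I.loopBound ^ 3 ≤ (20 * I.n ^ 2) ^ 3 := Nat.pow_le_pow_left h1 _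
      _ = 20 ^ 3 * I.n ^ 6 := by ring
      _ ≤ _ := Nat.mul_le_mul_left _ hn6
  · have hBK : I.B ≤ K := Nat.le_mul_of_pos_left _ hk
    have hKK : K ≤ K * K := Nat.le_mul_of_pos_left _ (h0.trans_le hBK)
    have hB : I.B * (2 + 2 * Nat.clog 2 I.B) ≤ K * (2 + 2 * K) := Nat.mul_le_mul hBK (by omega)
    have hB' : K * (2 + 2 * K) = 2 * K + 2 * (K * K) := by ring
    have hX : K * K ≤ (K * K) * (I.n * I.n) := Nat.le_mul_of_pos_right _ (Nat.mul_pos hn hn)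
    have hX' : I.n * I.n ≤ (K * K) * (I.n * I.n) :=
      Nat.le_mul_of_pos_left _ (Nat.mul_pos (h0.trans_le hBK) (h0.trans_le hBK))
    have h1 : I.loopBound ≤ 20 * ((K * K) * (I.n * I.n)) := by
      rw [loopBound, guessLen, codeLen]
      omega
    have hK6 : K ^ 6 ≤ K ^ (6 * K) :=
      Nat.pow_le_pow_right (h0.trans_le hBK) (by have := h0.trans_le hBK; omega)
    calc I.loopBound ^ 3 ≤ (20 * ((K * K) * (I.n * I.n))) ^ 3 := Nat.pow_le_pow_left h1 _
      _ = 20 ^ 3 * K ^ 6 * I.n ^ 6 := by ring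
      _ ≤ _ := Nat.mul_le_mul (Nat.mul_le_mul_left _ hK6) hn6

end CCOInstance

/-! ### The machine program -/

namespace CCOInstance

open Imp Ex Cm

variable {I : CCOInstance} {S : HState}

theorem le_size_of_mem_input {x : ℕ} (hx : x ∈ I.input) : x ≤ I.size := by
  have hle := I.le_size
  have hsz := I.size_ge
  simp only [input, List.mem_append, List.mem_ofFn', Set.mem_range] at hx
  rcases hx with (hx | ⟨p, rfl⟩) | ⟨p, rfl⟩
  · simp only [List.mem_cons, List.not_mem_nil, or_false] at hx
    omega
  · exact ((I.A _ _).2.le).trans hle.2.2.1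
  · split_ifs <;> omega

theorem startState_bdd (hkn : I.k ≤ I.n) : I.startState.Bdd (I.size ^ 4) := by
  have hle := I.le_size
  have hsz := I.size_ge
  have hlen := I.length_input
  have h4 : I.size * 1000 ≤ I.size ^ 4 := by
    rw [pow_succ']
    exact Nat.mul_le_mul_left _ (Nat.pow_le_pow_left hsz 3)
  have hkm : I.k * I.m ≤ I.n * I.m := Nat.mul_le_mul_right _ hkn
  refine ⟨fun x => ?_, fun _ _ => Nat.zero_le _, fun a => ?_, ?_, le_rfl⟩
  · cases x <;> simp only [startState] <;> omega
  · change I.input.getD a 0 ≤ _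
    rcases Nat.lt_or_ge a I.input.length with h | h
    · rw [List.getD_eq_getElem _ _ h]
      have := le_size_of_mem_input (List.getElem_mem h)
      omega
    · rw [List.getD_eq_default _ _ h]
      exact Nat.zero_le _
  · change I.input.length + I.n + I.k * I.m ≤ _
    omega

/-- The part of the program that presupposes `k ≤ n`. -/
def mainProg : WordRAM.Prog :=
  .seq power <| .seq setup <| .seq layout.code <| .seq radices.code <|
  .seq (.while Var.zero.reg Var.go.reg searchRound.code) <|
  .ite Var.zero.reg Var.ans.reg output.code .skip

/-- The program: there is no solution if `n < k`; otherwise all guess vectors are tried. Registers `5`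
and `7` hold `n` and `k`. -/
def prog : WordRAM.Prog := .seq loads (.ite 5 7 .skip mainProg)

/-- The constant factor of the running time, relative to the number of guess vectors and the numbers
of iterations of the loops. -/
def stepConst : ℕ := layout.cst + radices.cst + searchRound.cst + output.cst + 40

/-- Bounds for the variables that limit loops. -/
def varBound (I : CCOInstance) (y : Var) : ℕ := if y = .m then I.m else I.loopBound

theorem wf_layout_loopVars : layout.wf 12 [.m, .n, .B] := by decide +kernel
theorem wf_radices_loopVars : radices.wf 12 loopVars := by decide +kernel
theorem wf_output_loopVars : output.wf 12 loopVars := by decide +kernel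

theorem reg_le_varBound (h : Layout I S) : ∀ y ∈ loopVars, S.reg y ≤ I.varBound y := by
  have h1 := h.m
  have h2 := h.n
  have h3 := h.k
  have h4 := h.B
  have h5 := h.L
  have h6 := h.T
  intro y hy
  simp only [loopVars, List.mem_cons, List.not_mem_nil, or_false] at hy
  rcases hy with rfl | rfl | rfl | rfl | rfl | rfl <;>
    simp only [varBound, loopBound, guessLen, if_true, reduceCtorEq, if_false] <;> omega

theorem time_le_loopBound (I : CCOInstance) {p : Cm} (hz : p.dz ≤ 3) (hm : p.dm ≤ 2) :
    p.time I.varBound ≤ p.cst * (I.loopBound ^ 3 * I.m ^ 2) := by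
  have hZ : 1 ≤ I.loopBound := by have := I.n_pos; unfold loopBound; omega
  refine (time_le (Z := I.loopBound) hZ (I.m_pos) (fun b hb => by simp [varBound, hb]) p).trans
    (Nat.mul_le_mul_left _ ?_)
  exact Nat.mul_le_mul (Nat.pow_le_pow_right hZ hz) (Nat.pow_le_pow_right I.m_pos hm)

theorem guessCount_pos (I : CCOInstance) : 0 < I.guessCount :=
  (Nat.zero_le _).trans_lt (mixedVal_lt _ I.search_start.lt)

/-- The state reached by the output commands holds the correct answer. -/
theorem correctOutput_of_found (h : Found I S) (h1 : S.reg .out1 = I.input.length)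
    (h2 : S.reg .out2 = I.input.length + I.n)
    (hbase : S.base = I.input.length + I.n + I.k * I.m) :
    I.CorrectOutput (if S.reg .ans = 1 then output.run S else S).conc := by
  rcases h.ans with ⟨ha, hv⟩ | ⟨ha, hno⟩
  · rw [if_pos ha]
    obtain ⟨O, cl, c, hsol, hO, hcl, hc⟩ := hv.exists_isSolution
    obtain ⟨o1, o2⟩ := run_output h.toEnv hv h1 h2 hbase
    have hreg : ∀ y ∈ fixedVars, (output.run S).reg y = S.reg y := fun y hy =>
      run_reg _ _ (notMem_wv hy _ wf_output)
    have hb : (output.run S).base = I.input.length + I.n + I.k * I.m := by rw [run_base, hbase]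
    have e1 : (output.run S).conc.reg 1 = I.input.length := by
      rw [← h1, ← hreg .out1 (by decide)]
      exact HState.conc_reg _ .out1
    have e2 : (output.run S).conc.reg 2 = I.input.length + I.n := by
      rw [← h2, ← hreg .out2 (by decide)]
      exact HState.conc_reg _ .out2
    have e0 : (output.run S).conc.reg 0 = 1 := by
      rw [← ha, ← run_reg output S (y := .ans) (by decide +kernel)]
      exact HState.conc_reg _ .ans
    have hlab : ∀ j : Fin I.n, (output.run S).conc.mem ((output.run S).conc.reg 1 + (j : ℕ)) =
        S.arr .lab j := fun j => by
      rw [e1, HState.conc_mem_low _ (by rw [hb]; have := j.2; omega), o1 j j.2]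
    refine ⟨fun _ => ⟨e0, O, cl, c, hsol, fun j hj => ?_, fun i j hj => ?_, fun i x => ?_⟩,
      fun hno => absurd ⟨O, cl, c, hsol⟩ hno⟩
    · rw [hlab, hO j hj]
    · rw [hlab, hcl i j hj]
    · have hix : (i : ℕ) * I.m + x < I.k * I.m := by
        have := Nat.mul_le_mul_right I.m (Nat.succ_le_of_lt i.2)
        rw [Nat.succ_mul] at this
        have := x.2
        omega
      rw [e2, HState.conc_mem_low _ (by rw [hb]; omega), o2 i i.2 x x.2, hc]
  · rw [if_neg (by omega)]
    exact ⟨fun hy => absurd hy hno, fun _ => (HState.conc_reg S .ans).trans ha⟩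

/-- The additional `14` steps are those of `loads` and of the test of `n < k`. -/
theorem exec_mainProg (I : CCOInstance) {W : ℕ} (hkn : I.k ≤ I.n) (hW : I.size ^ 48 ≤ W) :
    ∃ t σ, WordRAM.Exec W mainProg (I.loaded 0 0 0) t σ ∧ I.CorrectOutput σ ∧
      t + 14 ≤ stepConst * (I.guessCount * (I.loopBound ^ 3 * I.m ^ 2)) := by
  have hsz := I.size_ge
  have hpow : ∀ e < 48, I.size ^ e < W := fun e he =>
    (Nat.pow_lt_pow_right (by omega) he).trans_le hW
  have hY : 16 ≤ I.size ^ 4 :=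
    (by norm_num : 16 ≤ 10 ^ 4).trans (Nat.pow_le_pow_left hsz 4)
  have hYW : (I.size ^ 4) ^ 12 ≤ W := by rw [← pow_mul]; exact hW
  have hE1 := I.exec_power (hpow 2 (by norm_num))
  have hE2 := I.exec_setup (hpow 4 (by norm_num)) hkn
  rw [← conc_startState] at hE2
  have hB0 := I.startState_bdd hkn
  obtain ⟨hL, ho1, ho2, -⟩ := I.run_layout
  have hρ0 : ∀ y ∈ [Var.m, .n, .B], I.startState.reg y ≤ I.varBound y := by
    intro y hy
    simp only [List.mem_cons, List.not_mem_nil, or_false] at hy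
    rcases hy with rfl | rfl | rfl <;>
      simp only [startState, varBound, loopBound, guessLen, if_true, reduceCtorEq, if_false] <;>
      omega
  obtain ⟨t3, ht3, hE3⟩ := Cm.exec_code (by norm_num) hY hYW layout hB0 wf_layout_loopVars hρ0
  have hB1 := Cm.Bdd.run layout hB0 wf_layout_loopVars
  have hb1 : (layout.run I.startState).base = I.input.length + I.n + I.k * I.m :=
    run_base layout I.startState
  obtain ⟨t4, ht4, hE4⟩ := Cm.exec_code (by norm_num) hY hYW radices hB1 wf_radices_loopVars
    (reg_le_varBound hL)
  have hB2 := Cm.Bdd.run radices hB1 wf_radices_loopVars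
  have hf2 : ∀ y ∈ fixedVars, (radices.run (layout.run I.startState)).reg y =
      (layout.run I.startState).reg y := fun y hy => run_reg _ _ (notMem_wv hy _ wf_radices)
  have hb2 := run_base radices (layout.run I.startState)
  have hS := I.search_start
  obtain ⟨t5, ht5, S', hF, hB', hf', hb', hE5⟩ := exec_search hY hYW (ρ := I.varBound) I.guessCount
    (Nat.zero_add _) hS I.pending_zero hB2 (reg_le_varBound hS.toLayout)
  have hcor := correctOutput_of_found hF
    (by rw [hf' _ (by decide), hf2 _ (by decide), ho1])
    (by rw [hf' _ (by decide), hf2 _ (by decide), ho2]) (by rw [hb', hb2, hb1])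
  have hE6 : ∃ t ≤ output.time I.varBound + 1,
      WordRAM.Exec W (.ite Var.zero.reg Var.ans.reg output.code .skip) S'.conc t
        (if S'.reg .ans = 1 then output.run S' else S').conc := by
    have hz : S'.conc.reg Var.zero.reg = 0 := by rw [HState.conc_reg, hF.zero]
    by_cases ha : S'.reg .ans = 1
    · rw [if_pos ha]
      obtain ⟨t6, ht6, hE6⟩ := Cm.exec_code (by norm_num) hY hYW output hB' wf_output_loopVars
        (reg_le_varBound hF.toLayout)
      exact ⟨t6 + 1, by omega, .ite_true (by rw [hz, HState.conc_reg, ha]; exact Nat.one_pos) hE6⟩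
    · rw [if_neg ha]
      refine ⟨0 + 1, by omega, .ite_false ?_ (.skip _)⟩
      rcases hF.ans with ⟨h, -⟩ | ⟨h, -⟩
      · exact absurd h ha
      · rw [hz, HState.conc_reg, h]
        exact lt_irrefl _
  obtain ⟨t6, ht6, hE6⟩ := hE6
  refine ⟨_, _, .seq hE1 <| .seq hE2 <| .seq hE3 <| .seq hE4 <| .seq hE5 hE6, hcor, ?_⟩
  have c1 := I.time_le_loopBound (p := layout) (by decide +kernel) (by decide +kernel)
  have c2 := I.time_le_loopBound (p := radices) (by decide +kernel) (by decide +kernel)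
  have c3 := I.time_le_loopBound (p := searchRound) dz_round.le dm_round.le
  have c4 := I.time_le_loopBound (p := output) (by decide +kernel) (by decide +kernel)
  have hG := I.guessCount_pos
  have hkZ : I.k ≤ I.loopBound := by unfold loopBound; omega
  have hZ1 : 1 ≤ I.loopBound := I.k_pos.trans_le hkZ
  have hkX : I.k ≤ I.loopBound ^ 3 * I.m ^ 2 :=
    (hkZ.trans (Nat.le_self_pow (by norm_num) _)).trans
      (Nat.le_mul_of_pos_right _ (Nat.pow_pos I.m_pos))
  have hk1 := I.k_pos
  unfold stepConst
  revert c1 c2 c3 c4 ht3 ht4 ht5 ht6 hkX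
  generalize I.loopBound ^ 3 * I.m ^ 2 = X
  generalize layout.cst = a1
  generalize radices.cst = a2
  generalize searchRound.cst = a3
  generalize output.cst = a4
  generalize layout.time I.varBound = b1
  generalize radices.time I.varBound = b2
  generalize searchRound.time I.varBound = b3
  generalize output.time I.varBound = b4
  generalize I.guessCount = G at hG
  intro ht3 ht4 ht5 ht6 c1 c2 c3 c4 hkX
  have hGX : X ≤ G * X := Nat.le_mul_of_pos_left _ hG
  have d1 : a1 * X ≤ a1 * (G * X) := Nat.mul_le_mul_left _ hGX
  have d2 : a2 * X ≤ a2 * (G * X) := Nat.mul_le_mul_left _ hGX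
  have d4 : a4 * X ≤ a4 * (G * X) := Nat.mul_le_mul_left _ hGX
  have d3 : G * (b3 + 1) ≤ a3 * (G * X) + G * X := by
    calc G * (b3 + 1) ≤ G * (a3 * X + X) := Nat.mul_le_mul_left _ (by omega)
      _ = _ := by ring
  simp only [Nat.add_mul]
  omega

/-- The estimate of the running time in the form of the theorem. -/
theorem steps_le (I : CCOInstance) (hkn : I.k ≤ I.n) {c : ℕ} (hc : 16 * 20 ^ 3 * stepConst ≤ c)
    (hc' : 48 ≤ c) :
    stepConst * (I.guessCount * (I.loopBound ^ 3 * I.m ^ 2)) ≤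
      c * (I.k * I.B) ^ (c * (I.k * I.B)) * I.s ^ (I.k * I.B) * I.n ^ (c * I.k) * I.m ^ 2 := by
  have h1 := I.guessCount_le
  have h2 := I.loopBound_le hkn
  set K := I.k * I.B with hK
  have hKK : K ^ (22 * K) ≤ K ^ (c * K) := by
    rcases Nat.eq_zero_or_pos K with h | h
    · simp [h]
    · exact Nat.pow_le_pow_right h (Nat.mul_le_mul_right _ (by omega))
  have hn : I.n ^ (15 * I.k) ≤ I.n ^ (c * I.k) :=
    Nat.pow_le_pow_right I.n_pos (Nat.mul_le_mul_right _ (by omega))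
  calc stepConst * (I.guessCount * (I.loopBound ^ 3 * I.m ^ 2))
      ≤ stepConst * ((16 * K ^ (16 * K) * I.s ^ K * I.n ^ (9 * I.k)) *
          ((20 ^ 3 * K ^ (6 * K) * I.n ^ (6 * I.k)) * I.m ^ 2)) :=
        Nat.mul_le_mul_left _ (Nat.mul_le_mul h1 (Nat.mul_le_mul_right _ h2))
    _ = (16 * 20 ^ 3 * stepConst) * (K ^ (16 * K) * K ^ (6 * K)) * I.s ^ K *
          (I.n ^ (9 * I.k) * I.n ^ (6 * I.k)) * I.m ^ 2 := by ring
    _ = (16 * 20 ^ 3 * stepConst) * K ^ (22 * K) * I.s ^ K * I.n ^ (15 * I.k) * I.m ^ 2 := by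
        rw [← pow_add, ← pow_add, ← Nat.add_mul, ← Nat.add_mul]
    _ ≤ _ := Nat.mul_le_mul_right _ (Nat.mul_le_mul (Nat.mul_le_mul_right _
        (Nat.mul_le_mul hc hKK)) hn)

end CCOInstance

theorem theorem3 :
    ∃ (P : WordRAM.Prog) (c : ℕ), ∀ (I : CCOInstance) (W : ℕ), I.size ^ c ≤ W →
      ∃ (t : ℕ) (σ : WordRAM.State),
        WordRAM.Exec W P (WordRAM.init I.input) t σ ∧
        I.CorrectOutput σ ∧
        t ≤ c * (I.k * I.B) ^ (c * (I.k * I.B)) * I.s ^ (I.k * I.B) * I.n ^ (c * I.k) * I.m ^ 2 := by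
  obtain ⟨c, hc, hc'⟩ : ∃ c, 16 * 20 ^ 3 * CCOInstance.stepConst ≤ c ∧ 48 ≤ c :=
    ⟨_, le_max_left _ 48, le_max_right _ _⟩
  refine ⟨CCOInstance.prog, c, fun I W hW => ?_⟩
  have hsz := I.size_ge
  have hW' : I.size ^ 48 ≤ W := (Nat.pow_le_pow_right (by omega) hc').trans hW
  have h6 : 6 ≤ W := by
    have := Nat.le_self_pow (n := 48) (by norm_num) I.size
    omega
  have hE := I.exec_loads h6
  by_cases hkn : I.k ≤ I.n
  · obtain ⟨t, σ, h1, h2, h3⟩ := I.exec_mainProg hkn hW'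
    refine ⟨13 + (t + 1), σ, .seq hE (.ite_false (not_lt.2 hkn) h1), h2, ?_⟩
    have h4 := I.steps_le hkn hc hc'
    omega
  · refine ⟨13 + (0 + 1), _, .seq hE (.ite_true (not_le.1 hkn) (.skip _)),
      ⟨fun h => absurd (CCOInstance.k_le_n_of_isYes h) hkn, fun _ => rfl⟩, ?_⟩
    have hK : 1 ≤ (I.k * I.B) ^ (c * (I.k * I.B)) := by
      rcases Nat.eq_zero_or_pos (I.k * I.B) with h | h
      · simp [h]
      · exact Nat.pow_pos h
    have hs : 1 ≤ I.s ^ (I.k * I.B) := Nat.pow_pos I.s_pos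
    have hn : 1 ≤ I.n ^ (c * I.k) := Nat.pow_pos I.n_pos
    have hm : 1 ≤ I.m ^ 2 := Nat.pow_pos I.m_pos
    calc 13 + (0 + 1) ≤ c * 1 * 1 * 1 * 1 := by omega
      _ ≤ _ := Nat.mul_le_mul (Nat.mul_le_mul (Nat.mul_le_mul (Nat.mul_le_mul_left _ hK) hs) hn) hm
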